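/- **Model.** Let $\mathcal K_1,\mathcal K_2$ be disjoint finite index sets, $\mathcal K=\mathcal K_1\cup\mathcal K_2$; let $\alpha>2$, ${\tt N}_0\ge 0$, $P_k,\tau_k>0$ for $k\in\mathcal K$, $\lambda_k>0$ for $k\in\mathcal K_2$, and $\lambda_{{\rm p}_k},\bar m_k>0$ and a probability density $g_k$ on $\mathbb R^2$ for $k\in\mathcal K_1$. For $k\in\mathcal K_2$ let $\Phi_k$ be a homogeneous Poisson point process (PPP) on $\mathbb R^2$ with intensity $\lambda_k$. For $k\in\mathcal K_1$ let $\Phi_k=\bigcup_{{\bf z}\in\Phi_{{\rm p}_k}}({\bf z}+\mathcal B_k^{\bf z})$ be a Poisson cluster process, where each $\mathcal B_k^{\bf z}$ consists of a ${\tt Poisson}(\bar m_k)$ number of i.i.d. points with density $g_k$, and where the parent process $\Phi_{{\rm p}_k}$ is a homogeneous PPP with intensity $\lambda_{{\rm p}_k}$, except that (if the users are coupled to the base stations) for one tier $q\in\mathcal K_1$ it is such a PPP together with one additional random point ${\bf z}_0$ of arbitrary law. Each point ${\bf x}$ of each $\Phi_k$ (a base station) carries a fading variable $h_{\bf x}\sim\exp(1)$.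 All PPPs, ${\bf z}_0$, cluster sizes, offspring displacements and fading variables are independent. The user is at the origin and is served by the base station ${\bf x}^*$ that maximizes $P_k\|{\bf x}\|^{-\alpha}$ over ${\bf x}\in\Phi_k$, $k\in\mathcal K$; $\mathcal S_i$ is the event that ${\bf x}^*\in\Phi_i$, and on $\mathcal S_i$ $$\mathrm{SINR}({\bf x}^*)=\frac{P_ih_{{\bf x}^*}\|{\bf x}^*\|^{-\alpha}}{{\tt N}_0+\sum_{j\in\mathcal K}\sum_{{\bf x}\in\Phi_j\setminus\{{\bf x}^*\}}P_jh_{\bf x}\|{\bf x}\|^{-\alpha}}.$$ Put $\bar P_{j,k}=(P_j/P_k)^{1/\alpha}$. For $k\in\mathcal K_1$ and ${\bf z}\in\mathbb R^2$ let $f_{{\rm d}_k}(\cdot\,|{\bf z})$ be the probability density of $\|{\bf z}+{\bf s}\|$ when ${\bf s}$ has density $g_k$. For $j\in\mathcal K_1$, $k\in\mathcal K$, $r>0$ let $$\mathcal C_{j,k}(r,{\bf z})=\exp\Bigl(-\bar m_j\Bigl(1-\int_{\bar P_{j,k}r}^\infty\frac{f_{{\rm d}_j}(y|{\bf z})}{1+\tau_k(\bar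 P_{j,k}r)^\alpha/y^\alpha}\,dy\Bigr)\Bigr),$$ and let $$\rho(\tau,\alpha)=1+\tau^{2/\alpha}\int_{\tau^{-2/\alpha}}^\infty\frac{dt}{1+t^{\alpha/2}}.$$ **Statement.** Almost surely, the products over parent points below converge for all $r>0$, the sums over parent points converge for almost every $r>0$, the integrands below are integrable over $(0,\infty)$, and the conditional $i$-th tier coverage probability $\mathbb P(\mathrm{SINR}({\bf x}^*)>\tau_i,\mathcal S_i\mid\Phi_{{\rm p}_k},\,k\in\mathcal K_1)$ equals for $i\in\mathcal K_1$: $$\bar m_i\int_0^\infty e^{-\tau_i{\tt N}_0r^\alpha/P_i}\prod_{j_1\in\mathcal K_1\setminus\{i\}}\ \prod_{{\bf z}\in\Phi_{{\rm p}_{j_1}}}\mathcal C_{j_1,i}(r,{\bf z})\prod_{j_2\in\mathcal K_2}e^{-\pi r^2\lambda_{j_2}\bar P_{j_2,i}^2\rho(\tau_i,\alpha)}\Bigl(\sum_{{\bf z}\in\Phi_{{\rm p}_i}}f_{{\rm d}_i}(r|{\bf z})\Bigr)\Bigl(\prod_{{\bf z}\in\Phi_{{\rm p}_i}}\mathcal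 C_{i,i}(r,{\bf z})\Bigr)dr,$$ for $i\in\mathcal K_2$: $$2\pi\lambda_i\int_0^\infty e^{-\tau_i{\tt N}_0r^\alpha/P_i}\prod_{j_1\in\mathcal K_1}\ \prod_{{\bf z}\in\Phi_{{\rm p}_{j_1}}}\mathcal C_{j_1,i}(r,{\bf z})\prod_{j_2\in\mathcal K_2}e^{-\pi r^2\lambda_{j_2}\bar P_{j_2,i}^2\rho(\tau_i,\alpha)}\,r\,dr.$$ Moreover $\rho(\tau_i,\alpha)=1+\frac{2\tau_i}{\alpha-2}\,{}_2F_1\bigl[1,1-\tfrac2\alpha;2-\tfrac2\alpha;-\tau_i\bigr]$, where ${}_2F_1$ is the Gauss hypergeometric function, continued analytically to $(-\infty,1)$; and if $g_j$ is isotropic (a function of $\|{\bf s}\|$ only), then $f_{{\rm d}_j}(r|{\bf z})$ and $\mathcal C_{j,i}(r,{\bf z})$ depend on ${\bf z}$ only through $z=\|{\bf z}\|$. -/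

import Mathlib

open MeasureTheory ProbabilityTheory
open scoped ENNReal NNReal

noncomputable section

namespace HetNet

/-- The plane `ℝ²` with its Euclidean norm and Lebesgue measure. -/
abbrev Plane := EuclideanSpace ℝ (Fin 2)

/-- The counting measure of the points `x 0, x 1, …` (with multiplicity). -/
def config (x : ℕ → Plane) : Measure Plane := Measure.sum fun n => Measure.dirac (x n)

/-- The points `X 0, X 1, …` form a homogeneous Poisson point process in the plane with
intensity `c > 0`: the number of points in a Borel set `A` of finite area is Poisson with mean
`c * area A`, and the numbers of points in disjoint Borel sets are independent. As `c > 0` and the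
plane has infinite area, there are almost surely infinitely many points, so that they can be
enumerated by `ℕ`. -/
structure IsPoissonProcess {Ω : Type*} [MeasurableSpace Ω] (μ : Measure Ω) (c : ℝ≥0)
    (X : ℕ → Ω → Plane) : Prop where
  measurable : ∀ n, Measurable (X n)
  count_law : ∀ A : Set Plane, MeasurableSet A → volume A < ∞ →
    μ.map (fun ω => config (fun n => X n ω) A) =
      (poissonMeasure ((c : ℝ≥0∞) * volume A).toNNReal).map (Nat.cast : ℕ → ℝ≥0∞)
  count_indep : ∀ (N : ℕ) (A : Fin N → Set Plane), (∀ a, MeasurableSet (A a)) →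
    Pairwise (Function.onFun Disjoint A) →
    iIndepFun (fun a ω => config (fun n => X n ω) (A a)) μ

/-- The deterministic parameters of a `K`-tier network; `K₁` indexes the tiers that are Poisson
cluster processes and `K₂` the tiers that are Poisson processes. -/
structure Params (K₁ K₂ : Type*) where
  /-- transmit powers -/
  P : K₁ ⊕ K₂ → ℝ
  P_pos : ∀ k, 0 < P k
  /-- SINR thresholds -/
  τ : K₁ ⊕ K₂ → ℝ
  τ_pos : ∀ k, 0 < τ k
  /-- path-loss exponent -/
  α : ℝ
  two_lt_α : 2 < α
  /-- thermal noise power -/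
  N₀ : ℝ
  N₀_nonneg : 0 ≤ N₀
  /-- intensities of the parent Poisson processes -/
  lamP : K₁ → ℝ≥0
  lamP_pos : ∀ k, 0 < lamP k
  /-- mean numbers of points per cluster -/
  mbar : K₁ → ℝ≥0
  mbar_pos : ∀ k, 0 < mbar k
  /-- offspring densities on the plane -/
  g : K₁ → Plane → ℝ
  g_measurable : ∀ k, Measurable (g k)
  g_nonneg : ∀ k s, 0 ≤ g k s
  g_lintegral : ∀ k, ∫⁻ s, ENNReal.ofReal (g k s) = 1
  /-- intensities of the Poisson tiers -/
  lam : K₂ → ℝ≥0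
  lam_pos : ∀ k, 0 < lam k
  /-- `none` when the users are not coupled to the base stations; `some q` when the users are
  clustered around the parent points of tier `q`, so that tier `q` as seen by the typical user
  has an additional cluster, centred at the cluster centre of that user -/
  coupled : Option K₁

/-- Index set of all potential base stations: `inl (k, n, l)` is the `l`-th offspring of the
`n`-th cluster of the cluster tier `k`, and `inr (k, n)` is the `n`-th point of the Poisson
tier `k`. -/
abbrev BS (K₁ K₂ : Type*) := (K₁ × ℕ × ℕ) ⊕ (K₂ × ℕ)

/-- The tier of a base station. -/
def BS.tier {K₁ K₂ : Type*} : BS K₁ K₂ → K₁ ⊕ K₂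
  | .inl b => .inl b.1
  | .inr b => .inr b.1

/-- Names of the mutually independent sources of randomness. -/
inductive Source (K₁ K₂ : Type*)
  | parent (k : K₁)
  | userCenter
  | count (k : K₁) (n : ℕ)
  | offset (k : K₁) (n l : ℕ)
  | ppp (k : K₂)
  | fading (b : BS K₁ K₂)

/-- The random elements of the network, with the typical user at the origin. -/
structure Network {K₁ K₂ : Type*} {Ω : Type*} [MeasurableSpace Ω] (μ : Measure Ω)
    (p : Params K₁ K₂) where
  /-- the points of the parent Poisson process of tier `k` -/
  Z : K₁ → ℕ → Ω → Plane
  /-- the cluster centre of the typical user, of arbitrary law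
  (it plays a role only if `p.coupled = some q`) -/
  z₀ : Ω → Plane
  /-- number of offspring points of the `n`-th cluster of tier `k` -/
  M : K₁ → ℕ → Ω → ℕ
  /-- displacements of the offspring points from their cluster centre -/
  S : K₁ → ℕ → ℕ → Ω → Plane
  /-- the points of the Poisson tier `k` -/
  Y : K₂ → ℕ → Ω → Plane
  /-- the fading coefficients -/
  h : BS K₁ K₂ → Ω → ℝ
  Z_poisson : ∀ k, IsPoissonProcess μ (p.lamP k) (Z k)
  z₀_measurable : Measurable z₀
  M_measurable : ∀ k n, Measurable (M k n)
  M_law : ∀ k n, μ.map (M k n) = poissonMeasure (p.mbar k)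
  S_measurable : ∀ k n l, Measurable (S k n l)
  S_law : ∀ k n l, μ.map (S k n l) = volume.withDensity fun s => ENNReal.ofReal (p.g k s)
  Y_poisson : ∀ k, IsPoissonProcess μ (p.lam k) (Y k)
  h_measurable : ∀ b, Measurable (h b)
  h_law : ∀ b, μ.map (h b) = expMeasure 1
  indep : iIndep (fun s : Source K₁ K₂ =>
    match s with
    | .parent k => MeasurableSpace.comap (fun ω n => Z k n ω) inferInstance
    | .userCenter => MeasurableSpace.comap z₀ inferInstance
    | .count k n => MeasurableSpace.comap (M k n) inferInstance
    | .offset k n l => MeasurableSpace.comap (S k n l) inferInstance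
    | .ppp k => MeasurableSpace.comap (fun ω n => Y k n ω) inferInstance
    | .fading b => MeasurableSpace.comap (h b) inferInstance) μ

namespace Network

variable {K₁ K₂ : Type*} [DecidableEq K₁] {Ω : Type*} [MeasurableSpace Ω] {μ : Measure Ω}
  {p : Params K₁ K₂} (W : Network μ p)

/-- The `n`-th point of the parent point process of tier `k`, including the additional point `z₀`
(as the point number `0`) if the users are coupled to tier `k`. -/
def center (k : K₁) (n : ℕ) (ω : Ω) : Plane :=
  if p.coupled = some k then
    match n with
    | 0 => W.z₀ ω
    | n + 1 => W.Z k n ω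
  else W.Z k n ω

/-- The σ-algebra generated by all parent point processes (as random counting measures). -/
abbrev parentSigma : MeasurableSpace Ω :=
  ⨆ k : K₁, MeasurableSpace.comap (fun ω => config fun n => W.center k n ω) inferInstance

/-- The location of a base station. -/
def loc (b : BS K₁ K₂) (ω : Ω) : Plane :=
  match b with
  | .inl (k, n, l) => W.center k n ω + W.S k n l ω
  | .inr (k, n) => W.Y k n ω

/-- The potential base station `b` exists: the `n`-th cluster of tier `k` consists of the
offspring points number `0, …, M k n - 1`. -/
def Present (b : BS K₁ K₂) (ω : Ω) : Prop :=
  match b with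
  | .inl (k, n, l) => l < W.M k n ω
  | .inr _ => True

/-- The power received at the origin from `b`, averaged over the fading. -/
def avgPower (b : BS K₁ K₂) (ω : Ω) : ℝ := p.P b.tier * ‖W.loc b ω‖ ^ (-p.α)

/-- `b` is the serving base station: it offers the maximal average received power. -/
def IsServing (b : BS K₁ K₂) (ω : Ω) : Prop :=
  W.Present b ω ∧ ∀ b', W.Present b' ω → W.avgPower b' ω ≤ W.avgPower b ω

/-- The power received at the origin from `b`. -/
def rxPower (b : BS K₁ K₂) (ω : Ω) : ℝ≥0∞ :=
  ENNReal.ofReal (p.P b.tier * W.h b ω * ‖W.loc b ω‖ ^ (-p.α))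

open Classical in
/-- The signal to interference and noise ratio of the link from `b` to the origin. -/
def SINR (b : BS K₁ K₂) (ω : Ω) : ℝ≥0∞ :=
  W.rxPower b ω /
    (ENNReal.ofReal p.N₀ +
      ∑' b' : BS K₁ K₂, if b' ≠ b ∧ W.Present b' ω then W.rxPower b' ω else 0)

/-- The coverage event of tier `i`: the serving base station belongs to tier `i`, and its SINR
exceeds `τ i`. -/
def coverage (i : K₁ ⊕ K₂) : Set Ω :=
  {ω | ∃ b : BS K₁ K₂, b.tier = i ∧ W.IsServing b ω ∧ ENNReal.ofReal (p.τ i) < W.SINR b ω}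

end Network

namespace Params

variable {K₁ K₂ : Type*} (p : Params K₁ K₂)

/-- `(P j / P k) ^ (1 / α)` -/
def Pbar (j k : K₁ ⊕ K₂) : ℝ := (p.P j / p.P k) ^ (1 / p.α)

/-- The probability density at `r` of the distance from the origin to an offspring point of
tier `k` whose cluster centre is `z`. -/
def fd (k : K₁) (r : ℝ) (z : Plane) : ℝ :=
  (((volume.withDensity fun s => ENNReal.ofReal (p.g k s)).map fun s => ‖z + s‖).rnDeriv
    (volume : Measure ℝ) r).toReal

/-- The function `𝒞_{j,k}(r, z)`. -/
def C (j : K₁) (k : K₁ ⊕ K₂) (r : ℝ) (z : Plane) : ℝ :=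
  Real.exp (-(p.mbar j : ℝ) *
    (1 - ∫ y in Set.Ioi (p.Pbar (.inl j) k * r),
      p.fd j y z / (1 + p.τ k * ((p.Pbar (.inl j) k * r) ^ p.α / y ^ p.α))))

/-- The offspring points of tier `k` are isotropically distributed around the cluster centre. -/
def Isotropic (k : K₁) : Prop := ∀ s s' : Plane, ‖s‖ = ‖s'‖ → p.g k s = p.g k s'

end Params

/-- `ρ(τ, α) = 1 + τ^{2/α} ∫_{τ^{-2/α}}^∞ dt / (1 + t^{α/2})` -/
def rho (τ α : ℝ) : ℝ :=
  1 + τ ^ (2 / α) * ∫ t in Set.Ioi (τ ^ (-(2 / α))), 1 / (1 + t ^ (α / 2))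

/-- `F` is the Gauss hypergeometric function `x ↦ ₂F₁[a, b; c; x]` on `(-∞, 1)`, that is, the
analytic continuation to `(-∞, 1)` of the sum of the hypergeometric series on `(-1, 1)`. -/
def IsGaussHypergeometric (a b c : ℝ) (F : ℝ → ℝ) : Prop :=
  AnalyticOnNhd ℝ F (Set.Iio 1) ∧
    ∀ x ∈ Set.Ioo (-1 : ℝ) 1, F x = ordinaryHypergeometric a b c x

end HetNet

end

/-! Fix the cluster centres. A cluster is a Poisson number of i.i.d. points, hence a Poisson process
whose intensity is `mbar` times the shifted offspring law. By independence all base stations, marked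
with their tiers, then form one Poisson process with an explicit intensity measure Λ
(`Network.poissonLaplace`). All that is used of it is the Laplace functional E exp(-∑ v) = exp(-∫ (1
- e^{-v}) dΛ).

Consider a station of tier i at distance r. It serves exactly when no other station y lies closer
than P̄ r. With exponential fading it then overcomes noise and interference with probability e^{-τ
N₀ r^α / P_i} ∏ 1 / (1 + τ (P̄ r)^α / ‖y‖^α). Both requirements are products over the other
stations, so together they equal the noise factor times exp(-∑ v_r(y)) for a single function v_r,
the `attenuation`, infinite inside the exclusion disc (`Network.measure_covers`). Almost surely no
two stations tie, so coverage is a disjoint union over stations, and the Mecke formula evaluates its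
probability as an integral against Λ (`Network.measure_exists_covers`). The Mecke formula itself is
the derivative of the Laplace functional; the dependence of v_r on the chosen point is handled by
rounding r down to dyadic numbers.

As Λ is a sum over clusters and Poisson tiers, the exponential factorizes: each cluster gives a
factor `C`, each Poisson tier a factor with `rho`. The outer integral becomes an integral over the
serving distance.

The centres are independent of all else, so Fubini turns the formula for fixed centres into the
conditional probability. The conditioning σ-algebra knows only the counting measures of the centres,
not their enumeration; measurability is obtained by writing the formula as a limit built from
countably many integrals against Λ.

The closed form of `rho` is Euler's integral for ₂F₁[1, b; b + 1; x] with b = 1 - 2/α, analytic on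
(-∞, 1). -/

noncomputable section

namespace HetNet

open Filter Topology

/-! ### The function `exp (-t)` on `[0, ∞]` -/

/-- `exp (-t)` for `t ∈ [0, ∞]`, with `exp (-∞) = 0`. -/
def expNeg (t : ℝ≥0∞) : ℝ≥0∞ := EReal.exp (-(t : EReal))

@[simp] lemma expNeg_zero : expNeg 0 = 1 := by simp [expNeg]

@[simp] lemma expNeg_top : expNeg ∞ = 0 := by simp [expNeg]

lemma expNeg_ofReal {x : ℝ} (hx : 0 ≤ x) :
    expNeg (ENNReal.ofReal x) = ENNReal.ofReal (Real.exp (-x)) := by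
  rw [expNeg, EReal.coe_ennreal_ofReal, max_eq_left hx, ← EReal.coe_neg, EReal.exp_coe]

lemma expNeg_of_ne_top {t : ℝ≥0∞} (ht : t ≠ ∞) :
    expNeg t = ENNReal.ofReal (Real.exp (-t.toReal)) := by
  rw [← expNeg_ofReal ENNReal.toReal_nonneg, ENNReal.ofReal_toReal ht]

lemma expNeg_add (s t : ℝ≥0∞) : expNeg (s + t) = expNeg s * expNeg t := by
  rw [expNeg, EReal.coe_ennreal_add, EReal.neg_add, sub_eq_add_neg, EReal.exp_add, expNeg, expNeg]
  · left; exact EReal.coe_ennreal_ne_bot _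
  · right; exact EReal.coe_ennreal_ne_bot _

lemma antitone_expNeg : Antitone expNeg := fun s t h => by
  simpa [expNeg] using h

lemma continuous_expNeg : Continuous expNeg :=
  ENNReal.continuous_exp.comp (continuous_neg.comp continuous_coe_ennreal_ereal)

@[fun_prop]
lemma measurable_expNeg : Measurable expNeg := continuous_expNeg.measurable

lemma expNeg_le_one (t : ℝ≥0∞) : expNeg t ≤ 1 := by
  simpa using antitone_expNeg (zero_le : 0 ≤ t)

lemma expNeg_ne_top (t : ℝ≥0∞) : expNeg t ≠ ∞ := ((expNeg_le_one t).trans_lt ENNReal.one_lt_top).ne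

lemma expNeg_ne_zero {t : ℝ≥0∞} (ht : t ≠ ∞) : expNeg t ≠ 0 := by
  rw [expNeg_of_ne_top ht]
  simpa using Real.exp_pos _

lemma expNeg_sum {ι : Type*} (s : Finset ι) (f : ι → ℝ≥0∞) :
    expNeg (∑ i ∈ s, f i) = ∏ i ∈ s, expNeg (f i) := by
  classical
  induction s using Finset.induction_on with
  | empty => simp
  | insert a s ha ih => rw [Finset.sum_insert ha, Finset.prod_insert ha, expNeg_add, ih]

lemma expNeg_mul_natCast (t : ℝ≥0∞) (n : ℕ) : expNeg (t * n) = expNeg t ^ n := by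
  induction n with
  | zero => simp
  | succ n ih => rw [Nat.cast_succ, mul_add, expNeg_add, ih, pow_succ, mul_one]

lemma one_sub_expNeg_le (t : ℝ≥0∞) : 1 - expNeg t ≤ t := by
  rcases eq_or_ne t ∞ with rfl | ht
  · simp
  rw [expNeg_of_ne_top ht, ← ENNReal.ofReal_one, ← ENNReal.ofReal_sub _ (Real.exp_pos _).le]
  refine ENNReal.ofReal_le_of_le_toReal ?_
  have := Real.add_one_le_exp (-t.toReal)
  linarith

/-- Equivalent to e^{-x} ≤ 1 / (1 + x), that is, to 1 + x ≤ e^x. With `one_sub_expNeg_le` it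
squeezes n (1 - e^{-a/n}); it also drives the two-point estimate that excludes ties. -/
lemma div_one_add_le_one_sub_expNeg {t : ℝ≥0∞} (ht : t ≠ ∞) : t / (1 + t) ≤ 1 - expNeg t := by
  obtain ⟨x, rfl⟩ : ∃ x : ℝ≥0, t = x := ⟨t.toNNReal, (ENNReal.coe_toNNReal ht).symm⟩
  rw [expNeg_of_ne_top ht, ← ENNReal.ofReal_one, ← ENNReal.ofReal_sub _ (Real.exp_pos _).le,
    ← ENNReal.ofReal_coe_nnreal, ← ENNReal.ofReal_add zero_le_one x.coe_nonneg,
    ← ENNReal.ofReal_div_of_pos (by positivity), ENNReal.toReal_ofReal x.coe_nonneg]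
  refine ENNReal.ofReal_le_ofReal ?_
  have hx : (0 : ℝ) ≤ x := x.coe_nonneg
  have h1 := Real.add_one_le_exp (x : ℝ)
  have h2 : Real.exp (-(x : ℝ)) ≤ 1 / (1 + x) := by
    rw [Real.exp_neg, ← one_div]
    exact one_div_le_one_div_of_le (by positivity) (by linarith)
  have h3 : (x : ℝ) / (1 + x) = 1 - 1 / (1 + x) := by field_simp; ring
  linarith

/-- If `aₙ → I < ∞`, then `n (1 - exp (-aₙ / n)) → I`. -/
lemma tendsto_mul_one_sub_expNeg {a : ℕ → ℝ≥0∞} {I : ℝ≥0∞} (hI : I ≠ ∞) (ha : Tendsto a atTop (𝓝 I))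
    (hle : ∀ n, a n ≤ I) :
    Tendsto (fun n : ℕ => ((n + 1 : ℕ) : ℝ≥0∞) * (1 - expNeg (a n / (n + 1 : ℕ)))) atTop (𝓝 I) := by
  have hn0 : ∀ n : ℕ, ((n + 1 : ℕ) : ℝ≥0∞) ≠ 0 := fun n => by simp
  have hnt : ∀ n : ℕ, ((n + 1 : ℕ) : ℝ≥0∞) ≠ ∞ := fun n => ENNReal.natCast_ne_top _
  have hat : ∀ n, a n ≠ ∞ := fun n => ((hle n).trans_lt hI.lt_top).ne
  have hlow : Tendsto (fun n : ℕ => a n / (1 + a n / (n + 1 : ℕ))) atTop (𝓝 (I / (1 + 0))) := by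
    refine ENNReal.Tendsto.div ha (Or.inr (by simp)) (tendsto_const_nhds.add ?_) (Or.inr hI)
    have : Tendsto (fun n : ℕ => I / (n + 1 : ℕ)) atTop (𝓝 0) := by
      have h := (ENNReal.tendsto_inv_nat_nhds_zero.comp (tendsto_add_atTop_nat 1))
      simpa [div_eq_mul_inv, Function.comp_def] using
        ENNReal.Tendsto.const_mul (a := I) h (Or.inr hI)
    exact tendsto_of_tendsto_of_tendsto_of_le_of_le tendsto_const_nhds this (fun _ => zero_le)
      (fun n => ENNReal.div_le_div_right (hle n) _)
  rw [add_zero, div_one] at hlow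
  refine tendsto_of_tendsto_of_tendsto_of_le_of_le hlow ha (fun n => ?_) (fun n => ?_)
  · have h := div_one_add_le_one_sub_expNeg (ENNReal.div_ne_top (hat n) (hn0 n))
    calc a n / (1 + a n / (n + 1 : ℕ))
        = ((n + 1 : ℕ) : ℝ≥0∞) * ((a n / (n + 1 : ℕ)) / (1 + a n / (n + 1 : ℕ))) := by
          rw [← mul_div_assoc, ENNReal.mul_div_cancel (hn0 n) (hnt n)]
      _ ≤ _ := by gcongr
  · calc ((n + 1 : ℕ) : ℝ≥0∞) * (1 - expNeg (a n / (n + 1 : ℕ)))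
        ≤ ((n + 1 : ℕ) : ℝ≥0∞) * (a n / (n + 1 : ℕ)) := by gcongr; exact one_sub_expNeg_le _
      _ = a n := ENNReal.mul_div_cancel (hn0 n) (hnt n)

lemma mul_one_sub_expNeg_div_le (t : ℝ≥0∞) (n : ℕ) :
    ((n + 1 : ℕ) : ℝ≥0∞) * (1 - expNeg (t / (n + 1 : ℕ))) ≤ t := by
  calc ((n + 1 : ℕ) : ℝ≥0∞) * (1 - expNeg (t / (n + 1 : ℕ)))
      ≤ ((n + 1 : ℕ) : ℝ≥0∞) * (t / (n + 1 : ℕ)) := by gcongr; exact one_sub_expNeg_le _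
    _ = t := ENNReal.mul_div_cancel (by simp) (ENNReal.natCast_ne_top _)

/-- The value ∞ is needed because point sums may be infinite. -/
lemma tendsto_mul_one_sub_expNeg_const (t : ℝ≥0∞) :
    Tendsto (fun n : ℕ => ((n + 1 : ℕ) : ℝ≥0∞) * (1 - expNeg (t / (n + 1 : ℕ)))) atTop (𝓝 t) := by
  rcases eq_or_ne t ∞ with rfl | ht
  · have : ∀ n : ℕ, (∞ : ℝ≥0∞) / (n + 1 : ℕ) = ∞ := fun n =>
      ENNReal.top_div_of_ne_top (ENNReal.natCast_ne_top _)
    simp only [this, expNeg_top, tsub_zero, mul_one]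
    exact ENNReal.tendsto_nat_nhds_top.comp (tendsto_add_atTop_nat 1)
  · exact tendsto_mul_one_sub_expNeg ht tendsto_const_nhds fun _ => le_rfl

/-- Convergence of integrals for functions that converge to an upper bound. -/
lemma tendsto_lintegral_of_le_of_tendsto {α : Type*} [MeasurableSpace α] {μ : Measure α}
    {f : ℕ → α → ℝ≥0∞} {g : α → ℝ≥0∞} (hf : ∀ n, Measurable (f n)) (hle : ∀ n x, f n x ≤ g x)
    (hlim : ∀ x, Tendsto (fun n => f n x) atTop (𝓝 (g x))) :
    Tendsto (fun n => ∫⁻ x, f n x ∂μ) atTop (𝓝 (∫⁻ x, g x ∂μ)) := by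
  refine tendsto_of_le_liminf_of_limsup_le ?_ ?_
  · calc ∫⁻ x, g x ∂μ = ∫⁻ x, liminf (fun n => f n x) atTop ∂μ :=
          lintegral_congr fun x => (hlim x).liminf_eq.symm
      _ ≤ _ := lintegral_liminf_le hf
  · exact limsup_le_of_le (by isBoundedDefault)
      (Eventually.of_forall fun n => lintegral_mono (hle n))

/-! ### Point processes with the Laplace functional of a Poisson process -/

section Poisson

variable {Ω B E : Type*}

/-- The sum of `v` over the points `X b` that are present, i.e. for which `A b` occurs. -/
def pointSum (X : B → Ω → E) (A : B → Set Ω) (v : E → ℝ≥0∞) (ω : Ω) : ℝ≥0∞ :=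
  ∑' b, (A b).indicator (fun ω => v (X b ω)) ω

variable {X : B → Ω → E} {A : B → Set Ω}

lemma pointSum_add (v w : E → ℝ≥0∞) (ω : Ω) :
    pointSum X A (fun y => v y + w y) ω = pointSum X A v ω + pointSum X A w ω := by
  simp only [pointSum]
  rw [← ENNReal.tsum_add]
  refine tsum_congr fun b => ?_
  by_cases h : ω ∈ A b <;> simp [h]

lemma pointSum_div (v : E → ℝ≥0∞) (c : ℝ≥0∞) (ω : Ω) :
    pointSum X A (fun y => v y / c) ω = pointSum X A v ω / c := by
  simp only [pointSum, div_eq_mul_inv]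
  rw [← ENNReal.tsum_mul_right]
  refine tsum_congr fun b => ?_
  by_cases h : ω ∈ A b <;> simp [h]

@[simp] lemma pointSum_zero (ω : Ω) : pointSum X A (fun _ => 0) ω = 0 := by
  simp [pointSum]

variable [MeasurableSpace Ω] [MeasurableSpace E] {μ : Measure Ω} {Λ : Measure E}

/-- The present points among `X b`, `b : B`, have the Laplace functional of a Poisson process with
intensity measure `Λ`. -/
structure PoissonLaplace (μ : Measure Ω) (X : B → Ω → E) (A : B → Set Ω) (Λ : Measure E) :
    Prop where
  measurable : ∀ b, Measurable (X b)
  measurableSet : ∀ b, MeasurableSet (A b)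
  laplace : ∀ v : E → ℝ≥0∞, Measurable v →
    ∫⁻ ω, expNeg (pointSum X A v ω) ∂μ = expNeg (∫⁻ y, (1 - expNeg (v y)) ∂Λ)

namespace PoissonLaplace

variable [Countable B]

lemma measurable_pointSum (h : PoissonLaplace μ X A Λ) {v : E → ℝ≥0∞} (hv : Measurable v) :
    Measurable (pointSum X A v) :=
  Measurable.tsum fun b => (hv.comp (h.measurable b)).indicator (h.measurableSet b)

/-- The Mecke formula, for a weight that depends on the other points through `exp (-∑ v)`. -/
theorem lintegral_pointSum_mul_expNeg (h : PoissonLaplace μ X A Λ) [IsProbabilityMeasure μ]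
    {v w : E → ℝ≥0∞}
    (hv : Measurable v) (hw : Measurable w) (hI : ∫⁻ y, expNeg (v y) * w y ∂Λ ≠ ∞) :
    ∫⁻ ω, expNeg (pointSum X A v ω) * pointSum X A w ω ∂μ =
      expNeg (∫⁻ y, (1 - expNeg (v y)) ∂Λ) * ∫⁻ y, expNeg (v y) * w y ∂Λ := by
  have hSv := h.measurable_pointSum hv
  have hSw := h.measurable_pointSum hw
  have he := measurable_expNeg
  -- The difference quotient of the Laplace functional L at v in the direction w, with step 1/c and
  -- c = n + 1: both sides are c (L(v) - L(v + w/c)). The exponent splits by 1 - e^{-v - w/c} = (1 -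
  -- e^{-v}) + e^{-v} (1 - e^{-w/c}).
  have key : ∀ n : ℕ, ∫⁻ ω, expNeg (pointSum X A v ω) *
        (((n + 1 : ℕ) : ℝ≥0∞) * (1 - expNeg (pointSum X A w ω / (n + 1 : ℕ)))) ∂μ =
      expNeg (∫⁻ y, (1 - expNeg (v y)) ∂Λ) * (((n + 1 : ℕ) : ℝ≥0∞) * (1 - expNeg
        ((∫⁻ y, expNeg (v y) * (((n + 1 : ℕ) : ℝ≥0∞) * (1 - expNeg (w y / (n + 1 : ℕ)))) ∂Λ) /
          (n + 1 : ℕ)))) := by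
    intro n
    have hn0 : ((n + 1 : ℕ) : ℝ≥0∞) ≠ 0 := by simp
    have hnt : ((n + 1 : ℕ) : ℝ≥0∞) ≠ ∞ := ENNReal.natCast_ne_top _
    generalize ((n + 1 : ℕ) : ℝ≥0∞) = c at hn0 hnt
    have hwc : Measurable fun y => w y / c := hw.div_const c
    have h1 : ∀ ω, expNeg (pointSum X A v ω) * (c * (1 - expNeg (pointSum X A w ω / c))) =
        c * (expNeg (pointSum X A v ω) - expNeg (pointSum X A (fun y => v y + w y / c) ω)) := by
      intro ω
      rw [pointSum_add, pointSum_div, expNeg_add, mul_left_comm, ENNReal.mul_sub, mul_one]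
      exact fun _ _ => expNeg_ne_top _
    have h2 : ∫⁻ y, (1 - expNeg (v y + w y / c)) ∂Λ = ∫⁻ y, (1 - expNeg (v y)) ∂Λ +
        (∫⁻ y, expNeg (v y) * (c * (1 - expNeg (w y / c))) ∂Λ) / c := by
      rw [div_eq_mul_inv, ← lintegral_mul_const _ (by fun_prop), ← lintegral_add_left (by fun_prop)]
      refine lintegral_congr fun y => ?_
      have e1 : expNeg (v y) * (c * (1 - expNeg (w y / c))) * c⁻¹ =
          expNeg (v y) - expNeg (v y) * expNeg (w y / c) := by
        rw [mul_left_comm, mul_comm c, mul_assoc, ENNReal.mul_inv_cancel hn0 hnt, mul_one,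
          ENNReal.mul_sub (fun _ _ => expNeg_ne_top _), mul_one]
      rw [e1, expNeg_add, tsub_add_tsub_cancel (expNeg_le_one _)]
      exact mul_le_of_le_one_right' (expNeg_le_one _)
    have hvw : Measurable fun y => v y + w y / c := hv.add hwc
    have hm : Measurable fun ω => expNeg (pointSum X A (fun y => v y + w y / c) ω) :=
      he.comp (h.measurable_pointSum hvw)
    simp_rw [h1]
    rw [lintegral_const_mul _ (by fun_prop), lintegral_sub hm, h.laplace v hv, h.laplace _ hvw]
    · rw [h2, expNeg_add, mul_left_comm, ENNReal.mul_sub (fun _ _ => expNeg_ne_top _), mul_one]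
    · refine ((lintegral_mono fun ω => expNeg_le_one _).trans_lt ?_).ne
      simp
    · refine Eventually.of_forall fun ω => antitone_expNeg ?_
      rw [pointSum_add]
      exact le_self_add
  have hlim1 : Tendsto (fun n : ℕ => ∫⁻ ω, expNeg (pointSum X A v ω) *
        (((n + 1 : ℕ) : ℝ≥0∞) * (1 - expNeg (pointSum X A w ω / (n + 1 : ℕ)))) ∂μ) atTop
      (𝓝 (∫⁻ ω, expNeg (pointSum X A v ω) * pointSum X A w ω ∂μ)) := by
    -- The quotients stay below their limit, so no integrability of the point sum is required;
    -- Campbell's formula is a consequence, not a prerequisite.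
    refine tendsto_lintegral_of_le_of_tendsto (fun n => by fun_prop) (fun n ω => ?_) (fun ω => ?_)
    · gcongr; exact mul_one_sub_expNeg_div_le _ _
    · exact ENNReal.Tendsto.const_mul (tendsto_mul_one_sub_expNeg_const _)
        (Or.inr (expNeg_ne_top _))
  have hle : ∀ (n : ℕ) (y : E), expNeg (v y) *
      (((n + 1 : ℕ) : ℝ≥0∞) * (1 - expNeg (w y / (n + 1 : ℕ)))) ≤ expNeg (v y) * w y :=
    fun n y => by gcongr; exact mul_one_sub_expNeg_div_le _ _
  have hlim2 : Tendsto (fun n : ℕ => ∫⁻ y, expNeg (v y) *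
        (((n + 1 : ℕ) : ℝ≥0∞) * (1 - expNeg (w y / (n + 1 : ℕ)))) ∂Λ) atTop
      (𝓝 (∫⁻ y, expNeg (v y) * w y ∂Λ)) := by
    refine tendsto_lintegral_of_le_of_tendsto (fun n => by fun_prop) hle (fun y => ?_)
    exact ENNReal.Tendsto.const_mul (tendsto_mul_one_sub_expNeg_const _)
        (Or.inr (expNeg_ne_top _))
  have hlim3 := ENNReal.Tendsto.const_mul (a := expNeg (∫⁻ y, (1 - expNeg (v y)) ∂Λ))
    (tendsto_mul_one_sub_expNeg hI hlim2 fun n => lintegral_mono (hle n))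
    (Or.inr (expNeg_ne_top _))
  exact tendsto_nhds_unique hlim1 (by simpa only [key] using hlim3)

/-- Campbell's formula. -/
theorem lintegral_pointSum (h : PoissonLaplace μ X A Λ) [IsProbabilityMeasure μ]
    {w : E → ℝ≥0∞} (hw : Measurable w) (hI : ∫⁻ y, w y ∂Λ ≠ ∞) :
    ∫⁻ ω, pointSum X A w ω ∂μ = ∫⁻ y, w y ∂Λ := by
  simpa using h.lintegral_pointSum_mul_expNeg (v := fun _ => 0) measurable_const hw (by simpa)

/-- No point lies in a null set of the intensity measure. -/
lemma ae_forall_notMem (h : PoissonLaplace μ X A Λ) [IsProbabilityMeasure μ] {s : Set E}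
    (hs : MeasurableSet s) (h0 : Λ s = 0) :
    ∀ᵐ ω ∂μ, ∀ b, ω ∈ A b → X b ω ∉ s := by
  have h1 : ∫⁻ y, s.indicator 1 y ∂Λ = 0 := by rw [lintegral_indicator_one hs, h0]
  have hm : Measurable (s.indicator (1 : E → ℝ≥0∞)) := measurable_one.indicator hs
  have h2 := h.lintegral_pointSum hm (by rw [h1]; simp)
  rw [h1, lintegral_eq_zero_iff (h.measurable_pointSum hm)] at h2
  filter_upwards [h2] with ω hω b hb hX
  have := ENNReal.tsum_eq_zero.1 hω b
  simp [hb, hX] at this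

end PoissonLaplace

end Poisson

/-! ### The Mecke formula for weights that vary with the chosen point -/

section Mecke

/-- `r` rounded down to a multiple of `2 ^ (-n)`. -/
def dyadicFloor (n : ℕ) (r : ℝ) : ℝ := ⌊2 ^ n * r⌋₊ / 2 ^ n

lemma dyadicFloor_nonneg (n : ℕ) (r : ℝ) : 0 ≤ dyadicFloor n r := by
  unfold dyadicFloor; positivity

lemma dyadicFloor_le (n : ℕ) {r : ℝ} (hr : 0 ≤ r) : dyadicFloor n r ≤ r := by
  rw [dyadicFloor, div_le_iff₀ (by positivity), mul_comm r]
  exact Nat.floor_le (by positivity)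

lemma tendsto_dyadicFloor {r : ℝ} (hr : 0 ≤ r) :
    Tendsto (fun n => dyadicFloor n r) atTop (𝓝 r) := by
  have h : Tendsto (fun n : ℕ => r - (1 / 2 : ℝ) ^ n) atTop (𝓝 (r - 0)) :=
    tendsto_const_nhds.sub (tendsto_pow_atTop_nhds_zero_of_lt_one (by norm_num) (by norm_num))
  rw [sub_zero] at h
  refine tendsto_of_tendsto_of_tendsto_of_le_of_le h tendsto_const_nhds (fun n => ?_)
    (fun n => dyadicFloor_le n hr)
  have := Nat.lt_floor_add_one (2 ^ n * r)
  rw [dyadicFloor, le_div_iff₀ (by positivity), sub_mul, ← mul_pow]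
  norm_num
  linarith

lemma tendsto_dyadicFloor_within {r : ℝ} (hr : 0 ≤ r) :
    Tendsto (fun n => dyadicFloor n r) atTop (𝓝[Set.Icc 0 r] r) :=
  tendsto_nhdsWithin_iff.2 ⟨tendsto_dyadicFloor hr,
    Eventually.of_forall fun n => ⟨dyadicFloor_nonneg n r, dyadicFloor_le n hr⟩⟩

variable {Ω B E : Type*}

open Classical in
/-- The sum of `v` over the present points other than the point number `b`. -/
def otherSum (X : B → Ω → E) (A : B → Set Ω) (v : E → ℝ≥0∞) (b : B) (ω : Ω) : ℝ≥0∞ :=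
  ∑' b', if b' = b then 0 else (A b').indicator (fun ω => v (X b' ω)) ω

variable {X : B → Ω → E} {A : B → Set Ω}

lemma pointSum_eq_add_otherSum (v : E → ℝ≥0∞) (b : B) (ω : Ω) :
    pointSum X A v ω = (A b).indicator (fun ω => v (X b ω)) ω + otherSum X A v b ω := by
  classical
  rw [pointSum, otherSum, ENNReal.tsum_eq_add_tsum_ite b]

/-- A series is an integral against counting measure, and an upper bound that is also the limit
makes summability unnecessary. -/
lemma tendsto_tsum_of_le_of_tendsto {f : ℕ → B → ℝ≥0∞} {g : B → ℝ≥0∞} (hle : ∀ n x, f n x ≤ g x)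
    (hlim : ∀ x, Tendsto (fun n => f n x) atTop (𝓝 (g x))) :
    Tendsto (fun n => ∑' b, f n b) atTop (𝓝 (∑' b, g b)) := by
  let _ : MeasurableSpace B := ⊤
  simp only [← lintegral_count]
  exact tendsto_lintegral_of_le_of_tendsto (fun n => measurable_from_top) hle hlim

variable [MeasurableSpace Ω] [MeasurableSpace E] {μ : Measure Ω} {Λ : Measure E}

/-- The functional `∫ g(x) exp (-∫ (1 - exp (-v(t(x), y))) Λ(dy)) Λ(dx)` with `t` rounded down to
multiples of `2 ^ (-n)`. -/
def meckeApprox (g : E → ℝ≥0∞) (t : E → ℝ) (v : ℝ → E → ℝ≥0∞) (n : ℕ) (Λ : Measure E) : ℝ≥0∞ :=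
  ∑' k : ℕ, (∫⁻ x, {x | ⌊2 ^ n * t x⌋₊ = k}.indicator g x ∂Λ) *
    expNeg (∫⁻ y, (1 - expNeg (v (k / 2 ^ n) y)) ∂Λ)

lemma measurableSet_floor_eq {t : E → ℝ} (ht : Measurable t) (n k : ℕ) :
    MeasurableSet {x | ⌊2 ^ n * t x⌋₊ = k} :=
  (measurableSet_singleton k).preimage (Nat.measurable_floor.comp (ht.const_mul _))

/-- On each cell of the dyadic grid the parameter of `F` is frozen at k / 2^n. -/
lemma lintegral_mul_floor_eq_tsum {α : Type*} [MeasurableSpace α] {ν : Measure α} {f : α → ℝ≥0∞}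
    (hf : Measurable f) {t : α → ℝ} (ht : Measurable t) (n : ℕ) (F : ℝ → α → ℝ≥0∞)
    (hF : ∀ r, Measurable (F r)) :
    ∫⁻ x, f x * F (dyadicFloor n (t x)) x ∂ν =
      ∑' k : ℕ, ∫⁻ x, {x | ⌊2 ^ n * t x⌋₊ = k}.indicator f x * F (k / 2 ^ n) x ∂ν := by
  rw [← lintegral_tsum (f := fun k x => {x | ⌊2 ^ n * t x⌋₊ = k}.indicator f x * F (k / 2 ^ n) x)
    fun k => ((hf.indicator (measurableSet_floor_eq ht n k)).mul (hF _)).aemeasurable]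
  refine lintegral_congr fun x => ?_
  rw [tsum_eq_single ⌊2 ^ n * t x⌋₊]
  · simp [dyadicFloor]
  · intro k hk
    simp [hk.symm]

lemma measurable_mul_floor {α : Type*} [MeasurableSpace α] {f : α → ℝ≥0∞}
    (hf : Measurable f) {t : α → ℝ} (ht : Measurable t) (n : ℕ) (F : ℝ → α → ℝ≥0∞)
    (hF : ∀ r, Measurable (F r)) :
    Measurable fun x => f x * F (dyadicFloor n (t x)) x := by
  have : (fun x => f x * F (dyadicFloor n (t x)) x) =
      fun x => ∑' k : ℕ, {x | ⌊2 ^ n * t x⌋₊ = k}.indicator f x * F (k / 2 ^ n) x := by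
    ext x
    rw [tsum_eq_single ⌊2 ^ n * t x⌋₊]
    · simp [dyadicFloor]
    · intro k hk
      simp [hk.symm]
  rw [this]
  exact Measurable.tsum fun k => (hf.indicator (measurableSet_floor_eq ht n k)).mul (hF _)

variable {g : E → ℝ≥0∞} {t : E → ℝ} {v : ℝ → E → ℝ≥0∞}

/-- The approximation converges if `g` is integrable. -/
theorem tendsto_meckeApprox (hg : Measurable g) (hgf : ∀ x, g x ≠ ∞) (ht : Measurable t)
    (ht0 : ∀ x, 0 ≤ t x)
    (hv : ∀ r, Measurable (v r)) (hmono : ∀ y r s, 0 ≤ r → r ≤ s → v r y ≤ v s y)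
    (hcont : ∀ y r, 0 ≤ r → ContinuousWithinAt (fun s => v s y) (Set.Icc 0 r) r)
    (hI : ∫⁻ x, g x ∂Λ ≠ ∞) :
    Tendsto (fun n => meckeApprox g t v n Λ) atTop
      (𝓝 (∫⁻ x, g x * expNeg (∫⁻ y, (1 - expNeg (v (t x) y)) ∂Λ) ∂Λ)) := by
  have he := measurable_expNeg
  have h1 : ∀ n, meckeApprox g t v n Λ =
      ∫⁻ x, g x * expNeg (∫⁻ y, (1 - expNeg (v (dyadicFloor n (t x)) y)) ∂Λ) ∂Λ := by
    intro n
    rw [lintegral_mul_floor_eq_tsum hg ht n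
      (fun r _ => expNeg (∫⁻ y, (1 - expNeg (v r y)) ∂Λ)) (fun r => measurable_const)]
    refine tsum_congr fun k => ?_
    rw [lintegral_mul_const _ (hg.indicator (measurableSet_floor_eq ht n k))]
  simp_rw [h1]
  refine tendsto_lintegral_of_dominated_convergence g (fun n => measurable_mul_floor hg ht n
      (fun r _ => expNeg (∫⁻ y, (1 - expNeg (v r y)) ∂Λ)) (fun r => measurable_const))
    (fun n => Eventually.of_forall fun x => mul_le_of_le_one_right' (expNeg_le_one _)) hI
    (Eventually.of_forall fun x => ?_)
  have hgt : Tendsto (fun n => expNeg (∫⁻ y, (1 - expNeg (v (dyadicFloor n (t x)) y)) ∂Λ)) atTop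
      (𝓝 (expNeg (∫⁻ y, (1 - expNeg (v (t x) y)) ∂Λ))) := by
    refine (continuous_expNeg.tendsto _).comp ?_
    -- Rounding down and monotonicity of `v` keep the integrands below their limit; left continuity
    -- of `v` gives the convergence.
    refine tendsto_lintegral_of_le_of_tendsto (fun n => by fun_prop) (fun n y => ?_) (fun y => ?_)
    · exact tsub_le_tsub_left (antitone_expNeg
        (hmono y _ _ (dyadicFloor_nonneg _ _) (dyadicFloor_le n (ht0 x)))) _
    · refine ENNReal.Tendsto.sub tendsto_const_nhds ((continuous_expNeg.tendsto _).comp ?_)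
        (Or.inl ENNReal.one_ne_top)
      exact (hcont y _ (ht0 x)).tendsto.comp (tendsto_dyadicFloor_within (ht0 x))
  exact ENNReal.Tendsto.const_mul hgt (Or.inr (hgf x))

variable [Countable B]

namespace PoissonLaplace

lemma measurable_otherSum (h : PoissonLaplace μ X A Λ) {v : E → ℝ≥0∞} (hv : Measurable v) (b : B) :
    Measurable (otherSum X A v b) := by
  refine Measurable.tsum fun b' => ?_
  split_ifs
  · exact measurable_const
  · exact (hv.comp (h.measurable b')).indicator (h.measurableSet b')

lemma measurable_otherSum_self (h : PoissonLaplace μ X A Λ) (ht : Measurable t)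
    (hv : Measurable (Function.uncurry v)) (b : B) :
    Measurable fun ω => otherSum X A (v (t (X b ω))) b ω := by
  have : (fun ω => otherSum X A (v (t (X b ω))) b ω) = fun ω => ∑' b', open Classical in
      if b' = b then 0 else
        (A b').indicator (fun ω => Function.uncurry v (t (X b ω), X b' ω)) ω := by
    ext ω
    refine tsum_congr fun b' => ?_
    by_cases hω : ω ∈ A b' <;> simp [hω]
  rw [this]
  refine Measurable.tsum fun b' => ?_
  split_ifs
  · exact measurable_const
  · exact (hv.comp ((ht.comp (h.measurable b)).prodMk (h.measurable b'))).indicator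
      (h.measurableSet b')

variable [IsProbabilityMeasure μ]

/-- The Mecke formula for a fixed `v` also counts `v` at the chosen point. The weight g e^{v}
cancels that factor, which `hgv` makes nonzero wherever `g` does not vanish. -/
lemma tsum_lintegral_expNeg_otherSum (h : PoissonLaplace μ X A Λ) {v : E → ℝ≥0∞}
    (hv : Measurable v) (hg : Measurable g) (hgv : ∀ x, g x ≠ 0 → v x ≠ ∞)
    (hI : ∫⁻ x, g x ∂Λ ≠ ∞) :
    ∑' b, ∫⁻ ω, (A b).indicator (fun ω => g (X b ω)) ω * expNeg (otherSum X A v b ω) ∂μ =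
      (∫⁻ x, g x ∂Λ) * expNeg (∫⁻ y, (1 - expNeg (v y)) ∂Λ) := by
  have he := measurable_expNeg
  have hw : Measurable fun x => g x * (expNeg (v x))⁻¹ := hg.mul (he.comp hv).inv
  have hwg : ∀ x, expNeg (v x) * (g x * (expNeg (v x))⁻¹) = g x := by
    intro x
    by_cases h0 : g x = 0
    · simp [h0]
    · rw [mul_left_comm, ENNReal.mul_inv_cancel (expNeg_ne_zero (hgv x h0)) (expNeg_ne_top _),
        mul_one]
  have key := h.lintegral_pointSum_mul_expNeg hv hw (by simpa only [hwg] using hI)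
  simp only [hwg] at key
  rw [mul_comm (∫⁻ x, g x ∂Λ), ← key, ← lintegral_tsum]
  · refine lintegral_congr fun ω => ?_
    rw [pointSum.eq_1 X A (fun x => g x * (expNeg (v x))⁻¹), ← ENNReal.tsum_mul_left]
    refine tsum_congr fun b => ?_
    rw [pointSum_eq_add_otherSum v b]
    by_cases hω : ω ∈ A b
    · simp only [hω, Set.indicator_of_mem, expNeg_add]
      rw [mul_right_comm, hwg]
    · simp [hω]
  · exact fun b => (((hg.comp (h.measurable b)).indicator (h.measurableSet b)).mul
      (he.comp (h.measurable_otherSum hv b))).aemeasurable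

/-- The Mecke formula, for a weight that depends on the point `x` and on the other points `y`
through `g x * exp (-∑ v (t x) y)`, if `g` is integrable. -/
theorem mecke_of_integrable (h : PoissonLaplace μ X A Λ) (hg : Measurable g) (hgf : ∀ x, g x ≠ ∞)
    (ht : Measurable t) (ht0 : ∀ x, 0 ≤ t x) (hv : ∀ r, Measurable (v r))
    (hmono : ∀ y r s, 0 ≤ r → r ≤ s → v r y ≤ v s y)
    (hcont : ∀ y r, 0 ≤ r → ContinuousWithinAt (fun s => v s y) (Set.Icc 0 r) r)
    (hgv : ∀ x, g x ≠ 0 → v (t x) x ≠ ∞) (hI : ∫⁻ x, g x ∂Λ ≠ ∞) :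
    ∑' b, ∫⁻ ω, (A b).indicator (fun ω => g (X b ω)) ω *
        expNeg (otherSum X A (v (t (X b ω))) b ω) ∂μ =
      ∫⁻ x, g x * expNeg (∫⁻ y, (1 - expNeg (v (t x) y)) ∂Λ) ∂Λ := by
  have he := measurable_expNeg
  have hgX : ∀ b, Measurable ((A b).indicator fun ω => g (X b ω)) := fun b =>
    (hg.comp (h.measurable b)).indicator (h.measurableSet b)
  have hF : ∀ b r, Measurable fun ω => expNeg (otherSum X A (v r) b ω) := fun b r =>
    he.comp (h.measurable_otherSum (hv r) b)
  have h1 : ∀ n, ∑' b, ∫⁻ ω, (A b).indicator (fun ω => g (X b ω)) ω *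
        expNeg (otherSum X A (v (dyadicFloor n (t (X b ω)))) b ω) ∂μ = meckeApprox g t v n Λ := by
    intro n
    have h2 : ∀ b, ∫⁻ ω, (A b).indicator (fun ω => g (X b ω)) ω *
        expNeg (otherSum X A (v (dyadicFloor n (t (X b ω)))) b ω) ∂μ = _ := fun b =>
      lintegral_mul_floor_eq_tsum (hgX b) (ht.comp (h.measurable b)) n
        (fun r ω => expNeg (otherSum X A (v r) b ω)) (hF b)
    simp_rw [h2]
    rw [ENNReal.tsum_comm]
    refine tsum_congr fun k => ?_
    rw [← h.tsum_lintegral_expNeg_otherSum (hv _) (hg.indicator (measurableSet_floor_eq ht n k))]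
    · refine tsum_congr fun b => lintegral_congr fun ω => ?_
      congr 1
      by_cases hω : ω ∈ A b <;> simp [hω, Set.indicator]
    -- On its cell the frozen parameter k / 2^n is at most `t x`, so finiteness of `v (t x) x`
    -- passes to it by monotonicity.
    · intro x hx
      have hxk : ⌊2 ^ n * t x⌋₊ = k := by
        by_contra hne
        simp [hne] at hx
      have hgx : g x ≠ 0 := by
        intro h0
        simp [Set.indicator, h0] at hx
      have : (k / 2 ^ n : ℝ) = dyadicFloor n (t x) := by rw [dyadicFloor, hxk]
      rw [this]
      exact ((hmono x _ _ (dyadicFloor_nonneg _ _) (dyadicFloor_le n (ht0 x))).trans_lt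
        (hgv x hgx).lt_top).ne
    · exact ((lintegral_mono fun x => Set.indicator_le_self _ _ _).trans_lt hI.lt_top).ne
  refine tendsto_nhds_unique ?_ (tendsto_meckeApprox hg hgf ht ht0 hv hmono hcont hI)
  simp_rw [← h1]
  let _ : MeasurableSpace B := ⊤
  simp only [← lintegral_count]
  -- Dominated convergence twice, over `b` for counting measure and then over `ω`. The bound g(X_b)
  -- has finite total expectation by Campbell's formula.
  refine tendsto_lintegral_of_dominated_convergence
    (fun b => ∫⁻ ω, (A b).indicator (fun ω => g (X b ω)) ω ∂μ)
    (fun n => measurable_from_top)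
    (fun n => Eventually.of_forall fun b => lintegral_mono fun ω =>
      mul_le_of_le_one_right' (expNeg_le_one _)) ?_ (Eventually.of_forall fun b => ?_)
  · rw [lintegral_count, ← lintegral_tsum fun b => (hgX b).aemeasurable]
    exact (h.lintegral_pointSum hg hI).trans_ne hI
  · refine tendsto_lintegral_of_dominated_convergence
      (fun ω => (A b).indicator (fun ω => g (X b ω)) ω)
      (fun n => measurable_mul_floor (hgX b) (ht.comp (h.measurable b)) n
        (fun r ω => expNeg (otherSum X A (v r) b ω)) (hF b))
      (fun n => Eventually.of_forall fun ω => mul_le_of_le_one_right' (expNeg_le_one _)) ?_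
      (Eventually.of_forall fun ω => ?_)
    · have := h.lintegral_pointSum hg hI
      have h3 : ∫⁻ ω, (A b).indicator (fun ω => g (X b ω)) ω ∂μ ≤ ∫⁻ ω, pointSum X A g ω ∂μ :=
        lintegral_mono fun ω => ENNReal.le_tsum b
      exact (h3.trans_lt (this ▸ hI.lt_top)).ne
    · refine ENNReal.Tendsto.const_mul ((continuous_expNeg.tendsto _).comp ?_) (Or.inr ?_)
      · refine tendsto_tsum_of_le_of_tendsto (fun n b' => ?_) (fun b' => ?_)
        · split_ifs
          · exact le_rfl
          · exact Set.indicator_le_indicator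
              (hmono _ _ _ (dyadicFloor_nonneg _ _) (dyadicFloor_le n (ht0 _)))
        · split_ifs
          · exact tendsto_const_nhds
          · by_cases hω : ω ∈ A b'
            · simp only [hω, Set.indicator_of_mem]
              exact (hcont _ _ (ht0 _)).tendsto.comp (tendsto_dyadicFloor_within (ht0 _))
            · simp [hω]
      · by_cases hω : ω ∈ A b <;> simp [hω, hgf]

/-- The Mecke formula, for a weight that depends on the point `x` and on the other points `y`
through `g x * exp (-∑ v (t x) y)`, if `g` is integrable over the sets where `t` is bounded. -/
theorem mecke [SFinite Λ] (h : PoissonLaplace μ X A Λ) (hg : Measurable g) (hgf : ∀ x, g x ≠ ∞)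
    (ht : Measurable t) (ht0 : ∀ x, 0 ≤ t x) (hv : Measurable (Function.uncurry v))
    (hmono : ∀ y r s, 0 ≤ r → r ≤ s → v r y ≤ v s y)
    (hcont : ∀ y r, 0 ≤ r → ContinuousWithinAt (fun s => v s y) (Set.Icc 0 r) r)
    (hgv : ∀ x, g x ≠ 0 → v (t x) x ≠ ∞)
    (hI : ∀ m : ℕ, ∫⁻ x, {x | ⌊t x⌋₊ = m}.indicator g x ∂Λ ≠ ∞) :
    ∑' b, ∫⁻ ω, (A b).indicator (fun ω => g (X b ω)) ω *
        expNeg (otherSum X A (v (t (X b ω))) b ω) ∂μ =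
      ∫⁻ x, g x * expNeg (∫⁻ y, (1 - expNeg (v (t x) y)) ∂Λ) ∂Λ := by
  have he := measurable_expNeg
  have hs : ∀ m : ℕ, MeasurableSet {x | ⌊t x⌋₊ = m} := fun m =>
    (measurableSet_singleton m).preimage (Nat.measurable_floor.comp ht)
  have hgm : ∀ m : ℕ, Measurable ({x | ⌊t x⌋₊ = m}.indicator g) := fun m => hg.indicator (hs m)
  -- Cut `g` into the shells m ≤ t < m + 1, on each of which it is integrable.
  have hsum : ∀ x, g x = ∑' m : ℕ, {x | ⌊t x⌋₊ = m}.indicator g x := by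
    intro x
    rw [tsum_eq_single ⌊t x⌋₊]
    · simp
    · intro k hk
      simp [hk.symm]
  have hR : ∫⁻ x, g x * expNeg (∫⁻ y, (1 - expNeg (v (t x) y)) ∂Λ) ∂Λ = ∑' m : ℕ,
      ∫⁻ x, {x | ⌊t x⌋₊ = m}.indicator g x * expNeg (∫⁻ y, (1 - expNeg (v (t x) y)) ∂Λ) ∂Λ := by
    rw [← lintegral_tsum]
    · refine lintegral_congr fun x => ?_
      rw [ENNReal.tsum_mul_right, ← hsum]
    · refine fun m => ((hgm m).mul (he.comp ?_)).aemeasurable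
      refine Measurable.lintegral_prod_right' (f := fun z : E × E => 1 - expNeg (v (t z.1) z.2)) ?_
      exact measurable_const.sub (he.comp
        (hv.comp ((ht.comp measurable_fst).prodMk measurable_snd)))
  have hL : ∀ b, ∫⁻ ω, (A b).indicator (fun ω => g (X b ω)) ω *
        expNeg (otherSum X A (v (t (X b ω))) b ω) ∂μ = ∑' m : ℕ,
      ∫⁻ ω, (A b).indicator (fun ω => {x | ⌊t x⌋₊ = m}.indicator g (X b ω)) ω *
        expNeg (otherSum X A (v (t (X b ω))) b ω) ∂μ := by
    intro b
    rw [← lintegral_tsum]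
    · refine lintegral_congr fun ω => ?_
      rw [ENNReal.tsum_mul_right]
      congr 1
      by_cases hω : ω ∈ A b
      · simp only [hω, Set.indicator_of_mem]
        exact hsum _
      · simp [hω]
    · exact fun m => ((((hgm m).comp (h.measurable b)).indicator (h.measurableSet b)).mul
        (he.comp (h.measurable_otherSum_self ht hv b))).aemeasurable
  simp_rw [hL]
  rw [ENNReal.tsum_comm, hR]
  refine tsum_congr fun m => ?_
  refine h.mecke_of_integrable (hgm m) (fun x => ?_) ht ht0 (fun r => hv.of_uncurry_left) hmono
    hcont (fun x hx => hgv x ?_) (hI m)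
  · exact ((Set.indicator_le_self _ _ _).trans_lt (hgf x).lt_top).ne
  · intro h0
    simp [Set.indicator, h0] at hx

end PoissonLaplace

end Mecke

/-! ### Almost sure absence of ties -/

section Ties

variable {Ω B E : Type*} {X : B → Ω → E} {A : B → Set Ω} [MeasurableSpace Ω] [MeasurableSpace E]
  {μ : Measure Ω} {Λ : Measure E} [Countable B] [IsProbabilityMeasure μ] {t : E → ℝ}

namespace PoissonLaplace

/-- A set `s` contains two or more points with probability at most `Λ s ^ 2`. -/
lemma measure_two_points_le (h : PoissonLaplace μ X A Λ) {s : Set E} (hs : MeasurableSet s)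
    (hΛ : Λ s ≠ ∞) :
    μ {ω | ∃ b b', b ≠ b' ∧ ω ∈ A b ∧ ω ∈ A b' ∧ X b ω ∈ s ∧ X b' ω ∈ s} ≤ Λ s * Λ s := by
  classical
  set D := {ω | ∃ b b', b ≠ b' ∧ ω ∈ A b ∧ ω ∈ A b' ∧ X b ω ∈ s ∧ X b' ω ∈ s} with hD
  have hDm : MeasurableSet D := by
    have : D = ⋃ b, ⋃ b', ⋃ (_ : b ≠ b'), A b ∩ A b' ∩ X b ⁻¹' s ∩ X b' ⁻¹' s := by
      ext ω; simp [hD]; grind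
    rw [this]
    exact .iUnion fun b => .iUnion fun b' => .iUnion fun _ =>
      (((h.measurableSet b).inter (h.measurableSet b')).inter (h.measurable b hs)).inter
        (h.measurable b' hs)
  have hv : Measurable (s.indicator fun _ => (∞ : ℝ≥0∞)) := measurable_const.indicator hs
  have hw : Measurable (s.indicator fun _ => (1 : ℝ≥0∞)) := measurable_const.indicator hs
  have h1 : ∫⁻ y, (1 - expNeg (s.indicator (fun _ => (∞ : ℝ≥0∞)) y)) ∂Λ = Λ s := by
    rw [← lintegral_indicator_one hs]
    refine lintegral_congr fun y => ?_
    by_cases hy : y ∈ s <;> simp [hy]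
  have h2 : ∫⁻ ω, pointSum X A (s.indicator fun _ => 1) ω ∂μ = Λ s := by
    have h3 : ∫⁻ y, s.indicator (fun _ => (1 : ℝ≥0∞)) y ∂Λ = Λ s := by
      rw [lintegral_indicator hs]; simp
    rw [h.lintegral_pointSum hw (by rwa [h3]), h3]
  -- With N the number of points in `s`, this reads 1{N ≥ 2} + 1{N ≥ 1} ≤ N. The second indicator is
  -- 1 - e^{-∞·N}, whose mean is given by the Laplace functional.
  have hpt : ∀ ω, D.indicator 1 ω + (1 - expNeg (pointSum X A (s.indicator fun _ => ∞) ω)) ≤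
      pointSum X A (s.indicator fun _ => 1) ω := by
    intro ω
    by_cases hω : ω ∈ D
    · obtain ⟨b, b', hne, hb, hb', hX, hX'⟩ := hω
      have hω : ω ∈ D := ⟨b, b', hne, hb, hb', hX, hX'⟩
      calc D.indicator 1 ω + (1 - expNeg (pointSum X A (s.indicator fun _ => ∞) ω)) ≤ 1 + 1 := by
            simp only [hω, Set.indicator_of_mem, Pi.one_apply]
            gcongr
            exact tsub_le_self
        _ = ∑ c ∈ ({b, b'} : Finset B), (A c).indicator
              (fun ω => s.indicator (fun _ => (1 : ℝ≥0∞)) (X c ω)) ω := by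
            rw [Finset.sum_pair hne]
            simp [hb, hb', hX, hX']
        _ ≤ _ := ENNReal.sum_le_tsum _
    · simp only [hω, not_false_eq_true, Set.indicator_of_notMem, zero_add]
      by_cases h0 : ∃ b, ω ∈ A b ∧ X b ω ∈ s
      · obtain ⟨b, hb, hX⟩ := h0
        calc _ ≤ (1 : ℝ≥0∞) := tsub_le_self
          _ = (A b).indicator (fun ω => s.indicator (fun _ => (1 : ℝ≥0∞)) (X b ω)) ω := by
            simp [hb, hX]
          _ ≤ _ := ENNReal.le_tsum b
      · have : pointSum X A (s.indicator fun _ => ∞) ω = 0 := by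
          refine ENNReal.tsum_eq_zero.2 fun b => ?_
          by_cases hb : ω ∈ A b
          · have : X b ω ∉ s := fun hX => h0 ⟨b, hb, hX⟩
            simp [this]
          · simp [hb]
        simp [this]
  have hme : Measurable fun ω => expNeg (pointSum X A (s.indicator fun _ => ∞) ω) :=
    measurable_expNeg.comp (h.measurable_pointSum hv)
  have h4 : μ D + (1 - expNeg (Λ s)) ≤ Λ s := by
    have h5 := lintegral_mono (μ := μ) hpt
    rw [lintegral_add_left (measurable_one.indicator hDm), lintegral_indicator_one hDm, h2,
      lintegral_sub hme, h.laplace _ hv, h1] at h5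
    · simpa using h5
    · exact ((lintegral_mono fun ω => expNeg_le_one _).trans_lt (by simp)).ne
    · exact Eventually.of_forall fun ω => expNeg_le_one _
  have h6 : μ D + Λ s / (1 + Λ s) ≤ Λ s :=
    (by gcongr; exact div_one_add_le_one_sub_expNeg hΛ : _ ≤ _).trans h4
  -- This is a - a / (1 + a) = a² / (1 + a) ≤ a², written without subtraction.
  have h7 : Λ s ≤ Λ s * Λ s + Λ s / (1 + Λ s) := by
    generalize Λ s = a at hΛ
    have h8 : a = a * (1 + a) / (1 + a) := by
      rw [mul_div_assoc, ENNReal.div_self (by simp) (by simpa using hΛ), mul_one]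
    conv_lhs => rw [h8, mul_add, mul_one, ENNReal.add_div, add_comm]
    gcongr
    exact ENNReal.div_le_of_le_mul (le_mul_of_one_le_right' le_self_add)
  have h9 : Λ s / (1 + Λ s) ≠ ∞ := ENNReal.div_ne_top hΛ (by simp)
  exact (ENNReal.add_le_add_iff_right h9).1 (h6.trans h7)

/-- Almost surely, `t` takes distinct values at distinct points. -/
theorem ae_ne_of_ne [SFinite Λ] (h : PoissonLaplace μ X A Λ) (ht : Measurable t)
    (ht0 : ∀ x, 0 ≤ t x)
    (hfin : ∀ m : ℕ, Λ {x | ⌊t x⌋₊ = m} ≠ ∞) (hatom : ∀ r, Λ {x | t x = r} = 0) :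
    ∀ᵐ ω ∂μ, ∀ b b', b ≠ b' → ω ∈ A b → ω ∈ A b' → t (X b ω) ≠ t (X b' ω) := by
  have hsm : ∀ m : ℕ, MeasurableSet {x | ⌊t x⌋₊ = m} := fun m =>
    (measurableSet_singleton m).preimage (Nat.measurable_floor.comp ht)
  have key : ∀ m : ℕ, ∀ᵐ ω ∂μ, ¬ ∃ b b', b ≠ b' ∧ ω ∈ A b ∧ ω ∈ A b' ∧ ⌊t (X b ω)⌋₊ = m ∧
      t (X b ω) = t (X b' ω) := by
    intro m
    set Λm := Λ.restrict {x | ⌊t x⌋₊ = m} with hΛm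
    have : IsFiniteMeasure Λm := ⟨by simpa [hΛm] using (hfin m).lt_top⟩
    let s : ℕ → ℕ → Set E := fun n k => {x | ⌊2 ^ n * t x⌋₊ = k}
    have hs : ∀ n k, MeasurableSet (s n k) := fun n k => measurableSet_floor_eq ht n k
    let D : ℕ → Set (E × E) := fun n => {z | ⌊2 ^ n * t z.1⌋₊ = ⌊2 ^ n * t z.2⌋₊}
    have hf : ∀ n, Measurable fun x => ⌊2 ^ n * t x⌋₊ := fun n =>
      Nat.measurable_floor.comp (ht.const_mul _)
    have hDm : ∀ n, MeasurableSet (D n) := fun n =>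
      measurableSet_eq_fun ((hf n).comp measurable_fst) ((hf n).comp measurable_snd)
    -- A tie puts two points into a common cell of every dyadic grid. The two-point bounds, summed
    -- over the cells, give the product measure of the neighbourhood `D n` of the diagonal.
    have hle : ∀ n, μ {ω | ∃ b b', b ≠ b' ∧ ω ∈ A b ∧ ω ∈ A b' ∧ ⌊t (X b ω)⌋₊ = m ∧
        t (X b ω) = t (X b' ω)} ≤ (Λm.prod Λm) (D n) := by
      intro n
      have e1 : D n = ⋃ k, s n k ×ˢ s n k := by
        ext z
        simp only [D, s, Set.mem_iUnion, Set.mem_prod, Set.mem_ofPred_eq]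
        exact ⟨fun hz => ⟨_, rfl, hz.symm⟩, fun ⟨k, h1, h2⟩ => h1.trans h2.symm⟩
      rw [e1, measure_iUnion]
      · simp_rw [Measure.prod_prod, hΛm, Measure.restrict_apply (hs n _)]
        refine (measure_mono ?_).trans ((measure_iUnion_le fun k =>
          {ω | ∃ b b', b ≠ b' ∧ ω ∈ A b ∧ ω ∈ A b' ∧ X b ω ∈ s n k ∩ {x | ⌊t x⌋₊ = m} ∧
            X b' ω ∈ s n k ∩ {x | ⌊t x⌋₊ = m}}).trans (ENNReal.tsum_le_tsum fun k =>
              h.measure_two_points_le ((hs n k).inter (hsm m)) ?_))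
        · rintro ω ⟨b, b', hne, hb, hb', hm, heq⟩
          refine Set.mem_iUnion.2 ⟨⌊2 ^ n * t (X b ω)⌋₊, b, b', hne, hb, hb', ⟨rfl, hm⟩, ?_, ?_⟩
          · simp [s, heq]
          · simpa [← heq] using hm
        · exact ((measure_mono Set.inter_subset_right).trans_lt (hfin m).lt_top).ne
      · intro k k' hkk
        refine Set.disjoint_left.2 fun z hz hz' => hkk ?_
        exact hz.1.symm.trans hz'.1
      · exact fun k => (hs n k).prod (hs n k)
    have hlim : Tendsto (fun n => (Λm.prod Λm) (D n)) atTop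
        (𝓝 ((Λm.prod Λm) {z | t z.1 = t z.2})) := by
      refine tendsto_measure_of_tendsto_indicator_of_isFiniteMeasure atTop _ hDm fun z => ?_
      by_cases hz : t z.1 = t z.2
      · exact Eventually.of_forall fun n => by simp [D, hz]
      · have h1 := (tendsto_dyadicFloor (ht0 z.1)).sub (tendsto_dyadicFloor (ht0 z.2))
        filter_upwards [h1.eventually_ne (sub_ne_zero.2 hz)] with n hn
        simp only [D, Set.mem_ofPred_eq, hz, iff_false]
        intro hc
        simp [dyadicFloor, hc] at hn
    -- By Fubini: the sections of the diagonal lie in level sets of `t`, which are null.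
    have h0 : (Λm.prod Λm) {z | t z.1 = t z.2} = 0 := by
      have hdiag : MeasurableSet {z : E × E | t z.1 = t z.2} :=
        measurableSet_eq_fun (ht.comp measurable_fst) (ht.comp measurable_snd)
      rw [Measure.prod_apply hdiag]
      refine (lintegral_congr fun x => ?_).trans lintegral_zero
      refine measure_mono_null ?_
        (Measure.absolutelyContinuous_of_le Measure.restrict_le_self (hatom (t x)))
      intro y hy
      exact (show t x = t y from hy).symm
    rw [h0] at hlim
    rw [ae_iff]
    simp only [not_not]
    exact le_antisymm (ge_of_tendsto' hlim hle) zero_le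
  filter_upwards [ae_all_iff.2 key] with ω hω b b' hne hb hb' heq
  exact hω _ ⟨b, b', hne, hb, hb', rfl, heq⟩

end PoissonLaplace
end Ties

/-! ### Expectations of products over independent sources -/

section Independence

variable {Ω ι J : Type*} [mΩ : MeasurableSpace Ω] {μ : Measure Ω} {m : ι → MeasurableSpace Ω}

/-- Nonnegative random variables that depend on disjoint groups of independent sources are
multiplicative under the expectation. -/
lemma lintegral_prod_of_iIndep [IsProbabilityMeasure μ] (hle : ∀ i, m i ≤ mΩ) (hind : iIndep m μ)
    (grp : J → Set ι) (hdisj : Pairwise (Function.onFun Disjoint grp)) (f : J → Ω → ℝ≥0∞)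
    (hf : ∀ j, Measurable[⨆ i ∈ grp j, m i] (f j)) (s : Finset J) :
    ∫⁻ ω, ∏ j ∈ s, f j ω ∂μ = ∏ j ∈ s, ∫⁻ ω, f j ω ∂μ := by
  classical
  induction s using Finset.induction_on with
  | empty => simp
  | insert a s ha ih =>
    simp only [Finset.prod_insert ha]
    rw [← ih]
    refine lintegral_mul_eq_lintegral_mul_lintegral_of_independent_measurableSpace
      (Mf := ⨆ i ∈ grp a, m i) (Mg := ⨆ i ∈ ⋃ j ∈ s, grp j, m i)
      (iSup₂_le fun i _ => hle i) (iSup₂_le fun i _ => hle i)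
      (indep_iSup_of_disjoint hle hind ?_) (hf a) ?_
    · refine Set.disjoint_iUnion₂_right.2 fun j hj => hdisj ?_
      rintro rfl
      exact ha hj
    · refine Finset.measurable_prod _ fun j hj => (hf j).mono ?_ le_rfl
      exact biSup_mono fun i hi => Set.mem_iUnion₂.2 ⟨j, hj, hi⟩

/-- The Laplace transform of a sum of nonnegative random variables that depend on disjoint groups
of independent sources. -/
lemma lintegral_expNeg_tsum_of_iIndep [Countable J] [IsProbabilityMeasure μ] (hle : ∀ i, m i ≤ mΩ)
    (hind : iIndep m μ) (grp : J → Set ι) (hdisj : Pairwise (Function.onFun Disjoint grp))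
    (T : J → Ω → ℝ≥0∞) (hT : ∀ j, Measurable[⨆ i ∈ grp j, m i] (T j)) (a : J → ℝ≥0∞)
    (ha : ∀ j, ∫⁻ ω, expNeg (T j ω) ∂μ = expNeg (a j)) :
    ∫⁻ ω, expNeg (∑' j, T j ω) ∂μ = expNeg (∑' j, a j) := by
  have h1 : ∀ s : Finset J, ∫⁻ ω, expNeg (∑ j ∈ s, T j ω) ∂μ = expNeg (∑ j ∈ s, a j) := by
    intro s
    simp_rw [expNeg_sum]
    rw [lintegral_prod_of_iIndep hle hind grp hdisj (fun j ω => expNeg (T j ω))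
      (fun j => measurable_expNeg.comp (hT j))]
    exact Finset.prod_congr rfl fun j _ => ha j
  have hT' : ∀ j, Measurable (T j) := fun j => (hT j).mono (iSup₂_le fun i _ => hle i) le_rfl
  have h2 : Tendsto (fun s : Finset J => ∫⁻ ω, expNeg (∑ j ∈ s, T j ω) ∂μ) atTop
      (𝓝 (∫⁻ ω, expNeg (∑' j, T j ω) ∂μ)) := by
    refine tendsto_lintegral_filter_of_dominated_convergence (fun _ => 1)
      (Eventually.of_forall fun s =>
        measurable_expNeg.comp (Finset.measurable_sum s fun j _ => hT' j))
      (Eventually.of_forall fun s => Eventually.of_forall fun ω => expNeg_le_one _) (by simp)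
      (Eventually.of_forall fun ω => ?_)
    exact (continuous_expNeg.tendsto _).comp ENNReal.summable.hasSum
  have h3 : Tendsto (fun s : Finset J => expNeg (∑ j ∈ s, a j)) atTop (𝓝 (expNeg (∑' j, a j))) :=
    (continuous_expNeg.tendsto _).comp ENNReal.summable.hasSum
  simp_rw [h1] at h2
  exact tendsto_nhds_unique h2 h3

/-- Fubini's theorem for independent random elements. -/
lemma lintegral_comp_prodMk_of_indepFun {α β : Type*} [MeasurableSpace α] [MeasurableSpace β]
    [IsProbabilityMeasure μ] {X : Ω → α} {Y : Ω → β} (hX : Measurable X) (hY : Measurable Y)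
    (h : IndepFun X Y μ) {f : α × β → ℝ≥0∞} (hf : Measurable f) :
    ∫⁻ ω, f (X ω, Y ω) ∂μ = ∫⁻ ω, ∫⁻ ω', f (X ω, Y ω') ∂μ ∂μ := by
  have h1 := (indepFun_iff_map_prod_eq_prod_map_map hX.aemeasurable hY.aemeasurable).1 h
  have := Measure.isProbabilityMeasure_map (μ := μ) hX.aemeasurable
  have := Measure.isProbabilityMeasure_map (μ := μ) hY.aemeasurable
  rw [← lintegral_map (f := f) hf (hX.prodMk hY), h1, lintegral_prod _ hf.aemeasurable,
    lintegral_map hf.lintegral_prod_right' hX]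
  refine lintegral_congr fun ω => ?_
  exact lintegral_map (hf.comp measurable_prodMk_left) hY

end Independence

/-! ### The Laplace functional of a homogeneous Poisson process -/

section PoissonLaws

/-- The generating function of the Poisson distribution. -/
lemma lintegral_pow_poissonMeasure (c : ℝ≥0) {x : ℝ≥0∞} (hx : x ≤ 1) :
    ∫⁻ n, x ^ n ∂(poissonMeasure c) = expNeg (c * (1 - x)) := by
  obtain ⟨y, rfl⟩ : ∃ y : ℝ≥0, x = y :=
    ⟨x.toNNReal, (ENNReal.coe_toNNReal (hx.trans_lt ENNReal.one_lt_top).ne).symm⟩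
  have hy : (y : ℝ) ≤ 1 := by exact_mod_cast hx
  have h1 : HasSum (fun n : ℕ => Real.exp (-c) * (c : ℝ) ^ n / n.factorial * (y : ℝ) ^ n)
      (Real.exp (-c) * Real.exp (c * y)) := by
    have := (NormedSpace.expSeries_div_hasSum_exp ((c : ℝ) * y)).mul_left (Real.exp (-c))
    rw [← Real.exp_eq_exp_ℝ] at this
    convert! this using 2 with n
    rw [mul_pow]
    ring
  rw [poissonMeasure, lintegral_sum_measure]
  simp_rw [lintegral_smul_measure, lintegral_dirac]
  have h2 : ∀ n : ℕ, ENNReal.ofReal (Real.exp (-c) * (c : ℝ) ^ n / n.factorial) • (y : ℝ≥0∞) ^ n =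
      ENNReal.ofReal (Real.exp (-c) * (c : ℝ) ^ n / n.factorial * (y : ℝ) ^ n) := by
    intro n
    rw [ENNReal.ofReal_mul (by positivity), ENNReal.ofReal_pow y.coe_nonneg,
      ENNReal.ofReal_coe_nnreal, smul_eq_mul]
  simp_rw [h2]
  have h3 : (c : ℝ≥0∞) * (1 - y) = ENNReal.ofReal (c * (1 - y)) := by
    rw [ENNReal.ofReal_mul c.coe_nonneg, ENNReal.ofReal_sub _ y.coe_nonneg,
      ENNReal.ofReal_coe_nnreal, ENNReal.ofReal_coe_nnreal, ENNReal.ofReal_one]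
  rw [← ENNReal.ofReal_tsum_of_nonneg (fun n => by positivity) h1.summable, h1.tsum_eq, h3,
    expNeg_ofReal (mul_nonneg c.coe_nonneg (sub_nonneg.2 hy)), ← Real.exp_add]
  ring_nf

variable {Ω : Type*} [MeasurableSpace Ω] {μ : Measure Ω}

lemma lintegral_config (x : ℕ → Plane) {v : Plane → ℝ≥0∞} (hv : Measurable v) :
    ∫⁻ z, v z ∂(config x) = ∑' n, v (x n) := by
  simp [config, lintegral_sum_measure, lintegral_dirac' _ hv]

lemma measurable_config {X : ℕ → Ω → Plane} (hX : ∀ n, Measurable (X n)) :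
    Measurable fun ω => config fun n => X n ω := by
  refine Measure.measurable_of_measurable_coe _ fun s hs => ?_
  simp only [config, Measure.sum_apply _ hs, Measure.dirac_apply' _ hs]
  exact Measurable.tsum fun n => (measurable_one.indicator hs).comp (hX n)

namespace IsPoissonProcess

variable {c : ℝ≥0} {X : ℕ → Ω → Plane}

/-- The count law is available only for sets of finite area, whereas the zero level of a simple
function may have infinite area; for x = 0 both sides are 1. -/
lemma lintegral_expNeg_mul_count (h : IsPoissonProcess μ c X) {s : Set Plane}
    (hs : MeasurableSet s) (x : ℝ≥0∞) (hfin : x ≠ 0 → volume s < ∞) [IsProbabilityMeasure μ] :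
    ∫⁻ ω, expNeg (x * config (fun n => X n ω) s) ∂μ =
      expNeg ((1 - expNeg x) * (c • volume : Measure Plane) s) := by
  rcases eq_or_ne x 0 with rfl | hx
  · simp
  have hm : Measurable fun ω => config (fun n => X n ω) s :=
    (Measure.measurable_coe hs).comp (measurable_config h.measurable)
  have hv := hfin hx
  have hxm : Measurable fun t => expNeg (x * t) := measurable_expNeg.comp (by fun_prop)
  rw [← lintegral_map (f := fun t => expNeg (x * t)) hxm hm, h.count_law s hs hv,
    lintegral_map hxm (by fun_prop)]
  simp_rw [expNeg_mul_natCast]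
  rw [lintegral_pow_poissonMeasure _ (expNeg_le_one _), ENNReal.coe_toNNReal, mul_comm]
  · simp
  · exact ENNReal.mul_ne_top ENNReal.coe_ne_top hv.ne

/-- The integral is a linear combination of the counts in the level sets; these sets are disjoint,
so the counts are independent and the expectation factorizes. -/
lemma laplace_simpleFunc [IsProbabilityMeasure μ] (h : IsPoissonProcess μ c X)
    (φ : SimpleFunc Plane ℝ≥0∞) (hφ : ∀ x, x ≠ 0 → volume (φ ⁻¹' {x}) < ∞) :
    ∫⁻ ω, expNeg (∫⁻ z, φ z ∂(config fun n => X n ω)) ∂μ =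
      expNeg (∫⁻ z, (1 - expNeg (φ z)) ∂(c • volume : Measure Plane)) := by
  have h1 : ∫⁻ z, (1 - expNeg (φ z)) ∂(c • volume : Measure Plane) =
      ∑ x ∈ φ.range, (1 - expNeg x) * (c • volume : Measure Plane) (φ ⁻¹' {x}) := by
    rw [← SimpleFunc.map_lintegral (fun x => 1 - expNeg x), ← SimpleFunc.lintegral_eq_lintegral]
    rfl
  rw [h1, expNeg_sum]
  simp_rw [SimpleFunc.lintegral_eq_lintegral, SimpleFunc.lintegral, expNeg_sum]
  have hm : ∀ x, Measurable fun ω => config (fun n => X n ω) (φ ⁻¹' {x}) := fun x =>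
    (Measure.measurable_coe (φ.measurableSet_fiber x)).comp (measurable_config h.measurable)
  let e := φ.range.equivFin
  have hind : iIndepFun (fun (x : φ.range) ω => config (fun n => X n ω) (φ ⁻¹' {x.1})) μ := by
    have := h.count_indep _ (fun a => φ ⁻¹' {(e.symm a).1}) (fun a => φ.measurableSet_fiber _) ?_
    · have h2 := this.precomp e.injective
      simpa [Function.comp_def] using h2
    · intro a b hab
      refine Disjoint.preimage _ (Set.disjoint_singleton.2 fun hc => hab ?_)
      exact e.symm.injective (Subtype.ext hc)
  have key := lintegral_prod_eq_prod_lintegral_of_indepFun Finset.univ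
    (fun (x : φ.range) ω => expNeg (x.1 * config (fun n => X n ω) (φ ⁻¹' {x.1})))
    (hind.comp (fun x t => expNeg (x.1 * t)) fun x => measurable_expNeg.comp (by fun_prop))
    (fun x => measurable_expNeg.comp ((hm _).const_mul _))
  have e1 : ∀ ω, ∏ x ∈ φ.range, expNeg (x * config (fun n => X n ω) (φ ⁻¹' {x})) =
      ∏ x : φ.range, expNeg (x.1 * config (fun n => X n ω) (φ ⁻¹' {x.1})) := fun ω =>
    (Finset.prod_coe_sort φ.range
      (fun x => expNeg (x * config (fun n => X n ω) (φ ⁻¹' {x})))).symm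
  simp_rw [e1]
  rw [key, ← Finset.prod_coe_sort φ.range]
  exact Finset.prod_congr rfl fun x _ =>
    h.lintegral_expNeg_mul_count (φ.measurableSet_fiber _) _ (hφ _)

/-- The Laplace functional of a homogeneous Poisson process. -/
theorem poissonLaplace [IsProbabilityMeasure μ] (h : IsPoissonProcess μ c X) :
    PoissonLaplace μ X (fun _ => Set.univ) (c • volume) := by
  refine ⟨h.measurable, fun _ => .univ, fun v hv => ?_⟩
  have e1 : ∀ ω, pointSum X (fun _ => Set.univ) v ω = ∫⁻ z, v z ∂(config fun n => X n ω) :=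
    fun ω => by simp [pointSum, lintegral_config _ hv]
  simp_rw [e1]
  -- Restricting to balls gives all nonzero levels finite area.
  let φ : ℕ → SimpleFunc Plane ℝ≥0∞ := fun n =>
    (SimpleFunc.eapprox v n).restrict (Metric.ball 0 n)
  have hφ : ∀ n z, φ n z = (Metric.ball (0 : Plane) n).indicator (SimpleFunc.eapprox v n) z :=
    fun n z => by rw [SimpleFunc.restrict_apply _ measurableSet_ball]
  have hle : ∀ n z, φ n z ≤ v z := by
    intro n z
    rw [hφ]
    refine (Set.indicator_le_self _ _ _).trans ?_
    rw [← SimpleFunc.iSup_eapprox_apply hv z]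
    exact le_iSup (fun n => (SimpleFunc.eapprox v n) z) n
  have hlim : ∀ z, Tendsto (fun n => φ n z) atTop (𝓝 (v z)) := by
    intro z
    refine (SimpleFunc.tendsto_eapprox hv z).congr' ?_
    obtain ⟨N, hN⟩ := exists_nat_gt ‖z‖
    filter_upwards [eventually_ge_atTop N] with n hn
    have : z ∈ Metric.ball (0 : Plane) n := by
      rw [mem_ball_zero_iff]
      exact hN.trans_le (by exact_mod_cast hn)
    rw [hφ, Set.indicator_of_mem this]
  have hvol : ∀ n x, x ≠ 0 → volume (φ n ⁻¹' {x}) < ∞ := by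
    intro n x hx
    refine (measure_mono ?_).trans_lt (measure_ball_lt_top (x := (0 : Plane)) (r := n))
    intro z hz
    by_contra hzb
    have : φ n z = x := hz
    rw [hφ, Set.indicator_of_notMem hzb] at this
    exact hx this.symm
  have hX := measurable_config h.measurable
  have h1 : Tendsto (fun n => ∫⁻ ω, expNeg (∫⁻ z, φ n z ∂(config fun n => X n ω)) ∂μ) atTop
      (𝓝 (∫⁻ ω, expNeg (∫⁻ z, v z ∂(config fun n => X n ω)) ∂μ)) := by
    refine tendsto_lintegral_of_dominated_convergence (fun _ => 1) (fun n => ?_)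
      (fun n => Eventually.of_forall fun ω => expNeg_le_one _) (by simp)
      (Eventually.of_forall fun ω => (continuous_expNeg.tendsto _).comp ?_)
    · exact measurable_expNeg.comp ((Measure.measurable_lintegral (φ n).measurable).comp hX)
    · exact tendsto_lintegral_of_le_of_tendsto (fun n => (φ n).measurable) hle hlim
  have h2 : Tendsto (fun n => expNeg (∫⁻ z, (1 - expNeg (φ n z)) ∂(c • volume : Measure Plane)))
      atTop (𝓝 (expNeg (∫⁻ z, (1 - expNeg (v z)) ∂(c • volume : Measure Plane)))) := by
    refine (continuous_expNeg.tendsto _).comp (tendsto_lintegral_of_le_of_tendsto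
      (fun n => measurable_const.sub (measurable_expNeg.comp (φ n).measurable))
      (fun n z => tsub_le_tsub_left (antitone_expNeg (hle n z)) _) (fun z => ?_))
    exact ENNReal.Tendsto.sub tendsto_const_nhds ((continuous_expNeg.tendsto _).comp (hlim z))
      (Or.inl ENNReal.one_ne_top)
  refine tendsto_nhds_unique h1 (h2.congr fun n => ?_)
  exact (h.laplace_simpleFunc (φ n) (hvol n)).symm

end IsPoissonProcess

end PoissonLaws

/-! ### The base stations as a Poisson process, given the cluster centres -/

/-- The tiers carry the discrete σ-algebra. -/
abbrev tierMeasurableSpace {K₁ K₂ : Type*} : MeasurableSpace (K₁ ⊕ K₂) := ⊤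

attribute [local instance] tierMeasurableSpace

variable {K₁ K₂ : Type*}

/-- The law of the displacement of an offspring point from its cluster centre. -/
def Params.offspring (p : Params K₁ K₂) (k : K₁) : Measure Plane :=
  volume.withDensity fun s => ENNReal.ofReal (p.g k s)

instance (p : Params K₁ K₂) (k : K₁) : IsProbabilityMeasure (p.offspring k) :=
  ⟨by rw [Params.offspring, withDensity_apply _ .univ, Measure.restrict_univ, p.g_lintegral]⟩

/-- The numbers of offspring points, their displacements, and the points of the Poisson tiers. -/
abbrev Positions (K₁ K₂ : Type*) := (K₁ → ℕ → ℕ) × (K₁ → ℕ → ℕ → Plane) × (K₂ → ℕ → Plane)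

/-- The location of a base station, given the cluster centres. -/
def locOf (c : K₁ → ℕ → Plane) (u : Positions K₁ K₂) : BS K₁ K₂ → Plane
  | .inl (k, n, l) => c k n + u.2.1 k n l
  | .inr (k, n) => u.2.2 k n

/-- The base station exists. -/
def PresentOf (u : Positions K₁ K₂) : BS K₁ K₂ → Prop
  | .inl (k, n, l) => l < u.1 k n
  | .inr _ => True

lemma measurable_locOf (b : BS K₁ K₂) :
    Measurable fun x : (K₁ → ℕ → Plane) × Positions K₁ K₂ => locOf x.1 x.2 b := by
  rcases b with ⟨k, n, l⟩ | ⟨k, n⟩ <;> simp only [locOf] <;> fun_prop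

lemma measurableSet_presentOf (b : BS K₁ K₂) :
    MeasurableSet {u : Positions K₁ K₂ | PresentOf u b} := by
  rcases b with ⟨k, n, l⟩ | ⟨k, n⟩
  · simp only [PresentOf]
    exact measurableSet_lt measurable_const (by fun_prop)
  · simp [PresentOf]

/-- The σ-algebra is a variable, here and in similar lemmas below, because they are applied to
sub-σ-algebras such as those generated by groups of sources. -/
lemma measurable_tsum_ite_lt {Ω : Type*} {m : MeasurableSpace Ω} {M : Ω → ℕ} {S : ℕ → Ω → Plane}
    {v : Plane → ℝ≥0∞} (hM : Measurable M) (hS : ∀ l, Measurable (S l)) (hv : Measurable v) :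
    Measurable fun ω => ∑' l, if l < M ω then v (S l ω) else 0 :=
  Measurable.tsum fun l => Measurable.ite (hM (measurableSet_Ioi (a := l))) (hv.comp (hS l))
    measurable_const

lemma measurable_tsum_comp {Ω : Type*} {m : MeasurableSpace Ω} {S : ℕ → Ω → Plane}
    {v : Plane → ℝ≥0∞} (hS : ∀ l, Measurable (S l)) (hv : Measurable v) :
    Measurable fun ω => ∑' l, v (S l ω) :=
  Measurable.tsum fun l => hv.comp (hS l)

lemma measurable_positions_mk {Ω : Type*} {m : MeasurableSpace Ω} {M : K₁ → ℕ → Ω → ℕ}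
    {S : K₁ → ℕ → ℕ → Ω → Plane} {Y : K₂ → ℕ → Ω → Plane} (hM : ∀ k n, Measurable (M k n))
    (hS : ∀ k n l, Measurable (S k n l)) (hY : ∀ k n, Measurable (Y k n)) :
    Measurable fun ω => ((fun k n => M k n ω, fun k n l => S k n l ω, fun k n => Y k n ω) :
      Positions K₁ K₂) := by
  fun_prop

namespace Network

variable {Ω : Type*} [mΩ : MeasurableSpace Ω] {μ : Measure Ω} {p : Params K₁ K₂} (W : Network μ p)

/-- The σ-algebras generated by the independent sources of randomness. -/
@[reducible] def sourceSigma (s : Source K₁ K₂) : MeasurableSpace Ω :=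
  match s with
  | .parent k => MeasurableSpace.comap (fun ω n => W.Z k n ω) inferInstance
  | .userCenter => MeasurableSpace.comap W.z₀ inferInstance
  | .count k n => MeasurableSpace.comap (W.M k n) inferInstance
  | .offset k n l => MeasurableSpace.comap (W.S k n l) inferInstance
  | .ppp k => MeasurableSpace.comap (fun ω n => W.Y k n ω) inferInstance
  | .fading b => MeasurableSpace.comap (W.h b) inferInstance

lemma iIndep_sourceSigma : iIndep W.sourceSigma μ := W.indep

lemma sourceSigma_le (s : Source K₁ K₂) : W.sourceSigma s ≤ mΩ := by
  cases s with
  | parent k =>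
    exact measurable_iff_comap_le.1 (measurable_pi_lambda _ fun n => (W.Z_poisson k).measurable n)
  | userCenter => exact measurable_iff_comap_le.1 W.z₀_measurable
  | count k n => exact measurable_iff_comap_le.1 (W.M_measurable k n)
  | offset k n l => exact measurable_iff_comap_le.1 (W.S_measurable k n l)
  | ppp k =>
    exact measurable_iff_comap_le.1 (measurable_pi_lambda _ fun n => (W.Y_poisson k).measurable n)
  | fading b => exact measurable_iff_comap_le.1 (W.h_measurable b)

lemma measurable_iSup_sourceSigma {β : Type*} [MeasurableSpace β] {f : Ω → β}
    {S : Set (Source K₁ K₂)} {s : Source K₁ K₂} (hs : s ∈ S) (hf : Measurable[W.sourceSigma s] f) :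
    Measurable[⨆ i ∈ S, W.sourceSigma i] f :=
  hf.mono (le_biSup W.sourceSigma hs) le_rfl

/-- The random positions relative to the cluster centres. -/
def positions (ω : Ω) : Positions K₁ K₂ :=
  (fun k n => W.M k n ω, fun k n l => W.S k n l ω, fun k n => W.Y k n ω)

/-- The base stations, as pairs of a tier and a location, given the cluster centres. -/
def site (c : K₁ → ℕ → Plane) (b : BS K₁ K₂) (ω : Ω) : (K₁ ⊕ K₂) × Plane :=
  (b.tier, locOf c (W.positions ω) b)

/-- The event that a base station exists. -/
def presentSet (b : BS K₁ K₂) : Set Ω := {ω | PresentOf (W.positions ω) b}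

lemma measurable_count_source (k : K₁) (n : ℕ) : Measurable[W.sourceSigma (.count k n)] (W.M k n) :=
  comap_measurable _

lemma measurable_offset_source (k : K₁) (n l : ℕ) :
    Measurable[W.sourceSigma (.offset k n l)] (W.S k n l) :=
  comap_measurable _

lemma measurable_ppp_source (k : K₂) (n : ℕ) :
    Measurable[W.sourceSigma (.ppp k)] (W.Y k n) :=
  (measurable_pi_apply n).comp (comap_measurable (fun ω n => W.Y k n ω))

lemma measurable_positions : Measurable W.positions :=
  measurable_positions_mk W.M_measurable W.S_measurable fun k => (W.Y_poisson k).measurable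

lemma measurable_site (c : K₁ → ℕ → Plane) (b : BS K₁ K₂) : Measurable (W.site c b) :=
  measurable_const.prodMk
    ((measurable_locOf b).comp (measurable_const.prodMk W.measurable_positions))

lemma measurableSet_presentSet (b : BS K₁ K₂) : MeasurableSet (W.presentSet b) :=
  W.measurable_positions (measurableSet_presentOf b)

/-- The Laplace transform of a sum over one cluster. -/
lemma lintegral_expNeg_cluster [IsProbabilityMeasure μ] (k : K₁) (n : ℕ) {v : Plane → ℝ≥0∞}
    (hv : Measurable v) :
    ∫⁻ ω, expNeg (∑' l, if l < W.M k n ω then v (W.S k n l ω) else 0) ∂μ =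
      expNeg (p.mbar k * ∫⁻ s, (1 - expNeg (v s)) ∂(p.offspring k)) := by
  set q := ∫⁻ s, expNeg (v s) ∂(p.offspring k) with hq
  have he : Measurable fun s => expNeg (v s) := measurable_expNeg.comp hv
  have hq1 : ∫⁻ s, (1 - expNeg (v s)) ∂(p.offspring k) = 1 - q := by
    rw [lintegral_sub he]
    · simp [hq]
    · exact ((lintegral_mono fun s => expNeg_le_one _).trans_lt (by simp)).ne
    · exact Eventually.of_forall fun s => expNeg_le_one _
  have hq2 : q ≤ 1 := (lintegral_mono fun s => expNeg_le_one _).trans (by simp)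
  have hS : ∀ l, ∫⁻ ω, expNeg (v (W.S k n l ω)) ∂μ = q := by
    intro l
    rw [← lintegral_map (f := fun s => expNeg (v s)) he (W.S_measurable k n l), W.S_law]
    rfl
  have hM : ∀ m, ∫⁻ ω, (W.M k n ⁻¹' {m}).indicator 1 ω ∂μ = poissonMeasure (p.mbar k) {m} := by
    intro m
    rw [lintegral_indicator_one (W.M_measurable k n (measurableSet_singleton m)), ← W.M_law k n,
      Measure.map_apply (W.M_measurable k n) (measurableSet_singleton m)]
  have hm : ∀ m, ∫⁻ ω, (W.M k n ⁻¹' {m}).indicator 1 ω *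
      ∏ l ∈ Finset.range m, expNeg (v (W.S k n l ω)) ∂μ =
        q ^ m * poissonMeasure (p.mbar k) {m} := by
    intro m
    -- `none` stands for the cluster size and `some l` for the l-th displacement. On the event that
    -- the size is `m`, the sum has `m` i.i.d. terms; summing over `m` then yields the Poisson
    -- generating function at `q`.
    let grp : Option ℕ → Set (Source K₁ K₂) := fun o => o.elim {.count k n} fun l => {.offset k n l}
    let f : Option ℕ → Ω → ℝ≥0∞ := fun o => o.elim ((W.M k n ⁻¹' {m}).indicator 1)
      fun l ω => expNeg (v (W.S k n l ω))
    have key := lintegral_prod_of_iIndep W.sourceSigma_le W.iIndep_sourceSigma grp ?_ f ?_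
      (Finset.insertNone (Finset.range m))
    · simp only [Finset.prod_insertNone, f, Option.elim] at key
      rw [key, hM, mul_comm]
      congr 1
      simp [hS]
    · rintro (_ | l) (_ | l') hne <;>
        simp_all [grp, Function.onFun]
    · rintro (_ | l)
      · exact W.measurable_iSup_sourceSigma rfl
          ((measurable_of_countable (({m} : Set ℕ).indicator 1)).comp
            (W.measurable_count_source k n))
      · exact W.measurable_iSup_sourceSigma rfl (he.comp (W.measurable_offset_source k n l))
  have hsum : ∀ ω, expNeg (∑' l, if l < W.M k n ω then v (W.S k n l ω) else 0) =
      ∑' m, (W.M k n ⁻¹' {m}).indicator 1 ω *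
        ∏ l ∈ Finset.range m, expNeg (v (W.S k n l ω)) := by
    intro ω
    have h1 : ∑' l, (if l < W.M k n ω then v (W.S k n l ω) else 0) =
        ∑ l ∈ Finset.range (W.M k n ω), v (W.S k n l ω) := by
      rw [tsum_eq_sum (s := Finset.range (W.M k n ω))]
      · exact Finset.sum_congr rfl fun l hl => by simp [Finset.mem_range.1 hl]
      · intro l hl
        rw [Finset.mem_range] at hl
        simp [hl]
    rw [h1, expNeg_sum]
    rw [tsum_eq_single (W.M k n ω)]
    · simp
    · intro m hm
      simp [hm.symm]
  simp_rw [hsum]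
  rw [lintegral_tsum, hq1, ← lintegral_pow_poissonMeasure _ hq2, lintegral_countable']
  · exact tsum_congr hm
  · intro m
    refine Measurable.aemeasurable (Measurable.mul ?_ (Finset.measurable_prod _ fun l _ =>
      he.comp (W.S_measurable k n l)))
    exact measurable_one.indicator (W.M_measurable k n (measurableSet_singleton m))

end Network

/-- The intensity measure of the base stations, given the cluster centres. -/
def Params.intensity (p : Params K₁ K₂) (c : K₁ → ℕ → Plane) : Measure ((K₁ ⊕ K₂) × Plane) :=
  Measure.sum (fun q : K₁ × ℕ => (p.mbar q.1 : ℝ≥0∞) •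
      (p.offspring q.1).map fun s => (Sum.inl q.1, c q.1 q.2 + s)) +
    Measure.sum fun k : K₂ => (p.lam k : ℝ≥0∞) • volume.map fun y : Plane => (Sum.inr k, y)

lemma Params.lintegral_intensity (p : Params K₁ K₂) (c : K₁ → ℕ → Plane)
    {φ : (K₁ ⊕ K₂) × Plane → ℝ≥0∞} (hφ : Measurable φ) :
    ∫⁻ x, φ x ∂(p.intensity c) =
      (∑' q : K₁ × ℕ, p.mbar q.1 * ∫⁻ s, φ (.inl q.1, c q.1 q.2 + s) ∂(p.offspring q.1)) +
        ∑' k : K₂, p.lam k * ∫⁻ y, φ (.inr k, y) := by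
  rw [intensity, lintegral_add_measure, lintegral_sum_measure, lintegral_sum_measure]
  congr 1
  · refine tsum_congr fun q => ?_
    rw [lintegral_smul_measure, lintegral_map hφ (by fun_prop)]
    rfl
  · refine tsum_congr fun k => ?_
    rw [lintegral_smul_measure, lintegral_map hφ (by fun_prop)]
    rfl

instance [Countable K₁] [Countable K₂] (p : Params K₁ K₂) (c : K₁ → ℕ → Plane) :
    SFinite (p.intensity c) := by
  have h1 : ∀ q : K₁ × ℕ, SFinite ((p.mbar q.1 : ℝ≥0∞) •
      (p.offspring q.1).map fun s => ((Sum.inl q.1 : K₁ ⊕ K₂), c q.1 q.2 + s)) :=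
    fun q => inferInstance
  have h2 : ∀ k : K₂, SFinite ((p.lam k : ℝ≥0∞) •
      (volume : Measure Plane).map fun y => ((Sum.inr k : K₁ ⊕ K₂), y)) :=
    fun q => inferInstance
  unfold Params.intensity
  infer_instance

/-- Given the cluster centres, the base stations form a Poisson process. -/
theorem Network.poissonLaplace [Countable K₁] [Countable K₂] {Ω : Type*} [MeasurableSpace Ω]
    {μ : Measure Ω} [IsProbabilityMeasure μ] {p : Params K₁ K₂} (W : Network μ p)
    (c : K₁ → ℕ → Plane) :
    PoissonLaplace μ (W.site c) W.presentSet (p.intensity c) := by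
  refine ⟨W.measurable_site c, W.measurableSet_presentSet, fun v hv => ?_⟩
  have he := measurable_expNeg
  -- One term per cluster and one per Poisson tier. The size of a cluster and its displacements
  -- belong to the same group of sources, and distinct groups are disjoint.
  let T : (K₁ × ℕ) ⊕ K₂ → Ω → ℝ≥0∞ := fun q => match q with
    | .inl (k, n) => fun ω =>
      ∑' l, if l < W.M k n ω then v (.inl k, c k n + W.S k n l ω) else 0
    | .inr k => fun ω => ∑' n, v (.inr k, W.Y k n ω)
  let a : (K₁ × ℕ) ⊕ K₂ → ℝ≥0∞ := fun q => match q with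
    | .inl (k, n) => p.mbar k * ∫⁻ s, (1 - expNeg (v (.inl k, c k n + s))) ∂(p.offspring k)
    | .inr k => p.lam k * ∫⁻ y : Plane, (1 - expNeg (v (.inr k, y)))
  let grp : (K₁ × ℕ) ⊕ K₂ → Set (Source K₁ K₂) := fun q => match q with
    | .inl (k, n) => insert (.count k n) (Set.range fun l => .offset k n l)
    | .inr k => {.ppp k}
  have h1 : ∀ ω, pointSum (W.site c) W.presentSet v ω = ∑' q, T q ω := by
    intro ω
    rw [pointSum, Summable.tsum_sum ENNReal.summable ENNReal.summable,
      Summable.tsum_sum ENNReal.summable ENNReal.summable]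
    congr 1
    · rw [← (Equiv.prodAssoc K₁ ℕ ℕ).tsum_eq, ENNReal.summable.tsum_prod' fun _ => ENNReal.summable]
      refine tsum_congr fun q => tsum_congr fun l => ?_
      simp only [Set.indicator, presentSet, PresentOf, site, locOf, positions, BS.tier,
        Equiv.prodAssoc_apply]
      rfl
    · rw [ENNReal.summable.tsum_prod' fun _ => ENNReal.summable]
      refine tsum_congr fun q => tsum_congr fun l => ?_
      simp [Set.indicator, presentSet, PresentOf, site, locOf, positions, BS.tier]
  have h2 : ∫⁻ y, (1 - expNeg (v y)) ∂(p.intensity c) = ∑' q, a q := by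
    rw [p.lintegral_intensity c (by fun_prop), Summable.tsum_sum ENNReal.summable ENNReal.summable]
  simp_rw [h1]
  rw [h2]
  refine lintegral_expNeg_tsum_of_iIndep W.sourceSigma_le W.iIndep_sourceSigma grp ?_ T ?_ a ?_
  · rintro (⟨k, n⟩ | k) (⟨k', n'⟩ | k') hne <;>
      refine Set.disjoint_left.2 fun x hx hx' => hne ?_
    · rcases hx with rfl | ⟨l, rfl⟩ <;> rcases hx' with h | ⟨l', h⟩ <;> simp_all
    · rcases hx with rfl | ⟨l, rfl⟩ <;> simp [grp] at hx'
    · rcases hx' with rfl | ⟨l, rfl⟩ <;> simp [grp] at hx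
    · simp_all [grp]
  · rintro (⟨k, n⟩ | k)
    · exact measurable_tsum_ite_lt
        (W.measurable_iSup_sourceSigma (Set.mem_insert _ _) (W.measurable_count_source k n))
        (fun l => W.measurable_iSup_sourceSigma (Set.mem_insert_of_mem _ ⟨l, rfl⟩)
          (W.measurable_offset_source k n l))
        (v := fun s => v (Sum.inl k, c k n + s)) (by fun_prop)
    · exact measurable_tsum_comp
        (fun l => W.measurable_iSup_sourceSigma rfl (W.measurable_ppp_source k l))
        (v := fun s => v (Sum.inr k, s)) (by fun_prop)
  · rintro (⟨k, n⟩ | k)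
    · exact W.lintegral_expNeg_cluster k n (v := fun s => v (.inl k, c k n + s)) (by fun_prop)
    · have := (W.Y_poisson k).poissonLaplace.laplace (fun y => v (.inr k, y)) (by fun_prop)
      rw [lintegral_smul_measure] at this
      simpa [pointSum, T, a, ENNReal.smul_def] using this

/-! ### Exponential fading -/

lemma expMeasure_eq_withDensity (r : ℝ) :
    expMeasure r = volume.withDensity (exponentialPDF r) := rfl

lemma measurable_exponentialPDF (r : ℝ) : Measurable (exponentialPDF r) :=
  (measurable_exponentialPDFReal r).ennreal_ofReal

/-- The tail of the exponential distribution. -/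
lemma expMeasure_one_setOf_lt_ofReal (y : ℝ≥0∞) :
    expMeasure 1 {x | y < ENNReal.ofReal x} = expNeg y := by
  have := isProbabilityMeasure_expMeasure zero_lt_one
  rcases eq_or_ne y ∞ with rfl | hy
  · simp
  have h1 : {x | y < ENNReal.ofReal x} = (Set.Iic y.toReal)ᶜ := by
    ext x
    simp [ENNReal.lt_ofReal_iff_toReal_lt hy]
  have h2 := cdf_expMeasure_eq zero_lt_one y.toReal
  rw [if_pos ENNReal.toReal_nonneg, one_mul, cdf_eq_real] at h2
  rw [h1, prob_compl_eq_one_sub measurableSet_Iic, expNeg_of_ne_top hy, ← ofReal_measureReal, h2,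
    ← ENNReal.ofReal_one, ← ENNReal.ofReal_sub _ (by simp), sub_sub_cancel]

/-- The Laplace transform of the exponential distribution. -/
lemma lintegral_expNeg_mul_expMeasure {c : ℝ} (hc : 0 ≤ c) :
    ∫⁻ x, expNeg (ENNReal.ofReal (c * x)) ∂(expMeasure 1) =
      expNeg (ENNReal.ofReal (Real.log (1 + c))) := by
  have h1 : 0 < 1 + c := by linarith
  -- Exponential tilting: e^{-x} e^{-cx} is 1 / (1 + c) times the exponential density of rate 1 + c.
  have hpt : ∀ x, exponentialPDF 1 x * expNeg (ENNReal.ofReal (c * x)) =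
      ENNReal.ofReal (1 / (1 + c)) * exponentialPDF (1 + c) x := by
    intro x
    rcases lt_or_ge x 0 with hx | hx
    · simp [exponentialPDF_of_neg hx]
    · rw [exponentialPDF_of_nonneg hx, exponentialPDF_of_nonneg hx,
        expNeg_ofReal (mul_nonneg hc hx), ← ENNReal.ofReal_mul (by positivity),
        ← ENNReal.ofReal_mul (by positivity)]
      congr 1
      rw [one_mul, one_mul, ← Real.exp_add]
      field_simp
      ring_nf
  rw [expMeasure_eq_withDensity, lintegral_withDensity_eq_lintegral_mul _
    (measurable_exponentialPDF 1) (by fun_prop)]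
  simp only [Pi.mul_apply, hpt]
  rw [lintegral_const_mul _ (measurable_exponentialPDF _), lintegral_exponentialPDF_eq_one h1,
    mul_one, expNeg_ofReal (Real.log_nonneg (by linarith)), Real.exp_neg, Real.exp_log h1, one_div]

open Classical in
lemma measurable_weighted_tsum [Countable K₁] [Countable K₂] {Ω : Type*} {m : MeasurableSpace Ω}
    {h : BS K₁ K₂ → Ω → ℝ} (b : BS K₁ K₂) (hh : ∀ b', b' ≠ b → Measurable (h b'))
    (w : BS K₁ K₂ → ℝ) :
    Measurable fun ω => ∑' b', if b' = b then 0 else ENNReal.ofReal (w b' * h b' ω) := by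
  refine Measurable.tsum fun b' => ?_
  split_ifs with hb
  · exact measurable_const
  · exact ((hh b' hb).const_mul _).ennreal_ofReal

namespace Network

variable {Ω : Type*} [mΩ : MeasurableSpace Ω] {μ : Measure Ω} {p : Params K₁ K₂} (W : Network μ p)

lemma measurable_fading_source (b : BS K₁ K₂) : Measurable[W.sourceSigma (.fading b)] (W.h b) :=
  comap_measurable _

open Classical in
/-- The probability that the fading of one link exceeds a constant plus a weighted sum of the
fadings of the other links. -/
lemma measure_add_tsum_lt_fading [Countable K₁] [Countable K₂] [IsProbabilityMeasure μ]
    (b : BS K₁ K₂) {a : ℝ} (ha : 0 ≤ a)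
    {w : BS K₁ K₂ → ℝ} (hw : ∀ b, 0 ≤ w b) :
    μ {ω | ENNReal.ofReal a + (∑' b', if b' = b then 0 else ENNReal.ofReal (w b' * W.h b' ω)) <
        ENNReal.ofReal (W.h b ω)} =
      ENNReal.ofReal (Real.exp (-a)) *
        expNeg (∑' b', if b' = b then 0 else ENNReal.ofReal (Real.log (1 + w b'))) := by
  set I : Ω → ℝ≥0∞ := fun ω => ∑' b', if b' = b then 0 else ENNReal.ofReal (w b' * W.h b' ω)
    with hI
  have hIm : Measurable I := measurable_weighted_tsum b (fun b' _ => W.h_measurable b') w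
  have hind : IndepFun I (W.h b) μ := by
    have h1 := indep_iSup_of_disjoint W.sourceSigma_le W.iIndep_sourceSigma
      (S := {s | ∃ b', b' ≠ b ∧ s = .fading b'}) (T := {.fading b}) (by
        rw [Set.disjoint_singleton_right]
        rintro ⟨b', hne, h⟩
        simp at h
        exact hne h.symm)
    refine indep_of_indep_of_le_left (indep_of_indep_of_le_right h1 ?_) ?_
    · exact le_biSup W.sourceSigma (Set.mem_singleton (Source.fading b))
    · refine measurable_iff_comap_le.1 (measurable_weighted_tsum b (fun b' hb' => ?_) w)
      exact W.measurable_iSup_sourceSigma ⟨b', hb', rfl⟩ (W.measurable_fading_source b')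
  have hset : MeasurableSet {x : ℝ≥0∞ × ℝ | ENNReal.ofReal a + x.1 < ENNReal.ofReal x.2} :=
    measurableSet_lt (by fun_prop) (by fun_prop)
  have h2 : ∀ y, μ {ω | y < ENNReal.ofReal (W.h b ω)} = expNeg y := by
    intro y
    rw [← expMeasure_one_setOf_lt_ofReal, ← W.h_law b, Measure.map_apply (W.h_measurable b)]
    · rfl
    · exact measurableSet_lt measurable_const (by fun_prop)
  have h3 := lintegral_comp_prodMk_of_indepFun hIm (W.h_measurable b) hind
    (f := {x : ℝ≥0∞ × ℝ | ENNReal.ofReal a + x.1 < ENNReal.ofReal x.2}.indicator 1)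
    (measurable_one.indicator hset)
  have h4 : ∫⁻ ω, {x : ℝ≥0∞ × ℝ | ENNReal.ofReal a + x.1 < ENNReal.ofReal x.2}.indicator 1
      (I ω, W.h b ω) ∂μ = μ {ω | ENNReal.ofReal a + I ω < ENNReal.ofReal (W.h b ω)} :=
    lintegral_indicator_one (μ := μ) ((hIm.prodMk (W.h_measurable b)) hset)
  -- Given the interference I, the exponential tail is e^{-(a + I)}; only the Laplace transform of I
  -- remains to be computed.
  have h5 : ∀ ω, ∫⁻ ω', {x : ℝ≥0∞ × ℝ | ENNReal.ofReal a + x.1 < ENNReal.ofReal x.2}.indicator 1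
      (I ω, W.h b ω') ∂μ = expNeg (ENNReal.ofReal a + I ω) := by
    intro ω
    rw [← h2]
    exact lintegral_indicator_one (μ := μ) ((measurable_const.prodMk (W.h_measurable b)) hset)
  rw [← h4, h3]
  simp_rw [h5, expNeg_add]
  rw [lintegral_const_mul _ (by fun_prop), expNeg_ofReal ha]
  congr 1
  refine lintegral_expNeg_tsum_of_iIndep W.sourceSigma_le W.iIndep_sourceSigma
    (fun b' => {.fading b'}) ?_ _ ?_ _ ?_
  · intro b₁ b₂ hne
    simpa [Function.onFun] using hne
  · intro b'
    refine W.measurable_iSup_sourceSigma rfl ?_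
    split_ifs
    · exact measurable_const
    · exact (Measurable.const_mul (W.measurable_fading_source b') _).ennreal_ofReal
  · intro b'
    split_ifs
    · simp
    · rw [← lintegral_expNeg_mul_expMeasure (hw b'), ← W.h_law b', lintegral_map
        (by fun_prop) (W.h_measurable b')]

end Network

/-! ### Attenuation by competing stations, and local finiteness of the intensity -/

namespace Params

variable (p : Params K₁ K₂)

lemma α_pos : 0 < p.α := by linarith [p.two_lt_α]

lemma Pbar_pos (j k : K₁ ⊕ K₂) : 0 < p.Pbar j k :=
  Real.rpow_pos_of_pos (div_pos (p.P_pos j) (p.P_pos k)) _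

lemma Pbar_self (k : K₁ ⊕ K₂) : p.Pbar k k = 1 := by
  rw [Pbar, div_self (p.P_pos k).ne', Real.one_rpow]

lemma Pbar_mul_rpow (j k : K₁ ⊕ K₂) {r : ℝ} (hr : 0 ≤ r) :
    (p.Pbar j k * r) ^ p.α = p.P j / p.P k * r ^ p.α := by
  rw [Real.mul_rpow (p.Pbar_pos j k).le hr, Pbar, ← Real.rpow_mul
    (div_pos (p.P_pos j) (p.P_pos k)).le, one_div_mul_cancel p.α_pos.ne', Real.rpow_one]

/-- The exponent by which a base station at `x` reduces the coverage probability of a base station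
of tier `i` at distance `r`; it is infinite if the base station at `x` offers more power. -/
def attenuation (i : K₁ ⊕ K₂) (r : ℝ) (x : (K₁ ⊕ K₂) × Plane) : ℝ≥0∞ :=
  if ‖x.2‖ < p.Pbar x.1 i * r then ∞
  else ENNReal.ofReal (Real.log (1 + p.τ i * ((p.Pbar x.1 i * r) ^ p.α / ‖x.2‖ ^ p.α)))

/-- The probability that a link from a base station of tier `i` at `x` overcomes the noise. -/
def noiseWeight (i : K₁ ⊕ K₂) (x : (K₁ ⊕ K₂) × Plane) : ℝ≥0∞ :=
  {x : (K₁ ⊕ K₂) × Plane | x.1 = i}.indicator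
    (fun x => ENNReal.ofReal (Real.exp (-(p.τ i * p.N₀ * ‖x.2‖ ^ p.α / p.P i)))) x

lemma attenuation_mono (i : K₁ ⊕ K₂) (x : (K₁ ⊕ K₂) × Plane) (r s : ℝ) (hr : 0 ≤ r) (hrs : r ≤ s) :
    p.attenuation i r x ≤ p.attenuation i s x := by
  have h1 : p.Pbar x.1 i * r ≤ p.Pbar x.1 i * s :=
    mul_le_mul_of_nonneg_left hrs (p.Pbar_pos _ _).le
  have h0 : 0 ≤ p.Pbar x.1 i * r := mul_nonneg (p.Pbar_pos _ _).le hr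
  unfold attenuation
  by_cases hs : ‖x.2‖ < p.Pbar x.1 i * s
  · simp [hs]
  · have hr' : ¬ ‖x.2‖ < p.Pbar x.1 i * r := fun h => hs (h.trans_le h1)
    rw [if_neg hs, if_neg hr']
    have hτ := p.τ_pos i
    have hα := p.α_pos
    gcongr

/-- Only left continuity holds: the exclusion disc is open, so the value jumps to ∞ immediately to
the right of r = ‖x‖ / P̄. Left continuity is what rounding down in `meckeApprox` requires. -/
lemma attenuation_continuousWithinAt (i : K₁ ⊕ K₂) (x : (K₁ ⊕ K₂) × Plane) (r : ℝ) (hr : 0 ≤ r) :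
    ContinuousWithinAt (fun s => p.attenuation i s x) (Set.Icc 0 r) r := by
  by_cases h : ‖x.2‖ < p.Pbar x.1 i * r
  · have h1 : ∀ᶠ s in 𝓝 r, ‖x.2‖ < p.Pbar x.1 i * s :=
      (continuous_const.mul continuous_id).continuousAt.eventually_const_lt h
    have h2 : (fun s => p.attenuation i s x) =ᶠ[𝓝[Set.Icc 0 r] r] fun _ => ∞ := by
      filter_upwards [nhdsWithin_le_nhds h1] with s hs
      simp [attenuation, hs]
    exact continuousWithinAt_const.congr_of_eventuallyEq h2 (by simp [attenuation, h])
  · have h1 : ∀ s ∈ Set.Icc 0 r, p.attenuation i s x = ENNReal.ofReal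
        (Real.log (1 + p.τ i * ((p.Pbar x.1 i * s) ^ p.α / ‖x.2‖ ^ p.α))) := by
      intro s hs
      have : ¬ ‖x.2‖ < p.Pbar x.1 i * s := fun h' =>
        h (h'.trans_le (mul_le_mul_of_nonneg_left hs.2 (p.Pbar_pos _ _).le))
      rw [attenuation, if_neg this]
    refine ContinuousWithinAt.congr ?_ h1 (h1 r ⟨hr, le_rfl⟩)
    refine ContinuousAt.continuousWithinAt ?_
    refine ENNReal.continuous_ofReal.continuousAt.comp (ContinuousAt.log ?_ ?_)
    · refine continuousAt_const.add (continuousAt_const.mul (ContinuousAt.div_const ?_ _))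
      exact ContinuousAt.rpow_const (by fun_prop) (Or.inr p.α_pos.le)
    · have hτ := p.τ_pos i
      have : 0 ≤ p.Pbar x.1 i * r := mul_nonneg (p.Pbar_pos _ _).le hr
      positivity

lemma measurable_attenuation [Countable K₁] [Countable K₂] (i : K₁ ⊕ K₂) :
    Measurable (Function.uncurry (p.attenuation i)) := by
  have h1 : Measurable fun z : (ℝ × Plane) × (K₁ ⊕ K₂) => p.attenuation i z.1.1 (z.2, z.1.2) := by
    refine measurable_from_prod_countable_left fun k => ?_
    simp only [attenuation]
    exact Measurable.ite (measurableSet_lt (by fun_prop) (by fun_prop)) measurable_const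
      (by fun_prop)
  exact h1.comp (f := fun z : ℝ × ((K₁ ⊕ K₂) × Plane) => ((z.1, z.2.2), z.2.1)) (by fun_prop)

lemma measurable_noiseWeight (i : K₁ ⊕ K₂) : Measurable (p.noiseWeight i) :=
  Measurable.indicator (by fun_prop) (measurable_fst (measurableSet_singleton i))

lemma noiseWeight_le_one (i : K₁ ⊕ K₂) (x : (K₁ ⊕ K₂) × Plane) : p.noiseWeight i x ≤ 1 := by
  refine (Set.indicator_le_self _ _ _).trans ?_
  rw [← ENNReal.ofReal_one]
  refine ENNReal.ofReal_le_ofReal (Real.exp_le_one_iff.2 (neg_nonpos.2 ?_))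
  have := p.τ_pos i
  have := p.N₀_nonneg
  have := p.P_pos i
  positivity

/-- The mean number of offspring points in each disc is finite. -/
def LocallyFinite (c : K₁ → ℕ → Plane) : Prop :=
  ∀ k, ∀ R : ℕ, ∑' n, p.offspring k {s | ‖c k n + s‖ ≤ R} ≠ ∞

lemma intensity_apply (c : K₁ → ℕ → Plane) {s : Set ((K₁ ⊕ K₂) × Plane)} (hs : MeasurableSet s) :
    p.intensity c s =
      (∑' q : K₁ × ℕ, p.mbar q.1 * p.offspring q.1 {y | (.inl q.1, c q.1 q.2 + y) ∈ s}) +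
        ∑' k : K₂, p.lam k * volume {y : Plane | (.inr k, y) ∈ s} := by
  have h1 := p.lintegral_intensity c (φ := s.indicator 1) (measurable_one.indicator hs)
  rw [lintegral_indicator_one hs] at h1
  rw [h1]
  congr 1
  · refine tsum_congr fun q => ?_
    congr 1
    have hm : MeasurableSet {y : Plane | ((Sum.inl q.1 : K₁ ⊕ K₂), c q.1 q.2 + y) ∈ s} :=
      (by fun_prop : Measurable fun y : Plane => ((Sum.inl q.1 : K₁ ⊕ K₂), c q.1 q.2 + y)) hs
    rw [← lintegral_indicator_one hm]
    rfl
  · refine tsum_congr fun k => ?_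
    congr 1
    have hm : MeasurableSet {y : Plane | ((Sum.inr k : K₁ ⊕ K₂), y) ∈ s} :=
      (by fun_prop : Measurable fun y : Plane => ((Sum.inr k : K₁ ⊕ K₂), y)) hs
    rw [← lintegral_indicator_one hm]
    rfl

lemma intensity_closedBall_ne_top [Finite K₁] [Finite K₂] {c : K₁ → ℕ → Plane}
    (hc : p.LocallyFinite c) (R : ℕ) : p.intensity c {x | ‖x.2‖ ≤ R} ≠ ∞ := by
  have := Fintype.ofFinite K₁
  have := Fintype.ofFinite K₂
  rw [p.intensity_apply c (measurableSet_le (by fun_prop) measurable_const)]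
  refine ENNReal.add_ne_top.2 ⟨?_, ?_⟩
  · rw [ENNReal.summable.tsum_prod' fun _ => ENNReal.summable, tsum_fintype]
    refine ENNReal.sum_ne_top.2 fun k _ => ?_
    simp only [ENNReal.tsum_mul_left]
    exact ENNReal.mul_ne_top ENNReal.coe_ne_top (hc k R)
  · rw [tsum_fintype]
    refine ENNReal.sum_ne_top.2 fun k _ => ENNReal.mul_ne_top ENNReal.coe_ne_top ?_
    have : {y : Plane | ‖y‖ ≤ R} = Metric.closedBall 0 R := by
      ext; simp
    simp only [Set.mem_ofPred_eq, this]
    exact measure_closedBall_lt_top.ne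

lemma volume_norm_eq (r : ℝ) : volume {y : Plane | ‖y‖ = r} = 0 := by
  have : {y : Plane | ‖y‖ = r} = Metric.sphere 0 r := by ext; simp
  rw [this]
  exact Measure.addHaar_sphere _ _ _

lemma offspring_norm_eq (k : K₁) (z : Plane) (r : ℝ) : p.offspring k {s | ‖z + s‖ = r} = 0 := by
  refine withDensity_absolutelyContinuous _ _ ?_
  have : {s : Plane | ‖z + s‖ = r} = (fun s => z + s) ⁻¹' {y | ‖y‖ = r} := rfl
  rw [this, measure_preimage_add, volume_norm_eq]

/-- The mean power received from `x`, as an effective distance. -/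
def effDist (x : (K₁ ⊕ K₂) × Plane) : ℝ := ‖x.2‖ * p.P x.1 ^ (-(1 / p.α))

lemma measurable_effDist : Measurable p.effDist := by
  have h1 : Measurable fun k : K₁ ⊕ K₂ => p.P k := measurable_from_top
  unfold effDist
  fun_prop

lemma effDist_nonneg (x : (K₁ ⊕ K₂) × Plane) : 0 ≤ p.effDist x :=
  mul_nonneg (norm_nonneg _) (Real.rpow_nonneg (p.P_pos _).le _)

lemma intensity_effDist_eq (c : K₁ → ℕ → Plane) (r : ℝ) :
    p.intensity c {x | p.effDist x = r} = 0 := by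
  rw [p.intensity_apply c (measurableSet_eq_fun p.measurable_effDist measurable_const)]
  have h : ∀ (k : K₁ ⊕ K₂) (y : Plane), p.effDist (k, y) = r ↔ ‖y‖ = r / p.P k ^ (-(1 / p.α)) := by
    intro k y
    rw [effDist, eq_div_iff (Real.rpow_pos_of_pos (p.P_pos k) _).ne']
  simp [h, offspring_norm_eq, volume_norm_eq]

lemma intensity_floor_effDist_ne_top [Finite K₁] [Finite K₂] {c : K₁ → ℕ → Plane}
    (hc : p.LocallyFinite c) (m : ℕ) : p.intensity c {x | ⌊p.effDist x⌋₊ = m} ≠ ∞ := by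
  have := Fintype.ofFinite K₁
  have := Fintype.ofFinite K₂
  -- A single radius for all tiers: the sum of the radii of the tiers bounds each of them.
  obtain ⟨R, hR⟩ := exists_nat_ge (∑ k, (m + 1) * p.P k ^ (1 / p.α))
  refine ((measure_mono ?_).trans_lt (p.intensity_closedBall_ne_top hc R).lt_top).ne
  intro x hx
  have h1 : p.effDist x < m + 1 := by
    rw [← (show ⌊p.effDist x⌋₊ = m from hx)]
    exact Nat.lt_floor_add_one _
  have hP : 0 < p.P x.1 ^ (1 / p.α) := Real.rpow_pos_of_pos (p.P_pos _) _
  rw [effDist, Real.rpow_neg (p.P_pos _).le, ← div_eq_mul_inv, div_lt_iff₀ hP] at h1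
  refine (h1.le.trans ?_).trans hR
  exact Finset.single_le_sum (f := fun k => ((m : ℝ) + 1) * p.P k ^ (1 / p.α))
    (fun k _ => mul_nonneg (by positivity) (Real.rpow_nonneg (p.P_pos k).le _))
    (Finset.mem_univ x.1)

lemma intensity_norm_eq_zero (c : K₁ → ℕ → Plane) : p.intensity c {x | ‖x.2‖ = 0} = 0 := by
  rw [p.intensity_apply c (measurableSet_eq_fun (by fun_prop) measurable_const)]
  simp only [Set.mem_ofPred_eq, offspring_norm_eq, volume_norm_eq, mul_zero, tsum_zero, add_zero]

end Params

/-! ### The coverage probability for fixed cluster centres -/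

/-- The base station `b` of tier `i` is the serving one, and its SINR exceeds the threshold. -/
def Covers (p : Params K₁ K₂) (i : K₁ ⊕ K₂) (c : K₁ → ℕ → Plane) (u : Positions K₁ K₂)
    (h : BS K₁ K₂ → ℝ) (b : BS K₁ K₂) : Prop :=
  b.tier = i ∧ (PresentOf u b ∧ ∀ b', PresentOf u b' →
      p.P b'.tier * ‖locOf c u b'‖ ^ (-p.α) ≤ p.P b.tier * ‖locOf c u b‖ ^ (-p.α)) ∧
    ENNReal.ofReal (p.τ i) < ENNReal.ofReal (p.P b.tier * h b * ‖locOf c u b‖ ^ (-p.α)) /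
      (ENNReal.ofReal p.N₀ + ∑' b' : BS K₁ K₂, open Classical in if b' ≠ b ∧ PresentOf u b' then
        ENNReal.ofReal (p.P b'.tier * h b' * ‖locOf c u b'‖ ^ (-p.α)) else 0)

lemma measurableSet_covers [Countable K₁] [Countable K₂] (p : Params K₁ K₂) (i : K₁ ⊕ K₂)
    (b : BS K₁ K₂) :
    MeasurableSet {x : (K₁ → ℕ → Plane) × Positions K₁ K₂ × (BS K₁ K₂ → ℝ) |
      Covers p i x.1 x.2.1 x.2.2 b} := by
  have hl : ∀ b, Measurable fun x : (K₁ → ℕ → Plane) × Positions K₁ K₂ × (BS K₁ K₂ → ℝ) =>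
      ‖locOf x.1 x.2.1 b‖ := fun b =>
    ((measurable_locOf b).comp (measurable_fst.prodMk (measurable_fst.comp measurable_snd))).norm
  have hp : ∀ b, MeasurableSet {x : (K₁ → ℕ → Plane) × Positions K₁ K₂ × (BS K₁ K₂ → ℝ) |
      PresentOf x.2.1 b} := fun b =>
    (measurable_fst.comp measurable_snd) (measurableSet_presentOf b)
  have hh : ∀ b, Measurable fun x : (K₁ → ℕ → Plane) × Positions K₁ K₂ × (BS K₁ K₂ → ℝ) =>
      x.2.2 b := fun b => by fun_prop
  have h1 : MeasurableSet {x : (K₁ → ℕ → Plane) × Positions K₁ K₂ × (BS K₁ K₂ → ℝ) |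
      ∀ b', PresentOf x.2.1 b' → p.P b'.tier * ‖locOf x.1 x.2.1 b'‖ ^ (-p.α) ≤
        p.P b.tier * ‖locOf x.1 x.2.1 b‖ ^ (-p.α)} := by
    rw [Set.ofPred_forall]
    refine .iInter fun b' => MeasurableSet.imp (hp b') ?_
    exact measurableSet_le (((hl b').pow_const _).const_mul _) (((hl b).pow_const _).const_mul _)
  have h2 : Measurable fun x : (K₁ → ℕ → Plane) × Positions K₁ K₂ × (BS K₁ K₂ → ℝ) =>
      ENNReal.ofReal (p.P b.tier * x.2.2 b * ‖locOf x.1 x.2.1 b‖ ^ (-p.α)) /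
      (ENNReal.ofReal p.N₀ + ∑' b' : BS K₁ K₂, open Classical in
        if b' ≠ b ∧ PresentOf x.2.1 b' then
          ENNReal.ofReal (p.P b'.tier * x.2.2 b' * ‖locOf x.1 x.2.1 b'‖ ^ (-p.α)) else 0) := by
    refine Measurable.div ?_ (Measurable.const_add ?_ _)
    · exact (((hh b).const_mul _).mul ((hl b).pow_const _)).ennreal_ofReal
    · refine Measurable.tsum fun b' => Measurable.ite ?_ ?_ measurable_const
      · exact (MeasurableSet.const _).inter (hp b')
      · exact (((hh b').const_mul _).mul ((hl b').pow_const _)).ennreal_ofReal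
  exact (MeasurableSet.const (b.tier = i)).inter (((hp b).inter h1).inter
    (measurableSet_lt measurable_const h2))

lemma Params.power_le_iff (p : Params K₁ K₂) (i j : K₁ ⊕ K₂) {r y : ℝ} (hr : 0 < r) (hy : 0 < y) :
    p.P j * y ^ (-p.α) ≤ p.P i * r ^ (-p.α) ↔ p.Pbar j i * r ≤ y := by
  have hPr := mul_pos (p.Pbar_pos j i) hr
  have hi := p.P_pos i
  rw [← Real.rpow_le_rpow_iff hPr.le hy.le p.α_pos, p.Pbar_mul_rpow j i hr.le,
    Real.rpow_neg hy.le, Real.rpow_neg hr.le]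
  have h1 := Real.rpow_pos_of_pos hr p.α
  have h2 := Real.rpow_pos_of_pos hy p.α
  rw [← div_eq_mul_inv, ← div_eq_mul_inv, div_le_div_iff₀ h2 h1, div_mul_eq_mul_div,
    div_le_iff₀ hi]
  rw [mul_comm (p.P i)]

/-- The effective distance is a function of the average power, so stations with equal power have
equal effective distance, which almost surely does not happen for distinct stations. -/
lemma Params.effDist_eq (p : Params K₁ K₂) (k : K₁ ⊕ K₂) (y : Plane) :
    p.effDist (k, y) = (p.P k * ‖y‖ ^ (-p.α)) ^ (-(1 / p.α)) := by
  have h1 : -p.α * -(1 / p.α) = 1 := by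
    have := p.α_pos.ne'
    field_simp
  rw [Real.mul_rpow (p.P_pos _).le (by positivity), ← Real.rpow_mul (norm_nonneg _), h1,
    Real.rpow_one, mul_comm, effDist]

open Classical in
-- Clear the denominator and multiply by κ = r^α / P_i. The signal becomes the bare fading variable,
-- the noise a constant, and the interference a weighted sum of fadings: the form treated in
-- `measure_add_tsum_lt_fading`. Absent stations get weight 0.
lemma Params.lt_sinr_iff (p : Params K₁ K₂) (i : K₁ ⊕ K₂) (b : BS K₁ K₂) (D : BS K₁ K₂ → Prop)
    (x : BS K₁ K₂ → ℝ) (h : BS K₁ K₂ → ℝ) {r : ℝ} (hr : 0 < r) (hx : ∀ b', D b' → 0 < x b') :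
    ENNReal.ofReal (p.τ i) < ENNReal.ofReal (p.P i * h b * r ^ (-p.α)) /
      (ENNReal.ofReal p.N₀ + ∑' b' : BS K₁ K₂, if b' ≠ b ∧ D b' then
        ENNReal.ofReal (p.P b'.tier * h b' * x b' ^ (-p.α)) else 0) ↔
    ENNReal.ofReal (p.τ i * p.N₀ * r ^ p.α / p.P i) + (∑' b', if b' = b then 0 else
      ENNReal.ofReal ((if D b' then p.τ i * ((p.Pbar b'.tier i * r) ^ p.α / x b' ^ p.α) else 0) *
        h b')) < ENNReal.ofReal (h b) := by
  have hi := p.P_pos i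
  have hτ := p.τ_pos i
  have hra := Real.rpow_pos_of_pos hr p.α
  set κ := r ^ p.α / p.P i with hκ
  have hκ0 : 0 < κ := div_pos hra hi
  have hN := p.N₀_nonneg
  rw [ENNReal.lt_div_iff_mul_lt (Or.inr ENNReal.ofReal_ne_top) (Or.inr (by simpa using hτ)),
    ← ENNReal.mul_lt_mul_iff_right (a := ENNReal.ofReal κ) (by simpa using hκ0)
      ENNReal.ofReal_ne_top]
  have h1 : ENNReal.ofReal κ * ENNReal.ofReal (p.P i * h b * r ^ (-p.α)) =
      ENNReal.ofReal (h b) := by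
    rw [← ENNReal.ofReal_mul hκ0.le, Real.rpow_neg hr.le, hκ]
    congr 1
    field_simp
  have h2 : ENNReal.ofReal κ * (ENNReal.ofReal (p.τ i) * (ENNReal.ofReal p.N₀ +
      ∑' b' : BS K₁ K₂, if b' ≠ b ∧ D b' then
        ENNReal.ofReal (p.P b'.tier * h b' * x b' ^ (-p.α)) else 0)) =
      ENNReal.ofReal (p.τ i * p.N₀ * r ^ p.α / p.P i) + (∑' b', if b' = b then 0 else
      ENNReal.ofReal ((if D b' then p.τ i * ((p.Pbar b'.tier i * r) ^ p.α / x b' ^ p.α) else 0) *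
        h b')) := by
    rw [← mul_assoc, mul_add, ← ENNReal.tsum_mul_left, ← ENNReal.ofReal_mul hκ0.le,
      ← ENNReal.ofReal_mul (by positivity)]
    congr 1
    · congr 1
      rw [hκ]
      ring
    · refine tsum_congr fun b' => ?_
      by_cases hb : b' = b
      · simp [hb]
      · by_cases hD : D b'
        · simp only [ne_eq, hb, not_false_eq_true, hD, and_self, if_true, if_false]
          rw [← ENNReal.ofReal_mul (by positivity), p.Pbar_mul_rpow _ _ hr.le,
            Real.rpow_neg (hx b' hD).le, hκ]
          congr 1
          field_simp
        · simp [hb, hD]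
  rw [h1, h2]

namespace Network

variable {Ω : Type*} [mΩ : MeasurableSpace Ω] {μ : Measure Ω}
  {p : Params K₁ K₂} (W : Network μ p)

/-- The probability, over the fading, that `b` is the serving base station and covers the user. -/
lemma measure_covers [Countable K₁] [Countable K₂] [IsProbabilityMeasure μ] (c : K₁ → ℕ → Plane)
    (ω₀ : Ω) (b : BS K₁ K₂) (i : K₁ ⊕ K₂)
    (hpos : ∀ b', ω₀ ∈ W.presentSet b' → ‖(W.site c b' ω₀).2‖ ≠ 0) :
    μ {ω | Covers p i c (W.positions ω₀) (fun b => W.h b ω) b} =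
      (W.presentSet b).indicator (fun ω => p.noiseWeight i (W.site c b ω)) ω₀ *
        expNeg (otherSum (W.site c) W.presentSet (p.attenuation i ‖(W.site c b ω₀).2‖) b ω₀) := by
  classical
  by_cases hb : ω₀ ∈ W.presentSet b
  swap
  · have : {ω | Covers p i c (W.positions ω₀) (fun b => W.h b ω) b} = ∅ :=
      Set.eq_empty_of_forall_notMem fun ω hω => hb hω.2.1.1
    simp [hb, this]
  by_cases hi : b.tier = i
  swap
  · have : {ω | Covers p i c (W.positions ω₀) (fun b => W.h b ω) b} = ∅ :=
      Set.eq_empty_of_forall_notMem fun ω hω => hi hω.1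
    simp [hb, this, Params.noiseWeight, site, hi]
  set r := ‖(W.site c b ω₀).2‖ with hr
  have hr0 : 0 < r := lt_of_le_of_ne (norm_nonneg _) (hpos b hb).symm
  have hpos' : ∀ b', PresentOf (W.positions ω₀) b' → 0 < ‖locOf c (W.positions ω₀) b'‖ :=
    fun b' hb' => lt_of_le_of_ne (norm_nonneg _) (hpos b' hb').symm
  -- Maximal average power means that every exclusion disc, of radius P̄ r for the respective tier,
  -- is empty.
  have hserv : (∀ b', PresentOf (W.positions ω₀) b' →
      p.P b'.tier * ‖locOf c (W.positions ω₀) b'‖ ^ (-p.α) ≤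
        p.P b.tier * ‖locOf c (W.positions ω₀) b‖ ^ (-p.α)) ↔
      ∀ b', ω₀ ∈ W.presentSet b' → ¬ ‖(W.site c b' ω₀).2‖ < p.Pbar b'.tier i * r := by
    refine forall_congr' fun b' => forall_congr' fun hb' => ?_
    rw [not_lt, ← hi]
    exact p.power_le_iff _ _ hr0 (hpos' b' hb')
  by_cases hs : ∀ b', ω₀ ∈ W.presentSet b' → ¬ ‖(W.site c b' ω₀).2‖ < p.Pbar b'.tier i * r
  · have hset : {ω | Covers p i c (W.positions ω₀) (fun b => W.h b ω) b} =
        {ω | ENNReal.ofReal (p.τ i * p.N₀ * r ^ p.α / p.P i) + (∑' b', if b' = b then 0 else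
          ENNReal.ofReal ((if PresentOf (W.positions ω₀) b' then p.τ i *
            ((p.Pbar b'.tier i * r) ^ p.α / ‖locOf c (W.positions ω₀) b'‖ ^ p.α) else 0) *
              W.h b' ω)) < ENNReal.ofReal (W.h b ω)} := by
      ext ω
      have h1 := p.lt_sinr_iff i b (PresentOf (W.positions ω₀))
        (fun b' => ‖locOf c (W.positions ω₀) b'‖) (fun b' => W.h b' ω) hr0 hpos'
      rw [Set.mem_ofPred_eq, Set.mem_ofPred_eq, ← h1, Covers, hserv, hi]
      exact ⟨fun h => h.2.2, fun h => ⟨rfl, ⟨hb, hs⟩, h⟩⟩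
    have hτ := p.τ_pos i
    have hP := p.P_pos i
    have hN := p.N₀_nonneg
    rw [hset, W.measure_add_tsum_lt_fading b (by positivity)]
    · congr 1
      · simp only [hb, Set.indicator_of_mem]
        rw [Params.noiseWeight, Set.indicator_of_mem]
        exact hi
      · congr 1
        refine tsum_congr fun b' => ?_
        by_cases hbb : b' = b
        · simp [hbb]
        · by_cases hb' : ω₀ ∈ W.presentSet b'
          · simp only [hbb, if_false, hb', Set.indicator_of_mem]
            have hb'' : PresentOf (W.positions ω₀) b' := hb'
            have h1 : ¬ ‖(W.site c b' ω₀).2‖ < p.Pbar (W.site c b' ω₀).1 i * r := hs b' hb'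
            rw [Params.attenuation, if_neg h1, if_pos hb'']
            rfl
          · have : ¬ PresentOf (W.positions ω₀) b' := hb'
            simp [hbb, hb', this]
    · intro b'
      split_ifs
      · have := (p.Pbar_pos b'.tier i)
        positivity
      · exact le_rfl
  · have h1 : {ω | Covers p i c (W.positions ω₀) (fun b => W.h b ω) b} = ∅ :=
      Set.eq_empty_of_forall_notMem fun ω hω => hs (hserv.1 hω.2.1.2)
    rw [h1, measure_empty]
    push Not at hs
    obtain ⟨b', hb', hlt⟩ := hs
    -- A station is never inside its own exclusion disc, since `Pbar i i = 1`. Hence the stronger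
    -- station occurs in `otherSum` with infinite attenuation, and both sides vanish.
    have hne : b' ≠ b := by
      rintro rfl
      rw [hi, p.Pbar_self, one_mul] at hlt
      exact lt_irrefl _ hlt
    have h2 : otherSum (W.site c) W.presentSet (p.attenuation i r) b ω₀ = ∞ := by
      refine ENNReal.tsum_eq_top_of_eq_top ⟨b', ?_⟩
      rw [if_neg hne, Set.indicator_of_mem hb', Params.attenuation, if_pos]
      exact hlt
    rw [h2, expNeg_top, mul_zero]

lemma indepFun_positions_fading : IndepFun W.positions (fun ω b => W.h b ω) μ := by
  have h1 := indep_iSup_of_disjoint W.sourceSigma_le W.iIndep_sourceSigma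
    (S := {s | (∃ k n, s = .count k n) ∨ (∃ k n l, s = .offset k n l) ∨ ∃ k, s = .ppp k})
    (T := {s | ∃ b, s = .fading b}) (by
      refine Set.disjoint_left.2 ?_
      rintro s (⟨k, n, rfl⟩ | ⟨k, n, l, rfl⟩ | ⟨k, rfl⟩) ⟨b, hb⟩ <;> simp at hb)
  refine indep_of_indep_of_le_left (indep_of_indep_of_le_right h1 ?_) ?_
  · refine measurable_iff_comap_le.1 (@measurable_pi_lambda _ _ _ (_) _ _ fun b => ?_)
    exact W.measurable_iSup_sourceSigma ⟨b, rfl⟩ (W.measurable_fading_source b)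
  · exact measurable_iff_comap_le.1 (measurable_positions_mk
      (fun k n => W.measurable_iSup_sourceSigma (Or.inl ⟨k, n, rfl⟩)
        (W.measurable_count_source k n))
      (fun k n l => W.measurable_iSup_sourceSigma (Or.inr (Or.inl ⟨k, n, l, rfl⟩))
        (W.measurable_offset_source k n l))
      (fun k n => W.measurable_iSup_sourceSigma (Or.inr (Or.inr ⟨k, rfl⟩))
        (W.measurable_ppp_source k n)))

lemma measurable_fading : Measurable fun ω b => W.h b ω :=
  measurable_pi_lambda _ W.h_measurable

end Network

/-- The coverage probability, given the cluster centres. -/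
def Params.coverageProb (p : Params K₁ K₂) (i : K₁ ⊕ K₂) (c : K₁ → ℕ → Plane) : ℝ≥0∞ :=
  ∫⁻ x, p.noiseWeight i x *
    expNeg (∫⁻ y, (1 - expNeg (p.attenuation i ‖x.2‖ y)) ∂(p.intensity c)) ∂(p.intensity c)

lemma Params.lintegral_floor_noiseWeight_ne_top [Finite K₁] [Finite K₂] (p : Params K₁ K₂)
    (i : K₁ ⊕ K₂) {c : K₁ → ℕ → Plane} (hc : p.LocallyFinite c) (m : ℕ) :
    ∫⁻ x, {x : (K₁ ⊕ K₂) × Plane | ⌊‖x.2‖⌋₊ = m}.indicator (p.noiseWeight i) x ∂(p.intensity c)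
      ≠ ∞ := by
  have hm : MeasurableSet {x : (K₁ ⊕ K₂) × Plane | ‖x.2‖ ≤ (m + 1 : ℕ)} :=
    measurableSet_le (by fun_prop) measurable_const
  refine ((lintegral_mono (g := {x | ‖x.2‖ ≤ (m + 1 : ℕ)}.indicator 1) fun x => ?_).trans_lt
    ?_).ne
  · refine (Set.indicator_le_indicator (g := 1) (p.noiseWeight_le_one i x)).trans ?_
    refine Set.indicator_le_indicator_of_subset (fun x hx => ?_) (fun _ => zero_le) x
    have := Nat.lt_floor_add_one ‖x.2‖
    rw [show ⌊‖x.2‖⌋₊ = m from hx] at this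
    simpa using this.le
  · rw [lintegral_indicator_one hm]
    exact (p.intensity_closedBall_ne_top hc _).lt_top

/-- The probability of coverage if the cluster centres are fixed. -/
theorem Network.measure_exists_covers [Finite K₁] [Finite K₂] {Ω : Type*} [MeasurableSpace Ω]
    {μ : Measure Ω} [IsProbabilityMeasure μ] {p : Params K₁ K₂} (W : Network μ p)
    (i : K₁ ⊕ K₂) {c : K₁ → ℕ → Plane} (hc : p.LocallyFinite c) :
    μ {ω | ∃ b, Covers p i c (W.positions ω) (fun b => W.h b ω) b} = p.coverageProb i c := by
  have hL := W.poissonLaplace c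
  have hcm : ∀ b, MeasurableSet {x : Positions K₁ K₂ × (BS K₁ K₂ → ℝ) | Covers p i c x.1 x.2 b} :=
    fun b => measurable_prodMk_left (measurableSet_covers p i b)
  have hset : MeasurableSet
      {x : Positions K₁ K₂ × (BS K₁ K₂ → ℝ) | ∃ b, Covers p i c x.1 x.2 b} := by
    rw [Set.ofPred_exists]
    exact .iUnion hcm
  have h1 := lintegral_comp_prodMk_of_indepFun W.measurable_positions W.measurable_fading
    W.indepFun_positions_fading (f := {x | ∃ b, Covers p i c x.1 x.2 b}.indicator 1)
    (measurable_one.indicator hset)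
  have h2 : ∫⁻ ω, {x : Positions K₁ K₂ × (BS K₁ K₂ → ℝ) | ∃ b, Covers p i c x.1 x.2 b}.indicator 1
      (W.positions ω, fun b => W.h b ω) ∂μ =
      μ {ω | ∃ b, Covers p i c (W.positions ω) (fun b => W.h b ω) b} :=
    lintegral_indicator_one (μ := μ) ((W.measurable_positions.prodMk W.measurable_fading) hset)
  have h3 : ∀ ω₀, ∫⁻ ω,
      {x : Positions K₁ K₂ × (BS K₁ K₂ → ℝ) | ∃ b, Covers p i c x.1 x.2 b}.indicator 1
      (W.positions ω₀, fun b => W.h b ω) ∂μ =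
      μ (⋃ b, {ω | Covers p i c (W.positions ω₀) (fun b => W.h b ω) b}) := by
    intro ω₀
    rw [← Set.ofPred_exists]
    exact lintegral_indicator_one (μ := μ) ((measurable_const.prodMk W.measurable_fading) hset)
  have hties := hL.ae_ne_of_ne p.measurable_effDist p.effDist_nonneg
    (p.intensity_floor_effDist_ne_top hc) (p.intensity_effDist_eq c)
  have hzero := hL.ae_forall_notMem (s := {x | ‖x.2‖ = 0})
    (measurableSet_eq_fun (by fun_prop) measurable_const) (p.intensity_norm_eq_zero c)
  have hatt := p.measurable_attenuation i
  have hm1 : ∀ b, Measurable ((W.presentSet b).indicator fun ω => p.noiseWeight i (W.site c b ω)) :=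
    fun b => ((p.measurable_noiseWeight i).comp (W.measurable_site c b)).indicator
      (W.measurableSet_presentSet b)
  have hnorm : Measurable fun x : (K₁ ⊕ K₂) × Plane => ‖x.2‖ := by fun_prop
  have hm2 : ∀ b, Measurable fun ω => expNeg (otherSum (W.site c) W.presentSet
      (p.attenuation i ‖(W.site c b ω).2‖) b ω) := fun b =>
    measurable_expNeg.comp (hL.measurable_otherSum_self hnorm hatt b)
  rw [← h2, h1]
  simp_rw [h3]
  rw [Params.coverageProb, ← hL.mecke (t := fun x => ‖x.2‖) (v := p.attenuation i)
    (p.measurable_noiseWeight i)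
    (fun x => ((p.noiseWeight_le_one i x).trans_lt ENNReal.one_lt_top).ne)
    (by fun_prop) (fun x => norm_nonneg _) hatt (p.attenuation_mono i)
    (p.attenuation_continuousWithinAt i) ?_ (p.lintegral_floor_noiseWeight_ne_top i hc),
    ← lintegral_tsum]
  · refine lintegral_congr_ae ?_
    filter_upwards [hties, hzero] with ω₀ ht hz
    -- The positions are fixed and only the fading is random. Without ties at most one station
    -- serves, so the events are disjoint.
    rw [measure_iUnion]
    · exact tsum_congr fun b => W.measure_covers c ω₀ b i hz
    · intro b b' hne
      refine Set.disjoint_left.2 fun ω hω hω' => ?_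
      have hb := hω.2.1.1
      have hb' := hω'.2.1.1
      refine ht b b' hne hb hb' ?_
      have e1 := le_antisymm (hω'.2.1.2 b hb) (hω.2.1.2 b' hb')
      rw [site, site, p.effDist_eq, p.effDist_eq, e1]
    · exact fun b => (measurable_const.prodMk W.measurable_fading) (hcm b)
  · exact fun b => ((hm1 b).mul (hm2 b)).aemeasurable
  -- A nonzero noise weight forces tier `i`. The point then lies on the boundary of its own open
  -- exclusion disc, where the attenuation is still finite.
  · intro x hx
    have hxi : x.1 = i := by
      by_contra hne
      exact hx (Set.indicator_of_notMem (by exact hne) _)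
    rw [Params.attenuation, if_neg]
    · exact ENNReal.ofReal_ne_top
    · rw [hxi, p.Pbar_self, one_mul]
      exact lt_irrefl _

/-! ### Measurability of the coverage formula in the centres -/

lemma lintegral_eq_tsum_floor {E : Type*} [MeasurableSpace E] {Λ : Measure E} {f F : E → ℝ≥0∞}
    (hf : Measurable f) (hF : Measurable F) {t : E → ℝ} (ht : Measurable t) :
    ∫⁻ x, f x * F x ∂Λ = ∑' m : ℕ, ∫⁻ x, {x | ⌊t x⌋₊ = m}.indicator f x * F x ∂Λ := by
  have := lintegral_mul_floor_eq_tsum (ν := Λ) hf ht 0 (fun _ => F) (fun _ => hF)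
  simpa using this

/-- A version of the coverage probability, as a limit of functions of integrals with respect to
the intensity measure. -/
def Params.coverageProbLim (p : Params K₁ K₂) (i : K₁ ⊕ K₂) (c : K₁ → ℕ → Plane) : ℝ≥0∞ :=
  ∑' m : ℕ, limsup (fun n => meckeApprox
    ({x : (K₁ ⊕ K₂) × Plane | ⌊‖x.2‖⌋₊ = m}.indicator (p.noiseWeight i)) (fun x => ‖x.2‖)
    (p.attenuation i) n (p.intensity c)) atTop

/-- The limsup is defined for all centres and is visibly measurable in the integrals against the
intensity measure. Local finiteness makes the approximations converge on every shell, so that it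
agrees with the integral formula. -/
lemma Params.coverageProbLim_eq [Finite K₁] [Finite K₂] (p : Params K₁ K₂) (i : K₁ ⊕ K₂)
    {c : K₁ → ℕ → Plane} (hc : p.LocallyFinite c) : p.coverageProbLim i c = p.coverageProb i c := by
  have hg := p.measurable_noiseWeight i
  have hv := p.measurable_attenuation i
  have ht : Measurable fun x : (K₁ ⊕ K₂) × Plane => ‖x.2‖ := by fun_prop
  have hF : Measurable fun x : (K₁ ⊕ K₂) × Plane =>
      expNeg (∫⁻ y, (1 - expNeg (p.attenuation i ‖x.2‖ y)) ∂(p.intensity c)) := by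
    have hj : Measurable fun z : ((K₁ ⊕ K₂) × Plane) × ((K₁ ⊕ K₂) × Plane) =>
        p.attenuation i ‖z.1.2‖ z.2 :=
      hv.comp (f := fun z : ((K₁ ⊕ K₂) × Plane) × ((K₁ ⊕ K₂) × Plane) => (‖z.1.2‖, z.2))
        (by fun_prop)
    have hj' : Measurable fun z : ((K₁ ⊕ K₂) × Plane) × ((K₁ ⊕ K₂) × Plane) =>
        1 - expNeg (p.attenuation i ‖z.1.2‖ z.2) := by fun_prop
    have hj'' := Measurable.lintegral_prod_right' (ν := p.intensity c) hj'
    exact measurable_expNeg.comp hj''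
  rw [coverageProbLim, coverageProb, lintegral_eq_tsum_floor hg hF ht]
  refine tsum_congr fun m => Tendsto.limsup_eq ?_
  refine tendsto_meckeApprox (hg.indicator ?_) (fun x => ?_) ht (fun x => norm_nonneg _)
    (fun r => hv.of_uncurry_left) (p.attenuation_mono i) (p.attenuation_continuousWithinAt i)
    (p.lintegral_floor_noiseWeight_ne_top i hc m)
  · exact (measurableSet_singleton m).preimage (Nat.measurable_floor.comp ht)
  · exact ((Set.indicator_le_self _ _ _).trans_lt
      ((p.noiseWeight_le_one i x).trans_lt ENNReal.one_lt_top)).ne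

lemma measurable_ite_match {Ω : Type*} {m : MeasurableSpace Ω} {q : Prop} [Decidable q]
    {Z : ℕ → Ω → Plane} {z : Ω → Plane} (hZ : ∀ n, Measurable (Z n)) (hz : Measurable z) (n : ℕ) :
    Measurable fun ω => if q then (match n with | 0 => z ω | n + 1 => Z n ω) else Z n ω := by
  split_ifs
  · cases n with
    | zero => exact hz
    | succ n => exact hZ n
  · exact hZ n

lemma measurable_config_eval {ι : Type*} (k : ι) :
    Measurable fun c : ι → ℕ → Plane => config (c k) :=
  measurable_config (X := fun n (c : ι → ℕ → Plane) => c k n) fun n => by fun_prop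

lemma measurableSet_exists_covers [Countable K₁] [Countable K₂] (p : Params K₁ K₂) (i : K₁ ⊕ K₂) :
    MeasurableSet {x : (K₁ → ℕ → Plane) × Positions K₁ K₂ × (BS K₁ K₂ → ℝ) |
      ∃ b, Covers p i x.1 x.2.1 x.2.2 b} := by
  rw [Set.ofPred_exists]
  exact .iUnion fun b => measurableSet_covers p i b

lemma measurable_tsum_mul_lintegral_config {ι Ω : Type*} [Countable ι] {m : MeasurableSpace Ω}
    {f : ι → Plane → ℝ≥0∞} (hf : ∀ k, Measurable (f k)) (a : ι → ℝ≥0∞) {N : ι → Ω → Measure Plane}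
    (hN : ∀ k, Measurable (N k)) (b : ℝ≥0∞) :
    Measurable fun ω => (∑' k, a k * ∫⁻ z, f k z ∂(N k ω)) + b :=
  (Measurable.tsum fun k =>
    ((Measure.measurable_lintegral (hf k)).comp (hN k)).const_mul _).add_const _

lemma measurable_tsum_mul_expNeg {Ω : Type*} {m : MeasurableSpace Ω} {f g : ℕ → Ω → ℝ≥0∞}
    (hf : ∀ k, Measurable (f k)) (hg : ∀ k, Measurable (g k)) :
    Measurable fun ω => ∑' k, f k ω * expNeg (g k ω) :=
  Measurable.tsum fun k => (hf k).mul (measurable_expNeg.comp (hg k))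

lemma measurable_tsum_limsup {Ω : Type*} {m : MeasurableSpace Ω} {f : ℕ → ℕ → Ω → ℝ≥0∞}
    (hf : ∀ k n, Measurable (f k n)) :
    Measurable fun ω => ∑' k, limsup (fun n => f k n ω) atTop :=
  Measurable.tsum fun k => Measurable.limsup (hf k)

lemma measurable_toReal_of {Ω : Type*} {m : MeasurableSpace Ω} {f : Ω → ℝ≥0∞}
    (hf : Measurable f) : Measurable fun ω => (f ω).toReal := hf.ennreal_toReal

/-! ### Conditioning on the parent point processes -/

namespace Network

variable [DecidableEq K₁] {Ω : Type*} [mΩ : MeasurableSpace Ω] {μ : Measure Ω}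
  {p : Params K₁ K₂} (W : Network μ p)

/-- All cluster centres. -/
def centers (ω : Ω) : K₁ → ℕ → Plane := fun k n => W.center k n ω

lemma measurable_center (k : K₁) (n : ℕ) : Measurable (W.center k n) :=
  measurable_ite_match (fun n => (W.Z_poisson k).measurable n) W.z₀_measurable n

lemma measurable_centers : Measurable W.centers :=
  measurable_pi_lambda _ fun k => measurable_pi_lambda _ fun n => W.measurable_center k n

lemma parentSigma_le : W.parentSigma ≤ mΩ :=
  iSup_le fun k => measurable_iff_comap_le.1 (measurable_config (W.measurable_center k))

lemma measurable_config_center (k : K₁) :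
    Measurable[W.parentSigma] fun ω => config fun n => W.center k n ω :=
  (comap_measurable _).mono
    (le_iSup (fun k => MeasurableSpace.comap (fun ω => config fun n => W.center k n ω) _) k) le_rfl

/-- Parent events are thereby events about the enumerated centres, to which independence applies. -/
lemma parentSigma_le_comap_centers :
    W.parentSigma ≤ MeasurableSpace.comap W.centers inferInstance := by
  refine iSup_le fun k => ?_
  have h2 : Measurable[MeasurableSpace.comap W.centers inferInstance]
      fun ω => config (W.centers ω k) := (measurable_config_eval k).comp (comap_measurable _)
  exact measurable_iff_comap_le.1 h2

lemma loc_eq (b : BS K₁ K₂) (ω : Ω) : W.loc b ω = locOf (W.centers ω) (W.positions ω) b := by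
  rcases b with ⟨k, n, l⟩ | ⟨k, n⟩ <;> rfl

lemma coverage_eq (i : K₁ ⊕ K₂) : W.coverage i =
    {ω | ∃ b, Covers p i (W.centers ω) (W.positions ω) (fun b => W.h b ω) b} := by
  unfold coverage Covers IsServing SINR avgPower rxPower
  simp only [loc_eq]
  congr! 10 with ω b
  refine funext fun b' => ?_
  have h : W.Present b' ω ↔ PresentOf (W.positions ω) b' := by
    rcases b' with ⟨k, n, l⟩ | ⟨k, n⟩ <;> rfl
  congr! 1

lemma measurableSet_coverage [Countable K₁] [Countable K₂] (i : K₁ ⊕ K₂) :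
    MeasurableSet (W.coverage i) := by
  rw [coverage_eq]
  exact (W.measurable_centers.prodMk (W.measurable_positions.prodMk W.measurable_fading))
    (measurableSet_exists_covers p i)

lemma indepFun_centers :
    IndepFun W.centers (fun ω => (W.positions ω, fun b => W.h b ω)) μ := by
  have h1 := indep_iSup_of_disjoint W.sourceSigma_le W.iIndep_sourceSigma
    (S := {s | (∃ k, s = .parent k) ∨ s = .userCenter})
    (T := {s | (∃ k n, s = .count k n) ∨ (∃ k n l, s = .offset k n l) ∨ (∃ k, s = .ppp k) ∨
      ∃ b, s = .fading b}) (by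
      refine Set.disjoint_left.2 ?_
      rintro s (⟨k, rfl⟩ | rfl) (⟨k, n, h⟩ | ⟨k, n, l, h⟩ | ⟨k, h⟩ | ⟨b, h⟩) <;> simp at h)
  refine indep_of_indep_of_le_left (indep_of_indep_of_le_right h1 ?_) ?_
  · refine measurable_iff_comap_le.1 (@Measurable.prodMk _ _ _ _ _ (_) _ _ ?_
      (@measurable_pi_lambda _ _ _ (_) _ _ fun b => ?_))
    · exact measurable_positions_mk
        (fun k n => W.measurable_iSup_sourceSigma (Or.inl ⟨k, n, rfl⟩)
          (W.measurable_count_source k n))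
        (fun k n l => W.measurable_iSup_sourceSigma (Or.inr (Or.inl ⟨k, n, l, rfl⟩))
          (W.measurable_offset_source k n l))
        (fun k n => W.measurable_iSup_sourceSigma (Or.inr (Or.inr (Or.inl ⟨k, rfl⟩)))
          (W.measurable_ppp_source k n))
    · exact W.measurable_iSup_sourceSigma (Or.inr (Or.inr (Or.inr ⟨b, rfl⟩)))
        (W.measurable_fading_source b)
  · refine measurable_iff_comap_le.1 (@measurable_pi_lambda _ _ _ (_) _ _ fun k =>
      @measurable_pi_lambda _ _ _ (_) _ _ fun n => measurable_ite_match (fun n => ?_) ?_ n)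
    · exact W.measurable_iSup_sourceSigma (Or.inl ⟨k, rfl⟩)
        ((measurable_pi_apply n).comp (comap_measurable (fun ω n => W.Z k n ω)))
    · exact W.measurable_iSup_sourceSigma (Or.inr rfl) (comap_measurable _)

/-- Almost surely, the mean number of offspring points in each disc is finite, given the cluster
centres. -/
lemma ae_locallyFinite [Countable K₁] [IsProbabilityMeasure μ] :
    ∀ᵐ ω ∂μ, p.LocallyFinite (W.centers ω) := by
  simp only [Params.LocallyFinite, ae_all_iff]
  intro k R
  let w : Plane → ℝ≥0∞ := fun z => p.offspring k {s | ‖z + s‖ ≤ R}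
  have hset : MeasurableSet {x : Plane × Plane | ‖x.1 + x.2‖ ≤ R} :=
    measurableSet_le (by fun_prop) measurable_const
  have hw : Measurable w := measurable_measure_prodMk_left hset
  -- By Fubini and translation invariance the integral of `w` over the plane is the area of the
  -- disc; Campbell's formula then applies.
  have hI : ∫⁻ z, w z ∂(p.lamP k • volume : Measure Plane) ≠ ∞ := by
    rw [lintegral_smul_measure]
    refine ENNReal.mul_ne_top ENNReal.coe_ne_top ?_
    have h1 := Measure.prod_apply (μ := (volume : Measure Plane)) (ν := p.offspring k) hset
    have h2 := Measure.prod_apply_symm (μ := (volume : Measure Plane)) (ν := p.offspring k) hset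
    have h3 : ∀ s : Plane,
        volume ((fun z : Plane => (z, s)) ⁻¹' {x : Plane × Plane | ‖x.1 + x.2‖ ≤ R}) =
        volume (Metric.closedBall (0 : Plane) R) := by
      intro s
      rw [← measure_preimage_add_right volume s (Metric.closedBall (0 : Plane) R)]
      congr 1
      ext z
      rw [Set.mem_preimage, Set.mem_preimage, mem_closedBall_zero_iff]
      rfl
    simp only [h3, lintegral_const, measure_univ, mul_one] at h2
    rw [show ∫⁻ z, w z = _ from h1.symm, h2]
    exact measure_closedBall_lt_top.ne
  have hP := (W.Z_poisson k).poissonLaplace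
  have h1 := ae_lt_top (hP.measurable_pointSum hw) ((hP.lintegral_pointSum hw hI).trans_ne hI)
  filter_upwards [h1] with ω hω
  have h2 : ∑' n, w (W.Z k n ω) ≠ ∞ := by simpa [pointSum] using hω.ne
  change ∑' n, w (W.center k n ω) ≠ ∞
  by_cases hk : p.coupled = some k
  -- The additional centre is number 0; it shifts the others and contributes one probability.
  · rw [tsum_eq_zero_add' ENNReal.summable]
    simp only [center, hk, if_true]
    exact ENNReal.add_ne_top.2 ⟨(measure_lt_top _ _).ne, h2⟩
  · simpa [center, hk] using h2

/-- The sum over the centres of a tier is an integral against their counting measure, so the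
enumeration drops out. -/
lemma measurable_lintegral_intensity [Countable K₁] {φ : (K₁ ⊕ K₂) × Plane → ℝ≥0∞}
    (hφ : Measurable φ) :
    Measurable[W.parentSigma] fun ω => ∫⁻ x, φ x ∂(p.intensity (W.centers ω)) := by
  have h1 : ∀ k : K₁, Measurable fun z : Plane => ∫⁻ s, φ (.inl k, z + s) ∂(p.offspring k) :=
    fun k => Measurable.lintegral_prod_right' (f := fun x : Plane × Plane => φ (.inl k, x.1 + x.2))
      (by fun_prop)
  have h2 : ∀ ω, ∫⁻ x, φ x ∂(p.intensity (W.centers ω)) =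
      (∑' k : K₁, p.mbar k * ∫⁻ z, ∫⁻ s, φ (.inl k, z + s) ∂(p.offspring k)
        ∂(config fun n => W.center k n ω)) + ∑' k : K₂, p.lam k * ∫⁻ y, φ (.inr k, y) := by
    intro ω
    rw [p.lintegral_intensity _ hφ, ENNReal.summable.tsum_prod' fun _ => ENNReal.summable]
    congr 1
    refine tsum_congr fun k => ?_
    rw [lintegral_config _ (h1 k), ← ENNReal.tsum_mul_left]
    rfl
  simp_rw [h2]
  exact measurable_tsum_mul_lintegral_config h1 _ W.measurable_config_center _

lemma measurable_meckeApprox [Countable K₁] {g : (K₁ ⊕ K₂) × Plane → ℝ≥0∞}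
    {t : (K₁ ⊕ K₂) × Plane → ℝ} {v : ℝ → (K₁ ⊕ K₂) × Plane → ℝ≥0∞} (hg : Measurable g)
    (ht : Measurable t) (hv : ∀ r, Measurable (v r)) (n : ℕ) :
    Measurable[W.parentSigma] fun ω => meckeApprox g t v n (p.intensity (W.centers ω)) :=
  measurable_tsum_mul_expNeg
    (fun k => W.measurable_lintegral_intensity (hg.indicator (measurableSet_floor_eq ht n k)))
    (fun k => W.measurable_lintegral_intensity
      (measurable_const.sub (measurable_expNeg.comp (hv (k / 2 ^ n)))))

lemma measurable_coverageProbLim [Countable K₁] [Countable K₂] (i : K₁ ⊕ K₂) :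
    Measurable[W.parentSigma] fun ω => p.coverageProbLim i (W.centers ω) := by
  have ht : Measurable fun x : (K₁ ⊕ K₂) × Plane => ‖x.2‖ := by fun_prop
  refine measurable_tsum_limsup fun m n => W.measurable_meckeApprox
    ((p.measurable_noiseWeight i).indicator ?_) ht
    (fun r => (p.measurable_attenuation i).of_uncurry_left) n
  exact (measurableSet_singleton m).preimage (Nat.measurable_floor.comp ht)

/-- The centres are independent of positions and fading. Fubini therefore replaces the coverage
indicator by its probability for frozen centres, which `measure_exists_covers` evaluates for almost
all of them. -/
lemma setLIntegral_coverageProb [Finite K₁] [Finite K₂] [IsProbabilityMeasure μ] (i : K₁ ⊕ K₂)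
    {s : Set Ω} (hs : MeasurableSet[W.parentSigma] s) :
    ∫⁻ ω in s, p.coverageProbLim i (W.centers ω) ∂μ = μ (W.coverage i ∩ s) := by
  obtain ⟨s', hs', rfl⟩ := W.parentSigma_le_comap_centers s hs
  have hB := measurableSet_exists_covers p i
  have hU : Measurable fun ω => (W.positions ω, fun b => W.h b ω) :=
    W.measurable_positions.prodMk W.measurable_fading
  have hf : Measurable fun x : (K₁ → ℕ → Plane) × Positions K₁ K₂ × (BS K₁ K₂ → ℝ) =>
      {x : (K₁ → ℕ → Plane) × Positions K₁ K₂ × (BS K₁ K₂ → ℝ) |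
        ∃ b, Covers p i x.1 x.2.1 x.2.2 b}.indicator (fun _ => (1 : ℝ≥0∞)) x *
      s'.indicator (fun _ => 1) x.1 :=
    (measurable_const.indicator hB).mul ((measurable_const.indicator hs').comp measurable_fst)
  have h1 := lintegral_comp_prodMk_of_indepFun W.measurable_centers hU W.indepFun_centers hf
  have hset : MeasurableSet (W.centers ⁻¹' s') := W.measurable_centers hs'
  have h2 : μ (W.coverage i ∩ W.centers ⁻¹' s') = ∫⁻ ω, (W.coverage i).indicator (fun _ => 1) ω *
      s'.indicator (fun _ => 1) (W.centers ω) ∂μ := by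
    rw [← lintegral_indicator_one ((W.measurableSet_coverage i).inter hset),
      Set.inter_indicator_one]
    rfl
  rw [h2, ← lintegral_indicator hset]
  rw [coverage_eq]
  refine Eq.trans (lintegral_congr_ae ?_) h1.symm
  filter_upwards [W.ae_locallyFinite] with ω hω
  have hB' : MeasurableSet {ω' | ∃ b, Covers p i (W.centers ω) (W.positions ω')
      (fun b => W.h b ω') b} := (measurable_const.prodMk hU) hB
  by_cases h : W.centers ω ∈ s'
  · simp only [Set.indicator_of_mem h, mul_one]
    rw [Set.indicator_of_mem (by exact h), p.coverageProbLim_eq i hω,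
      ← W.measure_exists_covers i hω, ← lintegral_indicator_one hB']
    rfl
  · simp only [Set.indicator_of_notMem h, mul_zero, lintegral_zero]
    rw [Set.indicator_of_notMem (by exact h)]

/-- The conditional coverage probability, given the parent points. -/
theorem condExp_coverage [Finite K₁] [Finite K₂] [IsProbabilityMeasure μ] (i : K₁ ⊕ K₂) :
    ∀ᵐ ω ∂μ, p.coverageProb i (W.centers ω) ≤ 1 ∧
      (μ⟦W.coverage i | W.parentSigma⟧) ω = (p.coverageProb i (W.centers ω)).toReal := by
  have hle : ∀ᵐ ω ∂μ, p.coverageProb i (W.centers ω) ≤ 1 := by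
    filter_upwards [W.ae_locallyFinite] with ω hω
    rw [← W.measure_exists_covers i hω]
    exact prob_le_one
  have heq : ∀ᵐ ω ∂μ, p.coverageProbLim i (W.centers ω) = p.coverageProb i (W.centers ω) := by
    filter_upwards [W.ae_locallyFinite] with ω hω using p.coverageProbLim_eq i hω
  have hm := W.measurable_coverageProbLim i
  have hm' := hm.mono W.parentSigma_le le_rfl
  have hlt : ∀ᵐ ω ∂μ, p.coverageProbLim i (W.centers ω) < ∞ := by
    filter_upwards [hle, heq] with ω h1 h2
    exact h2 ▸ h1.trans_lt ENNReal.one_lt_top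
  have hcov := W.measurableSet_coverage i
  have hint : Integrable (fun ω => (p.coverageProbLim i (W.centers ω)).toReal) μ := by
    refine integrable_toReal_of_lintegral_ne_top hm'.aemeasurable ?_
    have := W.setLIntegral_coverageProb i (s := Set.univ) (@MeasurableSet.univ _ W.parentSigma)
    rw [Measure.restrict_univ] at this
    exact this ▸ measure_ne_top _ _
  have hcond := ae_eq_condExp_of_forall_setIntegral_eq W.parentSigma_le
    (f := (W.coverage i).indicator fun _ => (1 : ℝ)) ((integrable_const 1).indicator hcov)
    (g := fun ω => (p.coverageProbLim i (W.centers ω)).toReal)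
    (fun s _ _ => hint.integrableOn) (fun s hs _ => ?_)
    (measurable_toReal_of hm).stronglyMeasurable.aestronglyMeasurable
  · filter_upwards [hle, heq, hcond] with ω h1 h2 h3
    exact ⟨h1, by rw [← h2]; exact h3.symm⟩
  · rw [integral_toReal hm'.aemeasurable (ae_restrict_of_ae hlt), W.setLIntegral_coverageProb i hs,
      integral_indicator_const _ hcov]
    simp [Measure.real, Measure.restrict_apply hcov]

end Network

/-! ### Polar coordinates and the distance densities -/

/-- Polar coordinates for radial functions on the plane. -/
lemma lintegral_plane_norm {φ : ℝ → ℝ≥0∞} (hφ : Measurable φ) :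
    ∫⁻ x : Plane, φ ‖x‖ = ENNReal.ofReal (2 * Real.pi) *
      ∫⁻ r in Set.Ioi (0 : ℝ), ENNReal.ofReal r * φ r := by
  have hdim : Module.finrank ℝ Plane - 1 = 1 := by simp
  calc ∫⁻ x : Plane, φ ‖x‖
      = ∫⁻ x : ({(0 : Plane)}ᶜ : Set Plane), φ ‖x.1‖ ∂((volume : Measure Plane).comap (↑)) := by
        rw [lintegral_subtype_comap (measurableSet_singleton _).compl fun x : Plane => φ ‖x‖,
          restrict_compl_singleton]
    _ = ∫⁻ x, φ x.2 ∂(volume : Measure Plane).toSphere.prod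
          (.volumeIoiPow (Module.finrank ℝ Plane - 1)) := by
        have := Measure.measurePreserving_homeomorphUnitSphereProd (volume : Measure Plane)
          |>.lintegral_comp_emb (Homeomorph.measurableEmbedding _) (φ ∘ Subtype.val ∘ Prod.snd)
        simpa using this
    _ = (volume : Measure Plane).toSphere Set.univ *
          ∫⁻ x : Set.Ioi (0 : ℝ), φ x ∂.volumeIoiPow 1 := by
        rw [hdim, lintegral_prod _ (by fun_prop)]
        simp [mul_comm]
    _ = _ := by
        -- The total mass of the circle is the dimension times the area of the unit disc, that is,
        -- 2π.
        rw [Measure.toSphere_apply_univ, Measure.volumeIoiPow,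
          lintegral_withDensity_eq_lintegral_mul _ (by fun_prop) (by fun_prop)]
        simp only [Pi.mul_apply, pow_one]
        rw [lintegral_subtype_comap measurableSet_Ioi fun r => ENNReal.ofReal r * φ r,
          EuclideanSpace.volume_ball_fin_two, ENNReal.ofReal_mul two_pos.le]
        simp

/-- The law of the norm of an absolutely continuous random vector is absolutely continuous. -/
lemma absolutelyContinuous_map_norm : (volume : Measure Plane).map norm ≪ volume := by
  refine Measure.AbsolutelyContinuous.mk fun s hs h0 => ?_
  rw [Measure.map_apply measurable_norm hs, ← lintegral_indicator_one (measurable_norm hs)]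
  have h1 := lintegral_plane_norm (φ := s.indicator 1) (measurable_one.indicator hs)
  refine h1.trans ?_
  rw [mul_eq_zero]
  right
  refine lintegral_eq_zero_of_ae_eq_zero (ae_restrict_of_ae ?_)
  filter_upwards [measure_eq_zero_iff_ae_notMem.1 h0] with r hr
  simp [hr]

namespace Params

variable (p : Params K₁ K₂)

/-- The law of the distance from the origin to an offspring point of the cluster at `z`. -/
def distLaw (k : K₁) (z : Plane) : Measure ℝ := (p.offspring k).map fun s => ‖z + s‖

instance (k : K₁) (z : Plane) : IsProbabilityMeasure (p.distLaw k z) :=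
  Measure.isProbabilityMeasure_map (by fun_prop)

lemma fd_eq (k : K₁) (r : ℝ) (z : Plane) :
    p.fd k r z = ((p.distLaw k z).rnDeriv volume r).toReal := rfl

lemma fd_nonneg (k : K₁) (r : ℝ) (z : Plane) : 0 ≤ p.fd k r z := ENNReal.toReal_nonneg

lemma measurable_fd (k : K₁) (z : Plane) : Measurable fun r => p.fd k r z :=
  (Measure.measurable_rnDeriv _ _).ennreal_toReal

/-- Translation preserves Lebesgue measure, which reduces the claim to z = 0. It makes the
Radon–Nikodym derivative `fd` a genuine density. -/
lemma distLaw_absolutelyContinuous (k : K₁) (z : Plane) : p.distLaw k z ≪ volume := by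
  have h1 : p.distLaw k z ≪ (volume : Measure Plane).map fun s => ‖z + s‖ :=
    (withDensity_absolutelyContinuous _ _).map (by fun_prop)
  have h2 : (volume : Measure Plane).map (fun s => ‖z + s‖) =
      (volume : Measure Plane).map norm := by
    have h3 : Measurable fun s : Plane => z + s := by fun_prop
    rw [show (fun s : Plane => ‖z + s‖) = norm ∘ (fun s => z + s) from rfl,
      ← Measure.map_map measurable_norm h3, map_add_left_eq_self]
  exact (h2 ▸ h1).trans absolutelyContinuous_map_norm

lemma ofReal_fd_ae (k : K₁) (z : Plane) :
    ∀ᵐ r : ℝ, ENNReal.ofReal (p.fd k r z) = (p.distLaw k z).rnDeriv volume r := by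
  filter_upwards [(p.distLaw k z).rnDeriv_lt_top volume] with r hr
  rw [fd_eq, ENNReal.ofReal_toReal hr.ne]

lemma setLIntegral_distLaw (k : K₁) (z : Plane) {φ : ℝ → ℝ≥0∞} (hφ : Measurable φ) {s : Set ℝ}
    (hs : MeasurableSet s) :
    ∫⁻ r in s, φ r ∂(p.distLaw k z) = ∫⁻ r in s, ENNReal.ofReal (p.fd k r z) * φ r := by
  rw [← setLIntegral_rnDeriv_mul (p.distLaw_absolutelyContinuous k z) hφ.aemeasurable hs]
  refine lintegral_congr_ae (ae_restrict_of_ae ?_)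
  filter_upwards [p.ofReal_fd_ae k z] with r hr
  rw [hr]

lemma lintegral_distLaw (k : K₁) (z : Plane) {φ : ℝ → ℝ≥0∞} (hφ : Measurable φ) :
    ∫⁻ r, φ r ∂(p.distLaw k z) = ∫⁻ s, φ ‖z + s‖ ∂(p.offspring k) :=
  lintegral_map hφ (by fun_prop)

lemma lintegral_offspring_norm (k : K₁) (z : Plane) {φ : ℝ → ℝ≥0∞} (hφ : Measurable φ) :
    ∫⁻ s, φ ‖z + s‖ ∂(p.offspring k) =
      ∫⁻ r in Set.Ioi 0, ENNReal.ofReal (p.fd k r z) * φ r := by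
  rw [← p.setLIntegral_distLaw k z hφ measurableSet_Ioi, ← p.lintegral_distLaw k z hφ]
  congr 1
  refine (Measure.restrict_eq_self_of_ae_mem ?_).symm
  rw [distLaw]
  refine (ae_map_iff (by fun_prop) (measurableSet_Ioi (a := (0 : ℝ)))).2 ?_
  have := p.offspring_norm_eq k z 0
  filter_upwards [measure_eq_zero_iff_ae_notMem.1 this] with s hs
  exact lt_of_le_of_ne (norm_nonneg _) (Ne.symm hs)

/-- Almost everywhere, the sum of the densities of the distances is finite. -/
lemma ae_tsum_fd_ne_top {c : K₁ → ℕ → Plane} (hc : p.LocallyFinite c) (k : K₁) :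
    ∀ᵐ r : ℝ, ∑' n, ENNReal.ofReal (p.fd k r (c k n)) ≠ ∞ := by
  have hm : Measurable fun r => ∑' n, ENNReal.ofReal (p.fd k r (c k n)) :=
    Measurable.tsum fun n => (p.measurable_fd k _).ennreal_ofReal
  -- Integrated over (-∞, R], the sum of densities is the sum over the centres of the probabilities
  -- that an offspring point falls into the disc of radius R, finite by local finiteness.
  have h1 : ∀ R : ℕ, ∀ᵐ r : ℝ, r ∈ Set.Iic (R : ℝ) →
      ∑' n, ENNReal.ofReal (p.fd k r (c k n)) < ∞ := by
    intro R
    rw [← ae_restrict_iff' measurableSet_Iic]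
    refine ae_lt_top hm ?_
    rw [lintegral_tsum fun n => (p.measurable_fd k _).ennreal_ofReal.aemeasurable]
    convert hc k R using 3 with n
    have := p.setLIntegral_distLaw k (c k n) (φ := fun _ => 1) measurable_const
      (measurableSet_Iic (a := (R : ℝ)))
    simp only [mul_one, lintegral_const, one_mul, Measure.restrict_apply_univ] at this
    rw [← this, distLaw, Measure.map_apply (by fun_prop) measurableSet_Iic]
    rfl
  filter_upwards [ae_all_iff.2 h1] with r hr
  obtain ⟨R, hR⟩ := exists_nat_ge r
  exact (hr R hR).ne

lemma summable_fd {c : K₁ → ℕ → Plane} {k : K₁} {r : ℝ}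
    (h : ∑' n, ENNReal.ofReal (p.fd k r (c k n)) ≠ ∞) : Summable fun n => p.fd k r (c k n) := by
  have := ENNReal.summable_toReal h
  simpa [ENNReal.toReal_ofReal (p.fd_nonneg _ _ _)] using this

/-- The reason for the logarithm in `attenuation`: exponentiation recovers the Laplace transform of
the fading outside the exclusion disc, and 0 inside. -/
lemma expNeg_attenuation (i : K₁ ⊕ K₂) {r : ℝ} (hr : 0 < r) (x : (K₁ ⊕ K₂) × Plane) :
    expNeg (p.attenuation i r x) = (Set.Ici (p.Pbar x.1 i * r)).indicator (fun y =>
      ENNReal.ofReal (1 / (1 + p.τ i * ((p.Pbar x.1 i * r) ^ p.α / y ^ p.α)))) ‖x.2‖ := by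
  have h0 : 0 < p.Pbar x.1 i * r := mul_pos (p.Pbar_pos _ _) hr
  have hτ := p.τ_pos i
  unfold attenuation
  by_cases h : ‖x.2‖ < p.Pbar x.1 i * r
  · rw [if_pos h, expNeg_top, Set.indicator_of_notMem (by simpa using h)]
  · have h1 : 0 ≤ p.τ i * ((p.Pbar x.1 i * r) ^ p.α / ‖x.2‖ ^ p.α) := by positivity
    rw [if_neg h, Set.indicator_of_mem (by simpa using h),
      expNeg_ofReal (Real.log_nonneg (by linarith)), Real.exp_neg, Real.exp_log (by linarith),
      one_div]

/-- The exponent of `C`. -/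
def logC (j : K₁) (i : K₁ ⊕ K₂) (r : ℝ) (z : Plane) : ℝ≥0∞ :=
  p.mbar j * ∫⁻ s, (1 - expNeg (p.attenuation i r (.inl j, z + s))) ∂(p.offspring j)

/-- The offspring law is pushed forward to the distance, where `fd` is its density. The resulting
integral is at most 1, so the exponent is nonnegative and the extended exponential agrees with the
real one. -/
lemma expNeg_logC [Countable K₁] [Countable K₂] (j : K₁) (i : K₁ ⊕ K₂) {r : ℝ} (hr : 0 < r)
    (z : Plane) : (expNeg (p.logC j i r z)).toReal = p.C j i r z := by
  set a := p.Pbar (.inl j) i * r with ha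
  have ha0 : 0 < a := mul_pos (p.Pbar_pos _ _) hr
  have hτ := p.τ_pos i
  set e : ℝ → ℝ := fun y => 1 / (1 + p.τ i * (a ^ p.α / y ^ p.α)) with he
  have hem : Measurable e := by fun_prop
  have he0 : ∀ y ∈ Set.Ioi a, 0 ≤ e y := fun y hy => by
    have : 0 < y := ha0.trans hy
    positivity
  have h1 : ∀ s, expNeg (p.attenuation i r (.inl j, z + s)) =
      (Set.Ici a).indicator (fun y => ENNReal.ofReal (e y)) ‖z + s‖ := fun s =>
    p.expNeg_attenuation i hr _
  have hφ : Measurable ((Set.Ici a).indicator fun y => ENNReal.ofReal (e y)) :=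
    hem.ennreal_ofReal.indicator measurableSet_Ici
  have h2 : ∫⁻ s, expNeg (p.attenuation i r (.inl j, z + s)) ∂(p.offspring j) =
      ∫⁻ y in Set.Ioi a, ENNReal.ofReal (p.fd j y z / (1 + p.τ i * (a ^ p.α / y ^ p.α))) := by
    simp only [h1]
    rw [← p.lintegral_distLaw j z hφ, lintegral_indicator measurableSet_Ici,
      p.setLIntegral_distLaw j z hem.ennreal_ofReal measurableSet_Ici,
      setLIntegral_congr Ioi_ae_eq_Ici.symm]
    refine lintegral_congr fun y => ?_
    rw [← ENNReal.ofReal_mul (p.fd_nonneg _ _ _), he, mul_one_div]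
  have hle : ∫⁻ s, expNeg (p.attenuation i r (.inl j, z + s)) ∂(p.offspring j) ≤ 1 :=
    (lintegral_mono fun s => expNeg_le_one _).trans (by simp)
  have hne := (hle.trans_lt ENNReal.one_lt_top).ne
  have hnn : ∀ᵐ y ∂(volume.restrict (Set.Ioi a)),
      0 ≤ p.fd j y z / (1 + p.τ i * (a ^ p.α / y ^ p.α)) := by
    filter_upwards [ae_restrict_mem measurableSet_Ioi] with y hy
    rw [← mul_one_div]
    exact mul_nonneg (p.fd_nonneg _ _ _) (he0 y hy)
  have hmeas : Measurable fun y => p.fd j y z / (1 + p.τ i * (a ^ p.α / y ^ p.α)) :=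
    (p.measurable_fd j z).div (by fun_prop)
  have hint : IntegrableOn (fun y => p.fd j y z / (1 + p.τ i * (a ^ p.α / y ^ p.α)))
      (Set.Ioi a) := by
    refine ⟨hmeas.aestronglyMeasurable, ?_⟩
    rw [hasFiniteIntegral_iff_ofReal hnn, ← h2]
    exact hle.trans_lt ENNReal.one_lt_top
  have hX := ofReal_integral_eq_lintegral_ofReal hint hnn
  set X := ∫ y in Set.Ioi a, p.fd j y z / (1 + p.τ i * (a ^ p.α / y ^ p.α)) with hXdef
  have hX0 : 0 ≤ X := integral_nonneg_of_ae hnn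
  have hX1 : X ≤ 1 := by
    rw [← h2] at hX
    rw [← ENNReal.ofReal_le_one, hX]
    exact hle
  have hmatt : Measurable fun s : Plane => expNeg (p.attenuation i r (.inl j, z + s)) := by
    simp only [h1]
    exact hφ.comp (by fun_prop)
  have h3 : p.logC j i r z = ENNReal.ofReal (p.mbar j * (1 - X)) := by
    rw [logC, lintegral_sub hmatt hne (ae_of_all _ fun s => expNeg_le_one _), h2, ← hX,
      lintegral_const, measure_univ, mul_one, ENNReal.ofReal_mul (p.mbar j).coe_nonneg,
      ENNReal.ofReal_sub _ hX0, ENNReal.ofReal_one, ENNReal.ofReal_coe_nnreal]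
  rw [h3, expNeg_ofReal (mul_nonneg (p.mbar j).coe_nonneg (by linarith)),
    ENNReal.toReal_ofReal (Real.exp_pos _).le, C, ← neg_mul]

end Params

/-- No summability is needed: series in [0, ∞] converge unconditionally and `expNeg` is continuous
even at ∞. `HasProd` admits the limit 0. -/
lemma hasProd_expNeg {ι : Type*} (a : ι → ℝ≥0∞) :
    HasProd (fun n => (expNeg (a n)).toReal) (expNeg (∑' n, a n)).toReal := by
  have h1 : Tendsto (fun s : Finset ι => (expNeg (∑ n ∈ s, a n)).toReal) atTop
      (𝓝 (expNeg (∑' n, a n)).toReal) :=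
    (ENNReal.tendsto_toReal (expNeg_ne_top _)).comp
      ((continuous_expNeg.tendsto _).comp ENNReal.summable.hasSum)
  simp only [expNeg_sum, ENNReal.toReal_prod] at h1
  rw [HasProd]
  simpa using h1

lemma Params.hasProd_C [Countable K₁] [Countable K₂] (p : Params K₁ K₂) (j : K₁) (i : K₁ ⊕ K₂)
    {r : ℝ} (hr : 0 < r) (c : ℕ → Plane) : HasProd (fun n => p.C j i r (c n))
      (expNeg (∑' n, p.logC j i r (c n))).toReal := by
  simpa only [p.expNeg_logC j i hr] using hasProd_expNeg fun n => p.logC j i r (c n)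

/-! ### The interference of a Poisson tier and ρ -/

lemma integrableOn_one_div_one_add_rpow {a s : ℝ} (ha : 0 < a) (hs : 1 < s) :
    IntegrableOn (fun t : ℝ => 1 / (1 + t ^ s)) (Set.Ioi a) := by
  refine Integrable.mono' (integrableOn_Ioi_rpow_of_lt (neg_lt_neg hs) ha)
    (Measurable.aestronglyMeasurable (by fun_prop)) ?_
  filter_upwards [ae_restrict_mem measurableSet_Ioi] with t ht
  have ht0 : 0 < t := ha.trans ht
  have := Real.rpow_pos_of_pos ht0 s
  rw [Real.norm_of_nonneg (by positivity), Real.rpow_neg ht0.le, ← one_div]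
  gcongr
  linarith

lemma image_mul_sq_Ioi {a κ : ℝ} (ha : 0 < a) (hκ : 0 < κ) :
    (fun y : ℝ => κ * y ^ 2) '' Set.Ioi a = Set.Ioi (κ * a ^ 2) := by
  ext t
  simp only [Set.mem_image, Set.mem_Ioi]
  constructor
  · rintro ⟨y, hy, rfl⟩
    gcongr
  · intro ht
    have h1 : a ^ 2 < t / κ := by rw [lt_div_iff₀ hκ]; linarith
    refine ⟨√(t / κ), (Real.lt_sqrt ha.le).2 h1, ?_⟩
    rw [Real.sq_sqrt ((by positivity : 0 ≤ a ^ 2).trans h1.le)]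
    field_simp

/-- Substitute t = κ y² with κ = τ^{-2/α} / a². This sends a to τ^{-2/α} and makes t^{α/2} = y^α /
(τ a^α), so that 1 / (1 + t^{α/2}) is the integrand on the left. -/
lemma lintegral_Ioi_interference {a τ α : ℝ} (ha : 0 < a) (hτ : 0 < τ) (hα : 2 < α) :
    ∫⁻ y in Set.Ioi a, ENNReal.ofReal y * ENNReal.ofReal (1 - 1 / (1 + τ * (a ^ α / y ^ α))) =
      ENNReal.ofReal (a ^ 2 / 2 * (τ ^ (2 / α) *
        ∫ t in Set.Ioi (τ ^ (-(2 / α))), 1 / (1 + t ^ (α / 2)))) := by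
  have hα0 : 0 < α := by linarith
  set κ := τ ^ (-(2 / α)) / a ^ 2 with hκ
  have hτ' : 0 < τ ^ (-(2 / α)) := Real.rpow_pos_of_pos hτ _
  have hκ0 : 0 < κ := by positivity
  have hκa : κ * a ^ 2 = τ ^ (-(2 / α)) := by rw [hκ]; field_simp
  have hcv := lintegral_image_eq_lintegral_deriv_mul_of_monotoneOn
    (s := Set.Ioi a) (f := fun y : ℝ => κ * y ^ 2) (f' := fun y => κ * (2 * y)) measurableSet_Ioi
    (fun x _ => by simpa using ((hasDerivAt_pow 2 x).const_mul κ).hasDerivWithinAt)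
    (fun x hx y _ hxy => by
      have : 0 < x := ha.trans hx
      dsimp only
      gcongr) (fun t => ENNReal.ofReal (1 / (1 + t ^ (α / 2))))
  rw [image_mul_sq_Ioi ha hκ0, hκa] at hcv
  have hint : IntegrableOn (fun t : ℝ => 1 / (1 + t ^ (α / 2))) (Set.Ioi (τ ^ (-(2 / α)))) :=
    integrableOn_one_div_one_add_rpow hτ' (by linarith)
  have hnn : ∀ᵐ t ∂(volume.restrict (Set.Ioi (τ ^ (-(2 / α))))), 0 ≤ 1 / (1 + t ^ (α / 2)) := by
    filter_upwards [ae_restrict_mem measurableSet_Ioi] with t ht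
    have : 0 < t := hτ'.trans ht
    positivity
  rw [← ofReal_integral_eq_lintegral_ofReal hint hnn] at hcv
  have hpt : ∀ y ∈ Set.Ioi a, ENNReal.ofReal (κ * (2 * y)) *
      ENNReal.ofReal (1 / (1 + (κ * y ^ 2) ^ (α / 2))) = ENNReal.ofReal (2 * κ) *
        (ENNReal.ofReal y * ENNReal.ofReal (1 - 1 / (1 + τ * (a ^ α / y ^ α)))) := by
    intro y hy
    have hy0 : 0 < y := ha.trans hy
    have h1 : (κ * y ^ 2) ^ (α / 2) = τ⁻¹ * (y ^ α / a ^ α) := by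
      rw [hκ, div_mul_eq_mul_div, Real.div_rpow (by positivity) (by positivity),
        Real.mul_rpow hτ'.le (by positivity), ← Real.rpow_mul hτ.le, ← Real.rpow_natCast,
        ← Real.rpow_natCast, ← Real.rpow_mul hy0.le, ← Real.rpow_mul ha.le]
      have e1 : -(2 / α) * (α / 2) = -1 := by field_simp
      have e2 : ((2 : ℕ) : ℝ) * (α / 2) = α := by push_cast; field_simp
      rw [e1, e2, Real.rpow_neg_one, mul_div_assoc]
    have hya := Real.rpow_pos_of_pos hy0 α
    have haa := Real.rpow_pos_of_pos ha α
    have h2 : 1 / (1 + (κ * y ^ 2) ^ (α / 2)) = 1 - 1 / (1 + τ * (a ^ α / y ^ α)) := by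
      rw [h1]
      have : 0 < y ^ α + τ * a ^ α := by positivity
      have : 0 < τ * a ^ α + y ^ α := by positivity
      field_simp
      ring
    rw [h2, ← mul_assoc (ENNReal.ofReal (2 * κ)), ← ENNReal.ofReal_mul (by positivity : 0 ≤ 2 * κ),
      mul_assoc 2, mul_left_comm 2]
  rw [setLIntegral_congr_fun measurableSet_Ioi hpt,
    lintegral_const_mul _ (by fun_prop)] at hcv
  have h2κ : 0 < 2 * κ := by positivity
  rw [← ENNReal.mul_right_inj (a := ENNReal.ofReal (2 * κ)) (by simpa using h2κ)
    ENNReal.ofReal_ne_top, ← hcv, ← ENNReal.ofReal_mul h2κ.le]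
  congr 1
  have h3 : 2 * κ * (a ^ 2 / 2 * τ ^ (2 / α)) = 1 := by
    rw [hκ, Real.rpow_neg hτ.le]
    have := Real.rpow_pos_of_pos hτ (2 / α)
    field_simp
  rw [← mul_assoc (a ^ 2 / 2), ← mul_assoc (2 * κ), h3, one_mul]

lemma lintegral_Ioc_ofReal {a : ℝ} (ha : 0 < a) :
    ∫⁻ y in Set.Ioc 0 a, ENNReal.ofReal y = ENNReal.ofReal (a ^ 2 / 2) := by
  rw [← ofReal_integral_eq_lintegral_ofReal (f := fun y : ℝ => y)
    (continuous_id.integrableOn_Icc.mono_set Set.Ioc_subset_Icc_self)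
    (by filter_upwards [ae_restrict_mem measurableSet_Ioc] with y hy using hy.1.le),
    ← intervalIntegral.integral_of_le ha.le]
  simp

lemma rho_sub_one_nonneg {τ α : ℝ} (hτ : 0 < τ) : 0 ≤ τ ^ (2 / α) *
    ∫ t in Set.Ioi (τ ^ (-(2 / α))), 1 / (1 + t ^ (α / 2)) := by
  refine mul_nonneg (Real.rpow_pos_of_pos hτ _).le
    (setIntegral_nonneg measurableSet_Ioi fun t ht => ?_)
  have : 0 < t := (Real.rpow_pos_of_pos hτ _).trans ht
  positivity

/-- In polar coordinates, the exclusion disc of radius a contributes a²/2, the summand 1 of `rho`,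
and the exterior contributes the integral term. -/
lemma Params.lintegral_attenuation_inr (p : Params K₁ K₂) (k : K₂) (i : K₁ ⊕ K₂) {r : ℝ}
    (hr : 0 < r) : ∫⁻ y : Plane, (1 - expNeg (p.attenuation i r (.inr k, y))) =
      ENNReal.ofReal (Real.pi * r ^ 2 * p.Pbar (.inr k) i ^ 2 * rho (p.τ i) p.α) := by
  set a := p.Pbar (.inr k) i * r with hadef
  have ha : 0 < a := mul_pos (p.Pbar_pos _ _) hr
  have hτ := p.τ_pos i
  have h1 : ∀ y : Plane, expNeg (p.attenuation i r (.inr k, y)) =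
      (Set.Ici a).indicator (fun y => ENNReal.ofReal (1 / (1 + p.τ i * (a ^ p.α / y ^ p.α)))) ‖y‖ :=
    fun y => p.expNeg_attenuation i hr _
  simp only [h1]
  have hm : Measurable ((Set.Ici a).indicator
      fun y : ℝ => ENNReal.ofReal (1 / (1 + p.τ i * (a ^ p.α / y ^ p.α)))) :=
    Measurable.indicator (by fun_prop) measurableSet_Ici
  rw [lintegral_plane_norm (φ := fun x => 1 - (Set.Ici a).indicator
      (fun y : ℝ => ENNReal.ofReal (1 / (1 + p.τ i * (a ^ p.α / y ^ p.α)))) x)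
      (measurable_const.sub hm),
    ← Set.Ioc_union_Ioi_eq_Ioi ha.le, lintegral_union measurableSet_Ioi
      (Set.disjoint_left.2 fun x hx hx' => hx.2.not_gt hx')]
  have h2 : ∫⁻ y in Set.Ioc 0 a, ENNReal.ofReal y * (1 - (Set.Ici a).indicator
      (fun y : ℝ => ENNReal.ofReal (1 / (1 + p.τ i * (a ^ p.α / y ^ p.α)))) y) =
      ENNReal.ofReal (a ^ 2 / 2) := by
    rw [← lintegral_Ioc_ofReal ha, setLIntegral_congr Ioo_ae_eq_Ioc.symm,
      setLIntegral_congr (f := fun y => ENNReal.ofReal y) Ioo_ae_eq_Ioc.symm]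
    refine setLIntegral_congr_fun measurableSet_Ioo fun y hy => ?_
    rw [Set.indicator_of_notMem (by simpa using hy.2), tsub_zero, mul_one]
  have h3 : ∫⁻ y in Set.Ioi a, ENNReal.ofReal y * (1 - (Set.Ici a).indicator
      (fun y : ℝ => ENNReal.ofReal (1 / (1 + p.τ i * (a ^ p.α / y ^ p.α)))) y) =
      ENNReal.ofReal (a ^ 2 / 2 * (p.τ i ^ (2 / p.α) *
        ∫ t in Set.Ioi (p.τ i ^ (-(2 / p.α))), 1 / (1 + t ^ (p.α / 2)))) := by
    rw [← lintegral_Ioi_interference ha hτ p.two_lt_α]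
    refine setLIntegral_congr_fun measurableSet_Ioi fun y hy => ?_
    have hy0 : 0 < y := ha.trans hy
    rw [Set.indicator_of_mem (Set.mem_Ici.2 (Set.mem_Ioi.1 hy).le),
      ENNReal.ofReal_sub _ (by positivity), ENNReal.ofReal_one]
  have hρ := rho_sub_one_nonneg (α := p.α) hτ
  rw [h2, h3, ← ENNReal.ofReal_add (by positivity) (by positivity),
    ← ENNReal.ofReal_mul (by positivity)]
  congr 1
  rw [hadef, rho]
  ring

/-! ### The coverage probability as an integral over the serving distance -/

namespace Params

variable (p : Params K₁ K₂)

/-- The probability that no other base station prevents coverage by a base station of tier `i` at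
distance `r`, given that it overcomes the noise. -/
def interferenceFactor (i : K₁ ⊕ K₂) (c : K₁ → ℕ → Plane) (r : ℝ) : ℝ≥0∞ :=
  expNeg (∫⁻ y, (1 - expNeg (p.attenuation i r y)) ∂(p.intensity c))

lemma measurable_interferenceFactor [Countable K₁] [Countable K₂] (i : K₁ ⊕ K₂)
    (c : K₁ → ℕ → Plane) : Measurable (p.interferenceFactor i c) := by
  have h1 : Measurable fun z : ℝ × ((K₁ ⊕ K₂) × Plane) => 1 - expNeg (p.attenuation i z.1 z.2) :=
    measurable_const.sub (measurable_expNeg.comp (p.measurable_attenuation i))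
  have h2 := Measurable.lintegral_prod_right' (ν := p.intensity c) h1
  exact measurable_expNeg.comp h2

/-- The intensity is a sum over clusters and Poisson tiers, and `expNeg` turns the sum in the
exponent into a product. -/
lemma toReal_interferenceFactor [Fintype K₁] [Fintype K₂] (i : K₁ ⊕ K₂) (c : K₁ → ℕ → Plane)
    {r : ℝ} (hr : 0 < r) : (p.interferenceFactor i c r).toReal =
      (∏ j : K₁, ∏' n, p.C j i r (c j n)) *
        ∏ k : K₂, Real.exp (-(Real.pi * r ^ 2 * p.lam k * p.Pbar (.inr k) i ^ 2 *
          rho (p.τ i) p.α)) := by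
  have hm : Measurable fun y : (K₁ ⊕ K₂) × Plane => 1 - expNeg (p.attenuation i r y) :=
    measurable_const.sub (measurable_expNeg.comp (p.measurable_attenuation i).of_uncurry_left)
  rw [interferenceFactor, p.lintegral_intensity c hm,
    ENNReal.summable.tsum_prod' fun _ => ENNReal.summable, tsum_fintype, tsum_fintype, expNeg_add,
    expNeg_sum, expNeg_sum, ENNReal.toReal_mul, ENNReal.toReal_prod, ENNReal.toReal_prod]
  congr 1
  · exact Finset.prod_congr rfl fun j _ => (p.hasProd_C j i hr (c j)).tprod_eq.symm
  · refine Finset.prod_congr rfl fun k _ => ?_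
    have hρ := rho_sub_one_nonneg (α := p.α) (p.τ_pos i)
    have hρ' : 0 ≤ rho (p.τ i) p.α := by rw [rho]; linarith
    rw [p.lintegral_attenuation_inr k i hr, ← ENNReal.ofReal_coe_nnreal,
      ← ENNReal.ofReal_mul (by positivity), expNeg_ofReal (by positivity),
      ENNReal.toReal_ofReal (Real.exp_pos _).le]
    congr 2
    ring

/-- The noise weight removes all tiers but `i`. What remains depends on the offspring points only
through their distance, whose density is `fd`. -/
lemma coverageProb_inl [Countable K₁] [Countable K₂] (i : K₁) (c : K₁ → ℕ → Plane) :
    p.coverageProb (.inl i) c = p.mbar i * ∫⁻ r in Set.Ioi 0,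
      ENNReal.ofReal (Real.exp (-(p.τ (.inl i) * p.N₀ * r ^ p.α / p.P (.inl i)))) *
        p.interferenceFactor (.inl i) c r * ∑' n, ENNReal.ofReal (p.fd i r (c i n)) := by
  classical
  have hG := p.measurable_interferenceFactor (.inl i) c
  have hφ : Measurable fun x : (K₁ ⊕ K₂) × Plane =>
      p.noiseWeight (.inl i) x * p.interferenceFactor (.inl i) c ‖x.2‖ :=
    (p.measurable_noiseWeight _).mul (hG.comp (by fun_prop))
  let φ : ℝ → ℝ≥0∞ := fun r => ENNReal.ofReal (Real.exp (-(p.τ (.inl i) * p.N₀ * r ^ p.α /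
    p.P (.inl i)))) * p.interferenceFactor (.inl i) c r
  have hφm : Measurable φ := Measurable.mul (by fun_prop) hG
  have h1 : p.coverageProb (.inl i) c = ∫⁻ x, p.noiseWeight (.inl i) x *
      p.interferenceFactor (.inl i) c ‖x.2‖ ∂(p.intensity c) := rfl
  rw [h1, p.lintegral_intensity c hφ, ENNReal.summable.tsum_prod' fun _ => ENNReal.summable,
    tsum_eq_single i]
  · have h2 : ∀ k : K₂, p.lam k * ∫⁻ y : Plane, p.noiseWeight (.inl i) (.inr k, y) *
        p.interferenceFactor (.inl i) c ‖y‖ = 0 := by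
      intro k
      simp [noiseWeight]
    simp only [h2, tsum_zero, add_zero]
    rw [ENNReal.tsum_mul_left]
    congr 1
    have h3 : ∀ n, ∫⁻ s, p.noiseWeight (.inl i) (.inl i, c i n + s) *
        p.interferenceFactor (.inl i) c ‖c i n + s‖ ∂(p.offspring i) =
        ∫⁻ r in Set.Ioi 0, ENNReal.ofReal (p.fd i r (c i n)) * φ r := by
      intro n
      rw [← p.lintegral_offspring_norm i (c i n) hφm]
      simp [noiseWeight, φ]
    simp only [h3]
    have h4 : ∀ n, Measurable fun r => ENNReal.ofReal (p.fd i r (c i n)) * φ r :=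
      fun n => (p.measurable_fd i _).ennreal_ofReal.mul hφm
    rw [← lintegral_tsum fun n => (h4 n).aemeasurable]
    refine lintegral_congr fun r => ?_
    rw [ENNReal.tsum_mul_right, mul_comm]
  · intro k hk
    simp [noiseWeight, hk]

lemma coverageProb_inr [Countable K₁] [Countable K₂] (i : K₂) (c : K₁ → ℕ → Plane) :
    p.coverageProb (.inr i) c = ENNReal.ofReal (2 * Real.pi * p.lam i) * ∫⁻ r in Set.Ioi 0,
      ENNReal.ofReal (Real.exp (-(p.τ (.inr i) * p.N₀ * r ^ p.α / p.P (.inr i)))) *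
        p.interferenceFactor (.inr i) c r * ENNReal.ofReal r := by
  classical
  have hG := p.measurable_interferenceFactor (.inr i) c
  have hφ : Measurable fun x : (K₁ ⊕ K₂) × Plane =>
      p.noiseWeight (.inr i) x * p.interferenceFactor (.inr i) c ‖x.2‖ :=
    (p.measurable_noiseWeight _).mul (hG.comp (by fun_prop))
  let φ : ℝ → ℝ≥0∞ := fun r => ENNReal.ofReal (Real.exp (-(p.τ (.inr i) * p.N₀ * r ^ p.α /
    p.P (.inr i)))) * p.interferenceFactor (.inr i) c r
  have hφm : Measurable φ := Measurable.mul (by fun_prop) hG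
  have h1 : p.coverageProb (.inr i) c = ∫⁻ x, p.noiseWeight (.inr i) x *
      p.interferenceFactor (.inr i) c ‖x.2‖ ∂(p.intensity c) := rfl
  have h2 : ∀ q : K₁ × ℕ, p.mbar q.1 * ∫⁻ s, p.noiseWeight (.inr i) (.inl q.1, c q.1 q.2 + s) *
      p.interferenceFactor (.inr i) c ‖c q.1 q.2 + s‖ ∂(p.offspring q.1) = 0 := by
    intro q
    simp [noiseWeight]
  rw [h1, p.lintegral_intensity c hφ]
  simp only [h2, tsum_zero, zero_add]
  rw [tsum_eq_single i]
  · have h3 : ∫⁻ y : Plane, p.noiseWeight (.inr i) (.inr i, y) *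
        p.interferenceFactor (.inr i) c ‖y‖ = ∫⁻ y : Plane, φ ‖y‖ := by
      simp [noiseWeight, φ]
    rw [h3, lintegral_plane_norm hφm, ← mul_assoc, ENNReal.ofReal_mul (q := (p.lam i : ℝ))
      (by positivity), ENNReal.ofReal_coe_nnreal, mul_comm (p.lam i : ℝ≥0∞)]
    congr 1
    exact lintegral_congr fun r => mul_comm _ _
  · intro k hk
    simp [noiseWeight, hk]

/-- The coverage probability of a cluster tier as an integral over the serving distance. -/
theorem integrableOn_and_coverageProb_inl [Fintype K₁] [DecidableEq K₁] [Fintype K₂] (i : K₁)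
    {c : K₁ → ℕ → Plane} (hle : p.coverageProb (.inl i) c ≤ 1) :
    let integrand : ℝ → ℝ := fun r =>
      Real.exp (-(p.τ (.inl i) * p.N₀ * r ^ p.α / p.P (.inl i))) *
        (∏ j₁ ∈ Finset.univ.erase i, ∏' n, p.C j₁ (.inl i) r (c j₁ n)) *
        (∏ j₂ : K₂, Real.exp (-(Real.pi * r ^ 2 * p.lam j₂ *
          p.Pbar (.inr j₂) (.inl i) ^ 2 * rho (p.τ (.inl i)) p.α))) *
        ((∑' n, p.fd i r (c i n)) * ∏' n, p.C i (.inl i) r (c i n))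
    IntegrableOn integrand (Set.Ioi 0) ∧
      (p.coverageProb (.inl i) c).toReal = p.mbar i * ∫ r in Set.Ioi (0 : ℝ), integrand r := by
  intro integrand
  let F : ℝ → ℝ≥0∞ := fun r =>
    ENNReal.ofReal (Real.exp (-(p.τ (.inl i) * p.N₀ * r ^ p.α / p.P (.inl i)))) *
      p.interferenceFactor (.inl i) c r * ∑' n, ENNReal.ofReal (p.fd i r (c i n))
  have hG := p.measurable_interferenceFactor (.inl i) c
  have hF : Measurable F := Measurable.mul (Measurable.mul (by fun_prop) hG)
    (Measurable.tsum fun n => (p.measurable_fd i _).ennreal_ofReal)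
  have hcov : p.coverageProb (.inl i) c = p.mbar i * ∫⁻ r in Set.Ioi 0, F r :=
    p.coverageProb_inl i c
  -- Integrability comes for free: a positive multiple of the integral is at most 1.
  have hfin : ∫⁻ r in Set.Ioi 0, F r ≠ ∞ := by
    intro h
    rw [hcov, h, ENNReal.mul_top (by simpa using (p.mbar_pos i).ne')] at hle
    simp at hle
  have hae : ∀ᵐ r ∂(volume.restrict (Set.Ioi (0 : ℝ))), (F r).toReal = integrand r := by
    filter_upwards [ae_restrict_mem measurableSet_Ioi] with r hr
    -- Where the sum of densities is infinite both sides are 0: `toReal` sends ∞ to 0, and so does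
    -- the real `tsum` of a divergent series.
    simp only [F, integrand, ENNReal.toReal_mul, ENNReal.toReal_ofReal (Real.exp_pos _).le,
      p.toReal_interferenceFactor (.inl i) c hr,
      ENNReal.tsum_toReal_eq fun n => ENNReal.ofReal_ne_top,
      ENNReal.toReal_ofReal (p.fd_nonneg _ _ _)]
    rw [← Finset.prod_erase_mul _ _ (Finset.mem_univ i)]
    ring
  refine ⟨(integrable_toReal_of_lintegral_ne_top hF.aemeasurable hfin).congr hae, ?_⟩
  rw [hcov, ENNReal.toReal_mul, ← integral_congr_ae hae,
    integral_toReal hF.aemeasurable (ae_lt_top hF hfin)]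
  rfl

/-- The coverage probability of a Poisson tier as an integral over the serving distance. -/
theorem integrableOn_and_coverageProb_inr [Fintype K₁] [Fintype K₂] (i : K₂)
    {c : K₁ → ℕ → Plane} (hle : p.coverageProb (.inr i) c ≤ 1) :
    let integrand : ℝ → ℝ := fun r =>
      Real.exp (-(p.τ (.inr i) * p.N₀ * r ^ p.α / p.P (.inr i))) *
        (∏ j₁ : K₁, ∏' n, p.C j₁ (.inr i) r (c j₁ n)) *
        (∏ j₂ : K₂, Real.exp (-(Real.pi * r ^ 2 * p.lam j₂ *
          p.Pbar (.inr j₂) (.inr i) ^ 2 * rho (p.τ (.inr i)) p.α))) * r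
    IntegrableOn integrand (Set.Ioi 0) ∧ (p.coverageProb (.inr i) c).toReal =
      2 * Real.pi * p.lam i * ∫ r in Set.Ioi (0 : ℝ), integrand r := by
  intro integrand
  let F : ℝ → ℝ≥0∞ := fun r =>
    ENNReal.ofReal (Real.exp (-(p.τ (.inr i) * p.N₀ * r ^ p.α / p.P (.inr i)))) *
      p.interferenceFactor (.inr i) c r * ENNReal.ofReal r
  have hG := p.measurable_interferenceFactor (.inr i) c
  have hF : Measurable F := Measurable.mul (Measurable.mul (by fun_prop) hG) (by fun_prop)
  have hcov : p.coverageProb (.inr i) c =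
      ENNReal.ofReal (2 * Real.pi * p.lam i) * ∫⁻ r in Set.Ioi 0, F r := p.coverageProb_inr i c
  have hpos : 0 < 2 * Real.pi * p.lam i :=
    mul_pos Real.two_pi_pos (NNReal.coe_pos.2 (p.lam_pos i))
  have hfin : ∫⁻ r in Set.Ioi 0, F r ≠ ∞ := by
    intro h
    rw [hcov, h, ENNReal.mul_top (by simpa using hpos)] at hle
    simp at hle
  have hae : ∀ᵐ r ∂(volume.restrict (Set.Ioi (0 : ℝ))), (F r).toReal = integrand r := by
    filter_upwards [ae_restrict_mem measurableSet_Ioi] with r hr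
    simp only [F, integrand, ENNReal.toReal_mul, ENNReal.toReal_ofReal (Real.exp_pos _).le,
      p.toReal_interferenceFactor (.inr i) c hr, ENNReal.toReal_ofReal (Set.mem_Ioi.1 hr).le,
      mul_assoc]
  refine ⟨(integrable_toReal_of_lintegral_ne_top hF.aemeasurable hfin).congr hae, ?_⟩
  rw [hcov, ENNReal.toReal_mul, ← integral_congr_ae hae,
    integral_toReal hF.aemeasurable (ae_lt_top hF hfin), ENNReal.toReal_ofReal hpos.le]

end Params

/-! ### The hypergeometric form of ρ -/

/-- Euler's integral for `₂F₁[1, b; b + 1; x]`. -/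
def eulerIntegral (b x : ℝ) : ℝ := b * ∫ t in Set.Ioo (0 : ℝ) 1, t ^ (b - 1) / (1 - x * t)

/-- The Taylor coefficients of `eulerIntegral b` at `x`. -/
def eulerCoeff (b x : ℝ) (n : ℕ) : ℝ :=
  b * ∫ t in Set.Ioo (0 : ℝ) 1, t ^ (b - 1) * (t ^ n / (1 - x * t) ^ (n + 1))

lemma integrableOn_rpow_sub_one {b : ℝ} (hb : 0 < b) :
    IntegrableOn (fun t : ℝ => t ^ (b - 1)) (Set.Ioo 0 1) := by
  have := intervalIntegral.intervalIntegrable_rpow' (a := 0) (b := 1) (r := b - 1) (by linarith)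
  rw [intervalIntegrable_iff_integrableOn_Ioo_of_le zero_le_one] at this
  exact this

/-- Expand 1 / (1 - (x + h) t) = ∑ h^n t^n / (1 - x t)^{n+1} and integrate term by term. As t / (1 -
x t) ≤ 1 / (1 - x) on (0, 1), the series is dominated by a geometric one of ratio |h| / (1 - x). -/
lemma hasSum_eulerIntegral {b x h : ℝ} (hb : 0 < b) (hx : x < 1) (hh : |h| < 1 - x) :
    HasSum (fun n => h ^ n * eulerCoeff b x n) (eulerIntegral b (x + h)) := by
  have hx1 : 0 < 1 - x := by linarith
  set q := |h| / (1 - x) with hq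
  have hq0 : 0 ≤ q := by positivity
  have hq1 : q < 1 := (div_lt_one hx1).2 hh
  -- A lower bound for 1 - x t on (0, 1), whatever the sign of `x`.
  set m := min 1 (1 - x) with hm
  have hm0 : 0 < m := lt_min one_pos hx1
  have hden : ∀ t ∈ Set.Ioo (0 : ℝ) 1, m ≤ 1 - x * t := by
    intro t ht
    rcases le_total 0 x with h0 | h0
    · exact (min_le_right _ _).trans (by nlinarith [ht.1, ht.2])
    · exact (min_le_left _ _).trans (by nlinarith [ht.1, ht.2])
  have hratio : ∀ t ∈ Set.Ioo (0 : ℝ) 1, t / (1 - x * t) ≤ 1 / (1 - x) := by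
    intro t ht
    have := hm0.trans_le (hden t ht)
    rw [div_le_div_iff₀ this hx1]
    nlinarith [ht.1, ht.2]
  have key := hasSum_integral_of_dominated_convergence
    (μ := volume.restrict (Set.Ioo (0 : ℝ) 1))
    (F := fun n t => h ^ n * (t ^ (b - 1) * (t ^ n / (1 - x * t) ^ (n + 1))))
    (f := fun t => t ^ (b - 1) / (1 - (x + h) * t))
    (fun n t => q ^ n * (t ^ (b - 1) * (1 / m)))
    (fun n => Measurable.aestronglyMeasurable (by fun_prop)) ?_ ?_ ?_ ?_
  · have h1 := key.mul_left b
    simp only [integral_const_mul] at h1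
    simpa only [eulerCoeff, eulerIntegral, mul_left_comm b] using h1
  · intro n
    filter_upwards [ae_restrict_mem measurableSet_Ioo] with t ht
    have hd := hm0.trans_le (hden t ht)
    have ht0 := ht.1
    have h1 : h ^ n * (t ^ (b - 1) * (t ^ n / (1 - x * t) ^ (n + 1))) =
        (h * (t / (1 - x * t))) ^ n * (t ^ (b - 1) * (1 / (1 - x * t))) := by
      rw [pow_succ, mul_pow, div_pow]
      field_simp
    rw [h1, norm_mul, norm_pow, Real.norm_eq_abs, Real.norm_of_nonneg (by positivity), abs_mul,
      abs_of_nonneg (by positivity : 0 ≤ t / (1 - x * t))]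
    have h2 : |h| * (t / (1 - x * t)) ≤ q := by
      rw [hq, ← mul_one_div |h|]
      exact mul_le_mul_of_nonneg_left (hratio t ht) (abs_nonneg _)
    gcongr
    exact hden t ht
  · exact ae_of_all _ fun t => (summable_geometric_of_lt_one hq0 hq1).mul_right _
  · simp only [tsum_mul_right]
    exact ((integrableOn_rpow_sub_one hb).mul_const _).const_mul _
  · filter_upwards [ae_restrict_mem measurableSet_Ioo] with t ht
    have hd := hm0.trans_le (hden t ht)
    have ht0 := ht.1
    have h2 : |h * (t / (1 - x * t))| < 1 := by
      rw [abs_mul, abs_of_nonneg (by positivity : 0 ≤ t / (1 - x * t))]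
      refine lt_of_le_of_lt ?_ hq1
      rw [hq, ← mul_one_div |h|]
      exact mul_le_mul_of_nonneg_left (hratio t ht) (abs_nonneg _)
    have h3 := (hasSum_geometric_of_abs_lt_one h2).mul_right (t ^ (b - 1) * (1 / (1 - x * t)))
    have h4 : (1 - h * (t / (1 - x * t))) * (1 - x * t) = 1 - (x + h) * t := by
      rw [sub_mul, mul_assoc, div_mul_cancel₀ _ hd.ne']
      ring
    have h5 : ∀ n : ℕ, h ^ n * (t ^ (b - 1) * (t ^ n / (1 - x * t) ^ (n + 1))) =
        (h * (t / (1 - x * t))) ^ n * (t ^ (b - 1) * (1 / (1 - x * t))) := by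
      intro n
      rw [pow_succ, mul_pow, div_pow]
      field_simp
    rw [show (fun n : ℕ => _) = _ from funext h5, ← h4, mul_comm _ (1 - x * t), ← div_div,
      div_eq_inv_mul _ (1 - h * (t / (1 - x * t))), ← mul_one_div (t ^ (b - 1))]
    exact h3

/-- The expansion is available around every x < 1, with radius at least 1 - x. -/
lemma analyticOnNhd_eulerIntegral {b : ℝ} (hb : 0 < b) :
    AnalyticOnNhd ℝ (eulerIntegral b) (Set.Iio 1) := by
  intro x hx
  have hx' : 0 < 1 - x := sub_pos.2 hx
  refine ⟨FormalMultilinearSeries.ofScalars ℝ (eulerCoeff b x), hasFPowerSeriesAt_iff.2 ?_⟩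
  filter_upwards [Metric.ball_mem_nhds (0 : ℝ) hx'] with h hh
  simpa [FormalMultilinearSeries.coeff_ofScalars] using
    hasSum_eulerIntegral hb hx (by simpa using hh)

lemma eulerCoeff_zero {b : ℝ} (hb : 0 < b) (n : ℕ) : eulerCoeff b 0 n = b / (b + n) := by
  have h1 : ∫ t in Set.Ioo (0 : ℝ) 1, t ^ (b - 1) * (t ^ n / (1 - 0 * t) ^ (n + 1)) =
      ∫ t in (0 : ℝ)..1, t ^ (b - 1 + n) := by
    rw [intervalIntegral.integral_of_le zero_le_one, integral_Ioc_eq_integral_Ioo]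
    refine setIntegral_congr_fun measurableSet_Ioo fun t ht => ?_
    simp [Real.rpow_add_natCast ht.1.ne']
  have hn : (0 : ℝ) ≤ n := n.cast_nonneg
  rw [eulerCoeff, h1, integral_rpow (Or.inl (by linarith))]
  have h2 : b - 1 + n + 1 = b + n := by ring
  rw [h2, Real.one_rpow, Real.zero_rpow (by positivity), sub_zero, mul_one_div]

lemma ascPochhammer_eval_one_eq (n : ℕ) : (ascPochhammer ℝ n).eval 1 = n.factorial := by
  induction n with
  | zero => simp
  | succ n ih => rw [ascPochhammer_succ_eval, ih, Nat.factorial_succ]; push_cast; ring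

/-- Both sides are b (b + 1) ⋯ (b + n). -/
lemma ascPochhammer_eval_add_one (b : ℝ) (n : ℕ) :
    (ascPochhammer ℝ n).eval b * (b + n) = b * (ascPochhammer ℝ n).eval (b + 1) := by
  induction n with
  | zero => simp
  | succ n ih =>
    rw [ascPochhammer_succ_eval, ih, ascPochhammer_succ_eval]
    push_cast
    ring

/-- The Taylor coefficients at 0 are b / (b + n) = (b)_n / (b + 1)_n, and (1)_n = n! cancels the
factorial of the hypergeometric series. -/
lemma isGaussHypergeometric_eulerIntegral {b : ℝ} (hb : 0 < b) :
    IsGaussHypergeometric 1 b (b + 1) (eulerIntegral b) := by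
  refine ⟨analyticOnNhd_eulerIntegral hb, fun x hx => ?_⟩
  have h1 := hasSum_eulerIntegral (x := 0) (h := x) hb one_pos (by
    rw [sub_zero, abs_lt]; exact hx)
  rw [zero_add] at h1
  rw [ordinaryHypergeometric_eq_tsum, ← h1.tsum_eq]
  refine tsum_congr fun n => ?_
  have hn : (0 : ℝ) ≤ n := n.cast_nonneg
  have h2 := ascPochhammer_eval_add_one b n
  have h3 : 0 < (ascPochhammer ℝ n).eval (b + 1) := ascPochhammer_pos n _ (by linarith)
  have h4 : (n.factorial : ℝ) ≠ 0 := by exact_mod_cast n.factorial_ne_zero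
  have h5 : b / (b + n) = (ascPochhammer ℝ n).eval b * ((ascPochhammer ℝ n).eval (b + 1))⁻¹ := by
    rw [← div_eq_mul_inv, div_eq_div_iff (by positivity) h3.ne', h2]
  rw [eulerCoeff_zero hb, ascPochhammer_eval_one_eq, h5, smul_eq_mul]
  field_simp

lemma image_rpow_Ioo {τ s : ℝ} (hτ : 0 < τ) (hs : 0 < s) :
    (fun t : ℝ => (τ * t) ^ (-s)) '' Set.Ioo 0 1 = Set.Ioi (τ ^ (-s)) := by
  ext y
  simp only [Set.mem_image, Set.mem_Ioi]
  constructor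
  · rintro ⟨t, ht, rfl⟩
    have h0 : 0 < τ * t := mul_pos hτ ht.1
    exact Real.rpow_lt_rpow_of_neg h0 (by nlinarith [ht.2]) (neg_lt_zero.2 hs)
  · intro hy
    have hy0 : 0 < y := (Real.rpow_pos_of_pos hτ _).trans hy
    have h1 : 0 < y ^ (-s⁻¹) := Real.rpow_pos_of_pos hy0 _
    have h2 : y ^ (-s⁻¹) < τ := by
      have := Real.rpow_lt_rpow_of_neg (Real.rpow_pos_of_pos hτ _) hy
        (neg_lt_zero.2 (inv_pos.2 hs))
      rwa [← Real.rpow_mul hτ.le, neg_mul_neg, mul_inv_cancel₀ hs.ne', Real.rpow_one] at this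
    refine ⟨y ^ (-s⁻¹) / τ, ⟨by positivity, (div_lt_one hτ).2 h2⟩, ?_⟩
    rw [mul_div_cancel₀ _ hτ.ne', ← Real.rpow_mul hy0.le, neg_mul_neg, inv_mul_cancel₀ hs.ne',
      Real.rpow_one]

/-- Substitute u = (τ t)^{-2/α}, which maps (0, 1) onto (τ^{-2/α}, ∞) and turns 1 / (1 + u^{α/2})
into τ t / (1 + τ t). The constants agree because 2τ / (α - 2) · (1 - 2/α) = 2τ / α. -/
theorem rho_eq_eulerIntegral {τ α : ℝ} (hτ : 0 < τ) (hα : 2 < α) :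
    rho τ α = 1 + 2 * τ / (α - 2) * eulerIntegral (1 - 2 / α) (-τ) := by
  have hα0 : 0 < α := by linarith
  set s := 2 / α with hs
  have hs0 : 0 < s := by positivity
  have hcv := integral_image_eq_integral_abs_deriv_smul (s := Set.Ioo (0 : ℝ) 1)
    (f := fun t : ℝ => (τ * t) ^ (-s)) (f' := fun t => τ * (-s) * (τ * t) ^ (-s - 1))
    measurableSet_Ioo (fun t ht => by
      have h0 : 0 < τ * t := mul_pos hτ ht.1
      have h1 : HasDerivAt (fun t : ℝ => τ * t) τ t := by
        simpa using (hasDerivAt_id t).const_mul τ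
      exact (h1.rpow_const (Or.inl h0.ne')).hasDerivWithinAt)
    (fun t ht u hu htu => by
      have h0 : 0 < τ * t := mul_pos hτ ht.1
      have h1 : 0 < τ * u := mul_pos hτ hu.1
      have := Real.rpow_left_injOn (x := -s) (neg_ne_zero.2 hs0.ne') h0.le h1.le htu
      exact mul_left_cancel₀ hτ.ne' this) (fun t => 1 / (1 + t ^ (α / 2)))
  rw [image_rpow_Ioo hτ hs0] at hcv
  rw [rho, ← hs, hcv, eulerIntegral, ← mul_assoc, ← integral_const_mul, ← integral_const_mul]
  congr 1
  refine setIntegral_congr_fun measurableSet_Ioo fun t ht => ?_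
  have ht0 := ht.1
  have h0 : 0 < τ * t := mul_pos hτ ht.1
  have h1 : ((τ * t) ^ (-s)) ^ (α / 2) = (τ * t)⁻¹ := by
    rw [← Real.rpow_mul h0.le, hs, ← Real.rpow_neg_one]
    congr 1
    field_simp
  have h2 : |τ * -s * (τ * t) ^ (-s - 1)| = τ * s * (τ * t) ^ (-s - 1) := by
    rw [mul_neg, neg_mul, abs_neg, abs_of_nonneg (by positivity)]
  have h3 : (τ * t) ^ (-s - 1) = τ ^ (-s) * t ^ (-s) / (τ * t) := by
    rw [Real.rpow_sub_one h0.ne', Real.mul_rpow hτ.le ht0.le]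
  have h4 : 2 * τ / (α - 2) * (1 - s) = τ * s := by
    have : α - 2 ≠ 0 := by linarith
    rw [hs]
    field_simp
  have h5 : τ ^ s * τ ^ (-s) = 1 := by rw [← Real.rpow_add hτ, add_neg_cancel, Real.rpow_zero]
  have h6 : (1 - s - 1) = -s := by ring
  simp only [smul_eq_mul]
  rw [h1, h2, h3, h4, h6]
  have h7 : 1 / (1 + (τ * t)⁻¹) = τ * t / (1 - -τ * t) := by
    have : 0 < τ * t + 1 := by positivity
    have : 0 < 1 + τ * t := by positivity
    rw [neg_mul, sub_neg_eq_add]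
    field_simp
    ring
  have h8 : 0 < 1 - -τ * t := by linarith
  rw [h7]
  calc τ ^ s * (τ * s * (τ ^ (-s) * t ^ (-s) / (τ * t)) * (τ * t / (1 - -τ * t)))
      = (τ ^ s * τ ^ (-s)) * (τ * s * (t ^ (-s) / (1 - -τ * t))) := by
        field_simp
    _ = _ := by rw [h5, one_mul]

/-! ### Isotropic offspring -/

namespace Params

variable (p : Params K₁ K₂)

/-- The reflection in the line orthogonal to z - z' exchanges two vectors of equal norm. It is an
isometry, so it preserves norms, Lebesgue measure and hence the isotropic offspring law. -/
lemma distLaw_eq_of_isotropic {j : K₁} (hj : p.Isotropic j) {z z' : Plane} (h : ‖z‖ = ‖z'‖) :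
    p.distLaw j z = p.distLaw j z' := by
  let R : Plane ≃ₗᵢ[ℝ] Plane := (Submodule.span ℝ {z - z'})ᗮ.reflection
  have hR : R z = z' := Submodule.reflection_sub h
  have hν : (p.offspring j).map R = p.offspring j := by
    refine Measure.ext fun s hs => ?_
    rw [Measure.map_apply R.continuous.measurable hs, offspring, withDensity_apply _ hs,
      withDensity_apply _ (R.continuous.measurable hs),
      ← R.measurePreserving.setLIntegral_comp_preimage hs (by
        have := p.g_measurable j
        fun_prop)]
    refine lintegral_congr fun x => ?_
    rw [hj (R x) x (R.norm_map x)]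
  have hm : Measurable fun s : Plane => ‖z' + s‖ := by fun_prop
  rw [distLaw, distLaw, ← hν, Measure.map_map hm R.continuous.measurable, hν]
  congr 1
  funext s
  rw [Function.comp_apply, ← hR, ← map_add, R.norm_map]

theorem fd_eq_of_isotropic {j : K₁} (hj : p.Isotropic j) {z z' : Plane} (h : ‖z‖ = ‖z'‖) (r : ℝ) :
    p.fd j r z = p.fd j r z' := by
  rw [fd_eq, fd_eq, p.distLaw_eq_of_isotropic hj h]

theorem C_eq_of_isotropic {j : K₁} (hj : p.Isotropic j) {z z' : Plane} (h : ‖z‖ = ‖z'‖)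
    (i : K₁ ⊕ K₂) (r : ℝ) : p.C j i r z = p.C j i r z' := by
  simp only [C, p.fd_eq_of_isotropic hj h]

end Params

end HetNet

end

/-! ### The conditional coverage probabilities -/

theorem mainTheorem3 {K₁ K₂ : Type*} [Fintype K₁] [DecidableEq K₁] [Fintype K₂]
    {Ω : Type*} [mΩ : MeasurableSpace Ω] (μ : Measure Ω) [IsProbabilityMeasure μ]
    (p : HetNet.Params K₁ K₂) (W : HetNet.Network μ p) :
    -- the conditional probabilities below are well defined
    (W.parentSigma ≤ mΩ ∧ ∀ i, MeasurableSet (W.coverage i)) ∧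
    -- the products and sums over the parent points converge
    (∀ᵐ ω ∂μ, ∀ j i,
      (∀ r, 0 < r → Multipliable fun n => p.C j i r (W.center j n ω)) ∧
      (∀ᵐ r : ℝ, 0 < r → Summable fun n => p.fd j r (W.center j n ω))) ∧
    -- tier `i` is a Poisson cluster process
    (∀ i : K₁, ∀ᵐ ω ∂μ,
      let integrand : ℝ → ℝ := fun r =>
        Real.exp (-(p.τ (.inl i) * p.N₀ * r ^ p.α / p.P (.inl i))) *
          (∏ j₁ ∈ Finset.univ.erase i, ∏' n, p.C j₁ (.inl i) r (W.center j₁ n ω)) *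
          (∏ j₂ : K₂, Real.exp (-(Real.pi * r ^ 2 * p.lam j₂ *
            p.Pbar (.inr j₂) (.inl i) ^ 2 * HetNet.rho (p.τ (.inl i)) p.α))) *
          ((∑' n, p.fd i r (W.center i n ω)) * ∏' n, p.C i (.inl i) r (W.center i n ω))
      IntegrableOn integrand (Set.Ioi 0) ∧
      (μ⟦W.coverage (.inl i) | W.parentSigma⟧) ω =
        p.mbar i * ∫ r in Set.Ioi (0 : ℝ), integrand r) ∧
    -- tier `i` is a Poisson process
    (∀ i : K₂, ∀ᵐ ω ∂μ,
      let integrand : ℝ → ℝ := fun r =>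
        Real.exp (-(p.τ (.inr i) * p.N₀ * r ^ p.α / p.P (.inr i))) *
          (∏ j₁ : K₁, ∏' n, p.C j₁ (.inr i) r (W.center j₁ n ω)) *
          (∏ j₂ : K₂, Real.exp (-(Real.pi * r ^ 2 * p.lam j₂ *
            p.Pbar (.inr j₂) (.inr i) ^ 2 * HetNet.rho (p.τ (.inr i)) p.α))) * r
      IntegrableOn integrand (Set.Ioi 0) ∧
      (μ⟦W.coverage (.inr i) | W.parentSigma⟧) ω =
        2 * Real.pi * p.lam i * ∫ r in Set.Ioi (0 : ℝ), integrand r) ∧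
    -- the closed form of `ρ(τ i, α)`
    (∀ i, ∃ F : ℝ → ℝ, HetNet.IsGaussHypergeometric 1 (1 - 2 / p.α) (2 - 2 / p.α) F ∧
      HetNet.rho (p.τ i) p.α = 1 + 2 * p.τ i / (p.α - 2) * F (-p.τ i)) ∧
    -- for isotropic offspring, the densities and `𝒞` depend on `z` only through its norm
    (∀ j, p.Isotropic j → ∀ z z' : HetNet.Plane, ‖z‖ = ‖z'‖ → ∀ r,
      p.fd j r z = p.fd j r z' ∧ ∀ i, p.C j i r z = p.C j i r z') := by
  have hcov := fun i => W.condExp_coverage i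
  refine ⟨⟨W.parentSigma_le, W.measurableSet_coverage⟩, ?_, fun i => ?_, fun i => ?_, fun i => ?_,
    fun j hj z z' h r => ⟨p.fd_eq_of_isotropic hj h r, fun i => p.C_eq_of_isotropic hj h i r⟩⟩
  · filter_upwards [W.ae_locallyFinite] with ω hω j i
    refine ⟨fun r hr => (p.hasProd_C j i hr (W.centers ω j)).multipliable, ?_⟩
    filter_upwards [p.ae_tsum_fd_ne_top hω j] with r hr _
    exact p.summable_fd (c := W.centers ω) hr
  · filter_upwards [hcov (.inl i)] with ω hω
    rw [hω.2]
    exact p.integrableOn_and_coverageProb_inl i hω.1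
  · filter_upwards [hcov (.inr i)] with ω hω
    rw [hω.2]
    exact p.integrableOn_and_coverageProb_inr i hω.1
  · have hb : 0 < 1 - 2 / p.α := by
      rw [sub_pos, div_lt_one p.α_pos]
      exact p.two_lt_α
    refine ⟨HetNet.eulerIntegral (1 - 2 / p.α), ?_,
      HetNet.rho_eq_eulerIntegral (p.τ_pos i) p.two_lt_α⟩
    have := HetNet.isGaussHypergeometric_eulerIntegral hb
    rwa [show 1 - 2 / p.α + 1 = 2 - 2 / p.α by ring] at this
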